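/- **Model.** Fix a depth $L\ge 1$ and $p_2\in(0,1)$, and put $p_3=1-p_2$. A grammar $G$ with vocabulary size $v$ has, for each level $\ell=1,\dots,L$, a set of binary rules $z\to(a,b)$ and a set of ternary rules $z\to(a,b,c)$ rewriting level-$(\ell-1)$ symbols $z\in[v]$ into level-$\ell$ symbols; each $z$ has exactly $m_2$ binary and $m_3$ ternary rules at each level, and two distinct symbols never generate the same tuple. The grammar is drawn uniformly at random, independently for the different levels and arities. Given $G$, a sentence $X_1\cdots X_d$ is generated from a uniformly distributed root $X^{(0)}\in[v]$ by applying $L$ times the following step: every symbol is independently rewritten, by a binary rule with probability $p_2$ and a ternary rule with probability $p_3$, the rule being uniform among those of that symbol and arity. Given the derivation, $I$ is uniform on $\{1,\dots,d-1\}$. The adjacent pair $(X_I,X_{I+1})$ has type *bin* (resp. *ter*) if both tokens are produced by the same application of a binary (resp. ternary) level-$L$ rule, and type *cross* otherwise; $p_{\rm bin},p_{\rm ter},p_{\rm cross}$ are the probabilities of the types (here $p_{\rm ter}$ counts both kinds of adjacent ternary siblings). Let $$C_2^{(L)}((a,b),\alpha)=\mathrm{Cov}\big(\mathbf 1\{(X_I,X_{I+1})=(a,b)\},\mathbf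 1\{X^{(0)}=\alpha\}\big),$$ let $R^{(L)}_{z\to(a,b)}$ be $1/m_2$ if $z\to(a,b)$ is a level-$L$ binary rule and $0$ otherwise, let $$C_1^{(L-1)}(z,\alpha)=\mathrm{Cov}\big(\mathbf 1\{Z=z\},\mathbf 1\{X^{(0)}=\alpha\}\,\big|\,\mathrm{bin}\big),$$ where $Z$ is the level-$(L-1)$ nonterminal that produces $X_I$, and let $\overline C_1^{(L-1)}(z,\alpha)=\mathrm{Cov}(\mathbf 1\{X^{(L-1)}_J=z\},\mathbf 1\{X^{(0)}=\alpha\})$, where $J$ is a uniformly random position of the level-$(L-1)$ string. Put $$B((a,b),\alpha)=p_{\rm bin}\sum_{z}R^{(L)}_{z\to(a,b)}C_1^{(L-1)}(z,\alpha),\qquad T_t((a,b),\alpha)=p_t\,\mathrm{Cov}\big(\mathbf 1\{(X_I,X_{I+1})=(a,b)\},\mathbf 1\{X^{(0)}=\alpha\}\,\big|\,t\big)$$ for $t\in\{\mathrm{ter},\mathrm{cross}\}$ (with $T_t=0$ if $p_t=0$). Call $(a,b)$ a *sibling pair of $z$* if $z\to(a,b)$ is a level-$L$ binary rule. **Statement.**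 1. For every grammar, $C_2^{(L)}=B+T_{\rm ter}+T_{\rm cross}$. 2. There is a constant $\kappa>0$ depending only on $L$ and $p_2$ such that the following holds. Let $f_2,f_3\in(0,1)$ and let $v\to\infty$ along any sequence, with $m_2/v\to f_2$ and $m_3/v^2\to f_3$. For every $\varepsilon>0$, with probability tending to $1$ over the draw of the grammar: * (lower order) for each of the four tensors $T=T_{\rm ter}$, $T=T_{\rm cross}$, $T=C_2^{(L)}-B$ and $T=C_2^{(L)}-\kappa\,p_{\rm bin}\sum_z R^{(L)}_{z\to(\cdot)}\overline C_1^{(L-1)}(z,\cdot)$, all $a,b,\alpha$, and all sibling pairs $(a',b')$, $$|T((a,b),\alpha)|\le \varepsilon\, v^{-1/2}\,\|B((a',b'),:)\|_2 ;$$ in particular $C_2^{(L)}((a,b),\alpha)\approx p_{\rm bin}\sum_z R^{(L)}_{z\to(a,b)}C_1^{(L-1)}(z,\alpha)$, with an error that is of lower order than the root-mean-square entry of the leading term at sibling pairs; * (clustering) for all sibling pairs $(a,b)$ the slices $B((a,b),:)$ and $C_2^{(L)}((a,b),:)$ are nonzero; the unit vectors in the directions of $C_2^{(L)}((a,b),:)$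 and $C_2^{(L)}((a',b'),:)$, for $(a,b)$ a sibling pair of $z$ and $(a',b')$ a sibling pair of $z'$, are at Euclidean distance at most $\varepsilon$ if $z=z'$ and at least $1$ if $z\ne z'$; * (other pairs) if $(a,b)$ is not a sibling pair and $(a',b')$ is one, then $\|C_2^{(L)}((a,b),:)\|_2\le\varepsilon\,\|C_2^{(L)}((a',b'),:)\|_2$. Hence the norms of the slices tell the sibling pairs from all other pairs, and their directions group the sibling pairs by the nonterminal that generates them, which identifies the level-$L$ binary rules. -/

import Mathlib

open MeasureTheory ProbabilityTheory Filter Topology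
open scoped ENNReal

noncomputable section

namespace RHM

/-- The production rules of one level: every one of the `v` parent symbols gets `m₂` binary and
`m₃` ternary right-hand sides. Injectivity says both that the rules of one symbol are distinct
(sampling without replacement) and that distinct symbols never generate the same tuple. -/
abbrev Rules (v m₂ m₃ : ℕ) : Type :=
  ((Fin v × Fin m₂) ↪ Fin v × Fin v) × ((Fin v × Fin m₃) ↪ Fin v × Fin v × Fin v)

/-- A grammar of uniform depth `L`: the entry `i : Fin L` holds the level-`(i+1)` rules, which
rewrite level-`i` symbols as tuples of level-`(i+1)` symbols. -/
abbrev Grammar (L v m₂ m₃ : ℕ) : Type := Fin L → Rules v m₂ m₃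

/-- Probability of a set of grammars when the rules of all levels and both arities are drawn
independently and uniformly at random, i.e. under the uniform law on `Grammar L v m₂ m₃`. -/
def grammarProb {L v m₂ m₃ : ℕ} (S : Set (Grammar L v m₂ m₃)) : ℝ :=
  (Nat.card S : ℝ) / (Nat.card (Grammar L v m₂ m₃) : ℝ)

/-- One application of a rule: the parent symbol together with its ordered children. -/
inductive Production (v : ℕ) : Type
  | bin (z a b : Fin v) : Production v
  | ter (z a b c : Fin v) : Production v

/-- The string of children of a production. -/
def Production.word {v : ℕ} : Production v → List (Fin v)
  | .bin _ a b => [a, b]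
  | .ter _ a b c => [a, b, c]

/-- The string obtained by concatenating the children of consecutive productions. -/
def yieldOf {v : ℕ} (bs : List (Production v)) : List (Fin v) := bs.flatMap Production.word

/-- The law of the arity: binary (`true`) with probability `p₂`, ternary with `1 - p₂`. -/
def arityLaw (p₂ : unitInterval) : PMF Bool :=
  PMF.ofFintype (fun s => ENNReal.ofReal (if s then (p₂ : ℝ) else 1 - (p₂ : ℝ))) (by
    have h0 : (0 : ℝ) ≤ p₂ := p₂.2.1
    have h1 : (0 : ℝ) ≤ 1 - (p₂ : ℝ) := sub_nonneg.2 p₂.2.2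
    simp only [Fintype.sum_bool, if_true, Bool.false_eq_true, if_false]
    rw [← ENNReal.ofReal_add h0 h1]
    simp)

section Laws

variable {v m₂ m₃ : ℕ}

/-- Random rewriting of one symbol `z`: draw the arity, then one of the rules of `z` of that arity
uniformly at random. -/
def expandLaw [NeZero m₂] [NeZero m₃] (p₂ : unitInterval) (R : Rules v m₂ m₃) (z : Fin v) :
    PMF (Production v) :=
  (arityLaw p₂).bind fun s =>
    if s then
      (PMF.uniformOfFintype (Fin m₂)).map fun j => .bin z (R.1 (z, j)).1 (R.1 (z, j)).2
    else
      (PMF.uniformOfFintype (Fin m₃)).map fun j =>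
        .ter z (R.2 (z, j)).1 (R.2 (z, j)).2.1 (R.2 (z, j)).2.2

/-- Independent rewriting of all symbols of a string. -/
def rewriteLaw [NeZero m₂] [NeZero m₃] (p₂ : unitInterval) (R : Rules v m₂ m₃) :
    List (Fin v) → PMF (List (Production v))
  | [] => PMF.pure []
  | z :: zs => (expandLaw p₂ R z).bind fun b => (rewriteLaw p₂ R zs).map fun bs => b :: bs

/-- Joint law of the root, uniform on the `v` symbols, and of the string of level-`ℓ` symbols. -/
def stringLaw [NeZero v] [NeZero m₂] [NeZero m₃] (p₂ : unitInterval) :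
    (ℓ : ℕ) → Grammar ℓ v m₂ m₃ → PMF (Fin v × List (Fin v))
  | 0, _ => (PMF.uniformOfFintype (Fin v)).map fun α => (α, [α])
  | ℓ + 1, G => (stringLaw p₂ ℓ (Fin.init G)).bind fun s =>
      (rewriteLaw p₂ (G (Fin.last ℓ)) s.2).map fun bs => (s.1, yieldOf bs)

/-- The uniform law on the positions `0, …, N - 1` (used only for `0 < N`). -/
def positionLaw (N : ℕ) : PMF ℕ :=
  if h : (Finset.range N).Nonempty then PMF.uniformOfFinset (Finset.range N) h else PMF.pure 0

end Laws

/-- Outcome of a random draw: the root, the last-level productions from left to right, and the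
(zero-based) position of an adjacent pair in the sentence. -/
structure Draw (v : ℕ) : Type where
  root : Fin v
  productions : List (Production v)
  pos : ℕ

instance (v : ℕ) : MeasurableSpace (Draw v) := ⊤

/-- Outcome of a random draw: the root, and the symbol at a random position of a string. -/
structure SymbolDraw (v : ℕ) : Type where
  root : Fin v
  symbol : Option (Fin v)

instance (v : ℕ) : MeasurableSpace (SymbolDraw v) := ⊤

/-- Local topology of an adjacent pair: the lowest common ancestor is a parent of tokens rewritten
by a binary rule, or by a ternary rule, or it lies higher in the tree. -/
inductive PairType : Type
  | bin
  | ter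
  | cross

/-- The type of the pair of tokens at positions `i, i + 1`. -/
def pairTypeAt {v : ℕ} : List (Production v) → ℕ → PairType
  | [], _ => .cross
  | .bin _ _ _ :: _, 0 => .bin
  | .bin _ _ _ :: _, 1 => .cross
  | .bin _ _ _ :: bs, i + 2 => pairTypeAt bs i
  | .ter _ _ _ _ :: _, 0 => .ter
  | .ter _ _ _ _ :: _, 1 => .ter
  | .ter _ _ _ _ :: _, 2 => .cross
  | .ter _ _ _ _ :: bs, i + 3 => pairTypeAt bs i

/-- The symbol whose production contains the token at position `i`. -/
def parentAt {v : ℕ} : List (Production v) → ℕ → Option (Fin v)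
  | [], _ => none
  | .bin z _ _ :: _, 0 => some z
  | .bin z _ _ :: _, 1 => some z
  | .bin _ _ _ :: bs, i + 2 => parentAt bs i
  | .ter z _ _ _ :: _, 0 => some z
  | .ter z _ _ _ :: _, 1 => some z
  | .ter z _ _ _ :: _, 2 => some z
  | .ter _ _ _ _ :: bs, i + 3 => parentAt bs i

namespace Draw

variable {v : ℕ}

/-- The event that the selected pair of adjacent tokens is `(a, b)`. -/
def pairEvent (a b : Fin v) : Set (Draw v) :=
  {ω | (yieldOf ω.productions)[ω.pos]? = some a ∧ (yieldOf ω.productions)[ω.pos + 1]? = some b}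

/-- The event that the selected pair has type `t`. -/
def typeEvent (t : PairType) : Set (Draw v) := {ω | pairTypeAt ω.productions ω.pos = t}

/-- The event that the first token of the selected pair was produced by `z`. -/
def parentEvent (z : Fin v) : Set (Draw v) := {ω | parentAt ω.productions ω.pos = some z}

/-- The event that the root is `α`. -/
def rootEvent (α : Fin v) : Set (Draw v) := {ω | ω.root = α}

end Draw

/-- The real-valued indicator of an event. -/
def ind {Ω : Type*} (A : Set Ω) : Ω → ℝ := A.indicator fun _ => 1

/-- `(a, b)` is the right-hand side of a last-level binary rule of the nonterminal `z`. -/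
def IsBinaryRule {n v m₂ m₃ : ℕ} (G : Grammar (n + 1) v m₂ m₃) (z a b : Fin v) :
    Prop :=
  ∃ j : Fin m₂, (G (Fin.last n)).1 (z, j) = (a, b)

open Classical in
/-- The probability of the last-level rule `z → (a, b)` among the binary rules of `z`. -/
def binaryRuleProb {n v m₂ m₃ : ℕ} (G : Grammar (n + 1) v m₂ m₃) (z a b : Fin v) : ℝ :=
  if IsBinaryRule G z a b then 1 / (m₂ : ℝ) else 0

section Covariances

variable {n v m₂ m₃ : ℕ} [NeZero v] [NeZero m₂] [NeZero m₃]

/-- The law of a sentence of a grammar of depth `n + 1`, with its root, its last-level productions,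
and a position that is uniform among the `d - 1` adjacent pairs of a sentence of length `d`. -/
def drawMeasure (p₂ : unitInterval) (G : Grammar (n + 1) v m₂ m₃) : Measure (Draw v) :=
  PMF.toMeasure
    ((stringLaw p₂ n (Fin.init G)).bind fun s =>
      (rewriteLaw p₂ (G (Fin.last n)) s.2).bind fun bs =>
        (positionLaw ((yieldOf bs).length - 1)).map fun i => (⟨s.1, bs, i⟩ : Draw v))

/-- The law of the root and of the symbol at a uniformly random position of the level-`ℓ`
string. -/
def symbolMeasure {ℓ : ℕ} (p₂ : unitInterval) (G : Grammar ℓ v m₂ m₃) : Measure (SymbolDraw v) :=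
  PMF.toMeasure
    ((stringLaw p₂ ℓ G).bind fun s =>
      (positionLaw s.2.length).map fun i => (⟨s.1, s.2[i]?⟩ : SymbolDraw v))

/-- The root-to-pair covariance. -/
def pairCov (p₂ : unitInterval) (G : Grammar (n + 1) v m₂ m₃) (a b α : Fin v) : ℝ :=
  cov[ind (Draw.pairEvent a b), ind (Draw.rootEvent α); drawMeasure p₂ G]

/-- The probability that the selected adjacent pair has type `t`. -/
def typeProb (p₂ : unitInterval) (G : Grammar (n + 1) v m₂ m₃) (t : PairType) : ℝ :=
  (drawMeasure p₂ G).real (Draw.typeEvent t)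

/-- The contribution of the pairs of type `t` to the root-to-pair covariance: the probability of
the type times the covariance conditional on the type. -/
def typeContribution (p₂ : unitInterval) (G : Grammar (n + 1) v m₂ m₃) (t : PairType)
    (a b α : Fin v) : ℝ :=
  typeProb p₂ G t *
    cov[ind (Draw.pairEvent a b), ind (Draw.rootEvent α); (drawMeasure p₂ G)[|Draw.typeEvent t]]

/-- The root-to-nonterminal covariance at the last nonterminal level, for the nonterminal that
produces the selected pair, given that the pair consists of binary siblings. -/
def parentCov (p₂ : unitInterval) (G : Grammar (n + 1) v m₂ m₃) (z α : Fin v) : ℝ :=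
  cov[ind (Draw.parentEvent z), ind (Draw.rootEvent α);
    (drawMeasure p₂ G)[|Draw.typeEvent PairType.bin]]

/-- The root-to-symbol covariance at level `ℓ`, for the symbol at a uniformly random position of
the level-`ℓ` string. -/
def symbolCov {ℓ : ℕ} (p₂ : unitInterval) (G : Grammar ℓ v m₂ m₃) (z α : Fin v) : ℝ :=
  cov[ind {ω : SymbolDraw v | ω.symbol = some z}, ind {ω : SymbolDraw v | ω.root = α};
    symbolMeasure p₂ G]

/-- `p_bin ∑_z R_{z → (a, b)} C(z, α)` for a root-to-nonterminal covariance matrix `C`. -/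
def binaryTerm (p₂ : unitInterval) (G : Grammar (n + 1) v m₂ m₃) (C : Fin v → Fin v → ℝ)
    (a b α : Fin v) : ℝ :=
  typeProb p₂ G PairType.bin * ∑ z : Fin v, binaryRuleProb G z a b * C z α

end Covariances

/-- The slice `T((a, b), :)` as a Euclidean vector. -/
def slice {v : ℕ} (T : Fin v → Fin v → Fin v → ℝ) (a b : Fin v) : EuclideanSpace ℝ (Fin v) :=
  WithLp.toLp 2 fun α => T a b α

/-- The unit vector in the direction of the slice `T((a, b), :)`. -/
def unitSlice {v : ℕ} (T : Fin v → Fin v → Fin v → ℝ) (a b : Fin v) : EuclideanSpace ℝ (Fin v) :=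
  ‖slice T a b‖⁻¹ • slice T a b

/-- Every entry of `T` is at most `ε` times the root-mean-square entry of the slice of the
leading binary term at any pair of binary siblings. -/
def LowerOrder {n v m₂ m₃ : ℕ} [NeZero v] [NeZero m₂] [NeZero m₃] (ε : ℝ) (p₂ : unitInterval)
    (G : Grammar (n + 1) v m₂ m₃) (T : Fin v → Fin v → Fin v → ℝ) : Prop :=
  ∀ a b α z a' b' : Fin v, IsBinaryRule G z a' b' →
    |T a b α| ≤ ε * (‖slice (binaryTerm p₂ G (parentCov p₂ G)) a' b'‖ / √(v : ℝ))

end RHM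

end

noncomputable section

namespace RHM

/-! The arities of a derivation are independent of its symbols. Hence the type of the selected pair
is independent of the root, and the law of total covariance has no term between types: this is the
exact decomposition (`pairCov_eq_sum`). A binary pair depends on the root only through its parent,
which identifies its contribution (`binaryTerm_parentCov`). For the same reason an expectation given
the root is a sum over words of arities, one letter for each level on the line down from the root,
of products of the averaging operators of the rules. The weights of the words depend only on `p₂`
and on the weight given to the length (`symFun`, `pairFun`, `drawMeasure_real_eq`).

It remains to measure products of random operators. Freeze all levels but one. The influence of the
root coming from above (`row`) is a vector of sum zero, the function pulled back from below (`leaf`)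
is a fixed function of the children, and the rules of the level enter through a linear statistic of
a uniformly random injection. The vanishing sum cancels the constant part of the function, so the
statistic is, up to a factor `v ^ δ`, of the order of its standard deviation
(`linear_statistic_whp`). The proof exposes the injection value by value and bounds exponential
moments; the drift of sampling without replacement is controlled by truncation. Consequently a
binary level shrinks the norm of the influence by about `√v`, and a ternary level, which averages
over about `v ^ 2` rules, by about `v` (`Typical.sqrt_nsq_row_le`).

The leading term also needs a lower bound. For a fixed vector, the squared norm of its centered
image under the binary rules concentrates at `2 / m₂` times the centered squared norm
(`quadratic_statistic_whp`). Applied to the pull-back of the indicator of one symbol, and to sums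
and differences for two symbols, this shows that the all-binary pull-backs to the root are nearly
orthogonal for distinct symbols, with squared norms bounded below on the same scale
(`Typical.binLeaf_geometry`).

Now compare sizes, with `L = n + 1`. The slice at a sibling pair of `z` is a scalar multiple of the
all-binary pull-back of the indicator of `z`, with entries of order `v⁻¹ * √v ^ (-(n + 3))`, up to
errors from three sources: words with a ternary letter (`Typical.abs_row_le`), pairs of ternary
siblings (`Typical.abs_ter_le`) and cross pairs (`Typical.abs_cross_le`). For a cross pair the two
leaf functions are constants plus small fluctuations, and the product of the constants cancels. All
three errors are at most of order `v⁻¹ * √v ^ (-(n + 4))` times a factor `q ^ (n + 2)`, which a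
small `δ` keeps at order `v ^ (1 / 4)`. Since the error is smaller than the leading term, clustering
follows from near orthogonality. The covariance at a uniformly random position has the same
all-binary vector with another weight; the ratio of the weights gives `κ = covRatio p₂ n`.

Only `O(v ^ 3)` statistics occur and each fails with probability `O(v ^ (-6))`, so a union bound
suffices (`typical_whp`). -/

open Classical in
/-- The fraction of the elements of a finite type that satisfy `P`. -/
def frac {X : Type*} [Fintype X] (P : X → Prop) : ℝ :=
  ((Finset.univ.filter P).card : ℝ) / (Fintype.card X : ℝ)

/-! ### Counting probability: union bounds, Markov bounds, conditioning on coordinates. -/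

section Frac

variable {X Y : Type*} [Fintype X] [Fintype Y]

lemma frac_eq_sum (P : X → Prop) [DecidablePred P] :
    frac P = (∑ x, if P x then (1 : ℝ) else 0) / Fintype.card X := by
  unfold frac
  congr 1
  rw [Finset.sum_boole]
  congr!

lemma frac_mono {P Q : X → Prop} (h : ∀ x, P x → Q x) : frac P ≤ frac Q := by
  classical
  rw [frac_eq_sum, frac_eq_sum]
  refine div_le_div_of_nonneg_right (Finset.sum_le_sum fun x _ => ?_) (by positivity)
  have := h x
  split_ifs <;> simp_all

lemma frac_exists_le {ι : Type*} [Fintype ι] (P : ι → X → Prop) (b : ℝ)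
    (h : ∀ i, frac (P i) ≤ b) : frac (fun x => ∃ i, P i x) ≤ Fintype.card ι * b := by
  classical
  have h1 : frac (fun x => ∃ i, P i x) ≤ ∑ i, frac (P i) := by
    simp_rw [frac_eq_sum]
    rw [← Finset.sum_div]
    refine div_le_div_of_nonneg_right ?_ (by positivity)
    rw [Finset.sum_comm]
    refine Finset.sum_le_sum fun x _ => ?_
    split_ifs with hx
    · obtain ⟨i, hi⟩ := hx
      have := Finset.single_le_sum (f := fun i => if P i x then (1 : ℝ) else 0)
        (fun i _ => by split_ifs <;> simp) (Finset.mem_univ i)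
      simpa [hi] using this
    · exact Finset.sum_nonneg fun i _ => by split_ifs <;> simp
  refine h1.trans ((Finset.sum_le_sum fun i _ => h i).trans ?_)
  simp

lemma frac_or_le (P Q : X → Prop) : frac (fun x => P x ∨ Q x) ≤ frac P + frac Q := by
  classical
  simp_rw [frac_eq_sum]
  rw [← add_div, ← Finset.sum_add_distrib]
  refine div_le_div_of_nonneg_right (Finset.sum_le_sum fun x _ => ?_) (by positivity)
  by_cases h1 : P x <;> by_cases h2 : Q x <;> simp [h1, h2]

/-- Markov's inequality for `exp Z`. -/
lemma frac_le_of_exp_moment (Z : X → ℝ) (C t : ℝ)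
    (h : ∑ x, Real.exp (Z x) ≤ Fintype.card X * Real.exp C) :
    frac (fun x => t ≤ Z x) ≤ Real.exp (C - t) := by
  classical
  unfold frac
  rcases Nat.eq_zero_or_pos (Fintype.card X) with h0 | h0
  · rw [h0]; simp; positivity
  have h0' : (0 : ℝ) < Fintype.card X := by exact_mod_cast h0
  rw [div_le_iff₀ h0', Real.exp_sub, div_mul_eq_mul_div, le_div_iff₀ (Real.exp_pos t), mul_comm (Real.exp C)]
  refine le_trans ?_ h
  rw [← nsmul_eq_mul]
  refine le_trans (Finset.card_nsmul_le_sum (Finset.univ.filter fun x => t ≤ Z x)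
    (fun x => Real.exp (Z x)) _ fun x hx => ?_) ?_
  · simp only [Finset.mem_filter] at hx
    exact Real.exp_le_exp.2 hx.2
  · exact Finset.sum_le_sum_of_subset_of_nonneg (Finset.filter_subset _ _)
      fun _ _ _ => (Real.exp_pos _).le

lemma frac_abs_le_of_exp_moment (Z : X → ℝ) (C t : ℝ)
    (h : ∑ x, Real.exp (Z x) ≤ Fintype.card X * Real.exp C)
    (h' : ∑ x, Real.exp (-Z x) ≤ Fintype.card X * Real.exp C) :
    frac (fun x => t ≤ |Z x|) ≤ 2 * Real.exp (C - t) := by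
  have h1 := frac_le_of_exp_moment Z C t h
  have h2 := frac_le_of_exp_moment (fun x => -Z x) C t h'
  refine le_trans (frac_mono fun x hx => ?_)
    ((frac_or_le (fun x => t ≤ Z x) (fun x => t ≤ -Z x)).trans (by linarith))
  exact le_abs.1 hx

/-- Conditioning: a bound that is uniform in the frozen coordinate survives averaging over it. -/
lemma frac_prod_left {P : X × Y → Prop} {b : ℝ} (hb : 0 ≤ b)
    (h : ∀ y, frac (fun x => P (x, y)) ≤ b) : frac P ≤ b := by
  classical
  have h' : ∀ y, (∑ x, if P (x, y) then (1 : ℝ) else 0) ≤ b * Fintype.card X := fun y => by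
    have := h y
    rw [frac_eq_sum] at this
    rcases Nat.eq_zero_or_pos (Fintype.card X) with h0 | h0
    · have := Fintype.card_eq_zero_iff.1 h0
      simp
    · rwa [div_le_iff₀ (by exact_mod_cast h0)] at this
  rw [frac_eq_sum]
  refine div_le_of_le_mul₀ (by positivity) hb ?_
  rw [Fintype.sum_prod_type_right]
  refine (Finset.sum_le_sum fun y _ => h' y).trans ?_
  rw [Finset.sum_const, Fintype.card_prod]
  simp
  apply le_of_eq; ring

lemma frac_congr_equiv (e : X ≃ Y) (P : Y → Prop) : frac (fun x => P (e x)) = frac P := by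
  classical
  rw [frac_eq_sum, frac_eq_sum, Fintype.card_congr e]
  congr 1
  exact Fintype.sum_equiv e _ _ fun _ => rfl

lemma frac_prod_right {P : X × Y → Prop} {b : ℝ} (hb : 0 ≤ b)
    (h : ∀ x, frac (fun y => P (x, y)) ≤ b) : frac P ≤ b := by
  rw [← frac_congr_equiv (Equiv.prodComm Y X)]
  exact frac_prod_left hb h

/-- This is how the independence of the levels is used: one level is resampled while all others are
frozen, and only a bound uniform in the frozen ones is needed. -/
lemma frac_le_of_update {ι : Type*} [Fintype ι] [DecidableEq ι] (P : (ι → X) → Prop) (i : ι)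
    {b : ℝ} (hb : 0 ≤ b) (h : ∀ G, frac (fun r => P (Function.update G i r)) ≤ b) :
    frac P ≤ b := by
  classical
  rw [← frac_congr_equiv (Equiv.funSplitAt i X).symm]
  refine frac_prod_left hb fun y => ?_
  -- A point of `X` is needed only to fill the coordinate that the update overwrites.
  rcases isEmpty_or_nonempty X with hX | ⟨⟨x0⟩⟩
  · simp [frac, hb]
  convert h ((Equiv.funSplitAt i X).symm (x0, y)) using 3 with r
  apply iff_of_eq
  congr 1
  ext j
  by_cases hj : j = i
  · subst hj; simp [Equiv.funSplitAt, Equiv.piSplitAt]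
  · simp [Equiv.funSplitAt, Equiv.piSplitAt, hj]

lemma frac_compl (P : X → Prop) [Nonempty X] : frac (fun x => ¬ P x) = 1 - frac P := by
  classical
  rw [frac_eq_sum, frac_eq_sum, eq_sub_iff_add_eq, ← add_div, ← Finset.sum_add_distrib]
  have : ∀ x, ((if ¬ P x then (1 : ℝ) else 0) + if P x then (1 : ℝ) else 0) = 1 := fun x => by
    by_cases h : P x <;> simp [h]
  rw [Finset.sum_congr rfl fun x _ => this x]
  simp

end Frac

/-! ### Exponential moments along a uniformly random injection. -/

section Injections

variable {S U : Type*} [Fintype S] [Fintype U] [DecidableEq U]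

/-- Given its values on `A`, a uniformly random injection maps a further point to a uniformly
random point outside the image of `A`. -/
lemma sum_embedding_exchange (A : Finset S) (s₀ : S) (hs : s₀ ∉ A) (H : (S ↪ U) → U → ℝ)
    (hH : ∀ φ ψ : S ↪ U, (∀ s ∈ A, φ s = ψ s) → H φ = H ψ) :
    ((Fintype.card U : ℝ) - A.card) * ∑ φ, H φ (φ s₀) =
      ∑ φ : S ↪ U, ∑ u ∈ Finset.univ \ A.map φ, H φ u := by
  have hl : ((Fintype.card U : ℝ) - A.card) * ∑ φ, H φ (φ s₀)
      = ∑ φ : S ↪ U, ∑ u ∈ Finset.univ \ A.map φ, H φ (φ s₀) := by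
    rw [Finset.mul_sum]
    refine Finset.sum_congr rfl fun φ _ => ?_
    rw [Finset.sum_const, nsmul_eq_mul, Finset.card_sdiff_of_subset (Finset.subset_univ _),
      Finset.card_map, Nat.cast_sub, Finset.card_univ]
    rw [← Finset.card_map φ]; exact Finset.card_le_univ _
  rw [hl, Finset.sum_sigma', Finset.sum_sigma']
  have key : ∀ (φ : S ↪ U) (u : U), u ∉ A.map φ → ∀ s ∈ A,
      (φ.trans (Equiv.swap (φ s₀) u).toEmbedding) s = φ s := by
    intro φ u hu s hsA
    simp only [Function.Embedding.trans_apply, Equiv.coe_toEmbedding]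
    apply Equiv.swap_apply_of_ne_of_ne
    · intro h; exact hs (φ.injective h ▸ hsA)
    · rintro rfl; exact hu (Finset.mem_map_of_mem _ hsA)
  -- Exchanging the value at `s₀` with `u` is an involution on the pairs `(φ, u)` with `u` outside
  -- the image of `A`. It does not change `φ` on `A`, hence not `H φ`.
  refine Finset.sum_nbij' (fun p => ⟨p.1.trans (Equiv.swap (p.1 s₀) p.2).toEmbedding, p.1 s₀⟩)
    (fun p => ⟨p.1.trans (Equiv.swap (p.1 s₀) p.2).toEmbedding, p.1 s₀⟩) ?_ ?_ ?_ ?_ ?_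
  · rintro ⟨φ, u⟩ h
    simp only [Finset.mem_sigma, Finset.mem_univ, Finset.mem_sdiff, true_and] at h ⊢
    rw [Finset.mem_map]
    rintro ⟨s, hsA, h2⟩
    rw [key φ u h s hsA] at h2
    exact hs (φ.injective h2 ▸ hsA)
  · rintro ⟨φ, u⟩ h
    simp only [Finset.mem_sigma, Finset.mem_univ, Finset.mem_sdiff, true_and] at h ⊢
    rw [Finset.mem_map]
    rintro ⟨s, hsA, h2⟩
    rw [key φ u h s hsA] at h2
    exact hs (φ.injective h2 ▸ hsA)
  · rintro ⟨φ, u⟩ h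
    simp only [Function.Embedding.trans_apply, Equiv.coe_toEmbedding, Equiv.swap_apply_left]
    congr 1
    ext s
    simp [Equiv.swap_comm u]
  · rintro ⟨φ, u⟩ h
    simp only [Function.Embedding.trans_apply, Equiv.coe_toEmbedding, Equiv.swap_apply_left]
    congr 1
    ext s
    simp [Equiv.swap_comm u]
  · rintro ⟨φ, u⟩ h
    simp only [Finset.mem_sigma, Finset.mem_univ, Finset.mem_sdiff, true_and] at h
    simp only
    rw [hH _ φ (key φ u h)]

lemma exp_le_one_add_sq {x : ℝ} (h : |x| ≤ 1) : Real.exp x ≤ 1 + x + x ^ 2 := by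
  have := Real.abs_exp_sub_one_sub_id_le h
  linarith [(abs_le.1 this).2]

/-- One exposure step for the exponential moment of a statistic of a random injection. -/
lemma sum_exp_exposure_le (c : U → ℝ) (hc : ∑ u, c u = 0) (A : Finset S) (s₀ : S) (hs : s₀ ∉ A)
    (hcard : A.card < Fintype.card U) (F f : (S ↪ U) → ℝ) (hF0 : ∀ φ, 0 ≤ F φ)
    (hF : ∀ φ ψ : S ↪ U, (∀ s ∈ A, φ s = ψ s) → F φ = F ψ)
    (hf : ∀ φ ψ : S ↪ U, (∀ s ∈ A, φ s = ψ s) → f φ = f ψ)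
    (hfc : ∀ φ u, |f φ * c u| ≤ 1) :
    ∑ φ, F φ * Real.exp (f φ * c (φ s₀)) ≤
      ∑ φ, F φ * Real.exp ((f φ * (-∑ s ∈ A, c (φ s)) + f φ ^ 2 * ∑ u, c u ^ 2) /
        (Fintype.card U - A.card)) := by
  have hpos : (0 : ℝ) < (Fintype.card U : ℝ) - A.card := by
    rw [sub_pos]; exact_mod_cast hcard
  have h1 := sum_embedding_exchange A s₀ hs (fun φ u => F φ * Real.exp (f φ * c u))
    (fun φ ψ h => by simp only [hF φ ψ h, hf φ ψ h])
  refine le_of_mul_le_mul_left ?_ hpos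
  rw [h1, Finset.mul_sum]
  refine Finset.sum_le_sum fun φ _ => ?_
  rw [← Finset.mul_sum, mul_left_comm]
  refine mul_le_mul_of_nonneg_left ?_ (hF0 φ)
  have h2 : ∑ u ∈ Finset.univ \ A.map φ, Real.exp (f φ * c u)
      ≤ ∑ u ∈ Finset.univ \ A.map φ, (1 + f φ * c u + (f φ * c u) ^ 2) :=
    Finset.sum_le_sum fun u _ => exp_le_one_add_sq (hfc φ u)
  refine h2.trans ?_
  have hcd : ((Finset.univ \ A.map φ).card : ℝ) = (Fintype.card U : ℝ) - A.card := by
    rw [Finset.card_sdiff_of_subset (Finset.subset_univ _),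
      Finset.card_map, Nat.cast_sub, Finset.card_univ]
    rw [← Finset.card_map φ]; exact Finset.card_le_univ _
  -- As `c` sums to zero, the values still available sum to minus the values already drawn. This
  -- drift is the effect of sampling without replacement.
  have h3 : ∑ u ∈ Finset.univ \ A.map φ, c u = -∑ s ∈ A, c (φ s) := by
    have := Finset.sum_sdiff (f := c) (Finset.subset_univ (A.map φ))
    rw [hc, Finset.sum_map] at this
    linarith
  have h4 : ∑ u ∈ Finset.univ \ A.map φ, c u ^ 2 ≤ ∑ u, c u ^ 2 :=
    Finset.sum_le_sum_of_subset_of_nonneg (Finset.subset_univ _) fun _ _ _ => sq_nonneg _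
  have h5 : ∑ u ∈ Finset.univ \ A.map φ, (1 + f φ * c u + (f φ * c u) ^ 2)
      ≤ ((Fintype.card U : ℝ) - A.card) + (f φ * (-∑ s ∈ A, c (φ s)) + f φ ^ 2 * ∑ u, c u ^ 2) := by
    rw [Finset.sum_add_distrib, Finset.sum_add_distrib, ← Finset.mul_sum, h3, Finset.sum_const,
      nsmul_eq_mul, mul_one, hcd]
    simp_rw [mul_pow]
    rw [← Finset.mul_sum]
    nlinarith [mul_le_mul_of_nonneg_left h4 (sq_nonneg (f φ))]
  refine h5.trans ?_
  set X := f φ * (-∑ s ∈ A, c (φ s)) + f φ ^ 2 * ∑ u, c u ^ 2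
  have := Real.add_one_le_exp (X / ((Fintype.card U : ℝ) - A.card))
  calc ((Fintype.card U : ℝ) - A.card) + X
      = ((Fintype.card U : ℝ) - A.card) * (X / ((Fintype.card U : ℝ) - A.card) + 1) := by
        field_simp; ring
    _ ≤ _ := mul_le_mul_of_nonneg_left this hpos.le

variable [DecidableEq S]

/-- Exponential moments of the sum of a centered function over a random sample drawn without
replacement. -/
lemma sum_exp_sample_le (c : U → ℝ) (hc : ∑ u, c u = 0)
    (hcard : Fintype.card S < Fintype.card U) (A : Finset S) (r : ℝ)
    (hr : ∀ u, |r * c u| ≤ 1) :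
    ∑ φ : S ↪ U, Real.exp (r * ∑ s ∈ A, c (φ s)) ≤ Fintype.card (S ↪ U) *
      Real.exp (r ^ 2 * A.card * (∑ u, c u ^ 2) / (Fintype.card U - Fintype.card S)) := by
  have hpos : (0 : ℝ) < (Fintype.card U : ℝ) - Fintype.card S := by
    rw [sub_pos]; exact_mod_cast hcard
  induction A using Finset.induction_on generalizing r with
  | empty => simp
  | insert s₀ A hs ih =>
    have hAS : (A.card : ℝ) + 1 ≤ Fintype.card S := by
      have := Finset.card_le_univ (insert s₀ A)
      rw [Finset.card_insert_of_notMem hs] at this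
      exact_mod_cast this
    have hAU : A.card < Fintype.card U := by
      have : (A.card : ℝ) < Fintype.card U := by linarith
      exact_mod_cast this
    set D : ℝ := (Fintype.card U : ℝ) - A.card with hD
    have hD1 : 1 ≤ D := by linarith
    have step := sum_exp_exposure_le c hc A s₀ hs hAU (fun φ => Real.exp (r * ∑ s ∈ A, c (φ s)))
      (fun _ => r) (fun _ => (Real.exp_pos _).le)
      (fun φ ψ h => by rw [Finset.sum_congr rfl fun s hs => by rw [h s hs]])
      (fun _ _ _ => rfl) (fun _ u => hr u)
    have e1 : ∀ φ : S ↪ U, Real.exp (r * ∑ s ∈ insert s₀ A, c (φ s))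
        = Real.exp (r * ∑ s ∈ A, c (φ s)) * Real.exp (r * c (φ s₀)) := fun φ => by
      rw [Finset.sum_insert hs, ← Real.exp_add]; congr 1; ring
    simp_rw [e1]
    refine step.trans ?_
    -- The drift multiplies the coefficient of the earlier draws by `1 - 1 / D`, a contraction; this
    -- is why the induction is over all `r`.
    set r' := r * (1 - 1 / D) with hr'
    set Q := ∑ u, c u ^ 2 with hQ
    have hQ0 : 0 ≤ Q := Finset.sum_nonneg fun _ _ => sq_nonneg _
    have e2 : ∀ φ : S ↪ U, Real.exp (r * ∑ s ∈ A, c (φ s)) *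
        Real.exp ((r * (-∑ s ∈ A, c (φ s)) + r ^ 2 * Q) / D)
        = Real.exp (r' * ∑ s ∈ A, c (φ s)) * Real.exp (r ^ 2 * Q / D) := fun φ => by
      rw [← Real.exp_add, ← Real.exp_add]; congr 1; rw [hr']; ring
    refine (Finset.sum_congr rfl fun φ _ => e2 φ).le.trans ?_
    rw [← Finset.sum_mul]
    have hfac : |1 - 1 / D| ≤ 1 := by
      have : 1 / D ≤ 1 := by rw [div_le_one (by linarith)]; exact hD1
      have : 0 ≤ 1 / D := by positivity
      rw [abs_le]; constructor <;> linarith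
    have hrr : |r'| ≤ |r| := by
      rw [hr', abs_mul]; exact mul_le_of_le_one_right (abs_nonneg _) hfac
    have ih' := ih r' fun u => by
      refine le_trans ?_ (hr u)
      rw [abs_mul r' (c u), abs_mul r (c u)]
      exact mul_le_mul_of_nonneg_right hrr (abs_nonneg _)
    refine (mul_le_mul_of_nonneg_right ih' (Real.exp_pos _).le).trans ?_
    rw [mul_assoc, ← Real.exp_add]
    refine mul_le_mul_of_nonneg_left (Real.exp_le_exp.2 ?_) (by positivity)
    rw [Finset.card_insert_of_notMem hs]
    push_cast
    have h1 : r' ^ 2 ≤ r ^ 2 := sq_le_sq.2 hrr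
    have h2 : r' ^ 2 * A.card * Q / (Fintype.card U - Fintype.card S)
        ≤ r ^ 2 * A.card * Q / (Fintype.card U - Fintype.card S) := by gcongr
    have h3 : r ^ 2 * Q / D ≤ r ^ 2 * Q / (Fintype.card U - Fintype.card S) := by
      apply div_le_div_of_nonneg_left (by positivity) hpos; linarith
    calc _ ≤ _ := add_le_add h2 h3
      _ = _ := by ring

/-- Exponential moments of a martingale-like sum along a random injection: the coefficient of a
slot may depend on the values at the earlier slots. -/
lemma sum_exp_adapted_le (c : U → ℝ) (hc : ∑ u, c u = 0)
    (hcard : Fintype.card S < Fintype.card U) (ord : S → ℕ) (hord : Function.Injective ord)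
    (f : S → (S ↪ U) → ℝ)
    (hf : ∀ s (φ ψ : S ↪ U), (∀ t, ord t < ord s → φ t = ψ t) → f s φ = f s ψ)
    (B : S → ℝ) (K : ℝ) (hB : ∀ s φ, |f s φ| ≤ B s) (hBc : ∀ s u, B s * |c u| ≤ 1)
    (hK : ∀ s φ, f s φ ≠ 0 → |∑ t with ord t < ord s, c (φ t)| ≤ K) (hK0 : 0 ≤ K) :
    ∑ φ : S ↪ U, Real.exp (∑ s, f s φ * c (φ s)) ≤ Fintype.card (S ↪ U) *
      Real.exp ((∑ s, (B s * K + B s ^ 2 * ∑ u, c u ^ 2)) /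
        (Fintype.card U - Fintype.card S)) := by
  have hpos : (0 : ℝ) < (Fintype.card U : ℝ) - Fintype.card S := by
    rw [sub_pos]; exact_mod_cast hcard
  set Q := ∑ u, c u ^ 2 with hQ
  have hQ0 : 0 ≤ Q := Finset.sum_nonneg fun _ _ => sq_nonneg _
  set D : ℝ := (Fintype.card U : ℝ) - Fintype.card S with hD
  have main : ∀ r : ℕ, ∑ φ : S ↪ U, Real.exp (∑ s with ord s < r, f s φ * c (φ s)) ≤
      Fintype.card (S ↪ U) * Real.exp ((∑ s with ord s < r, (B s * K + B s ^ 2 * Q)) / D) := by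
    intro r
    induction r with
    | zero => simp
    | succ r ih =>
      by_cases hr : ∃ s₀, ord s₀ = r
      · obtain ⟨s₀, rfl⟩ := hr
        set A : Finset S := Finset.univ.filter fun s => ord s < ord s₀ with hA
        have hs : s₀ ∉ A := by simp [hA]
        have hins : (Finset.univ.filter fun s => ord s < ord s₀ + 1) = insert s₀ A := by
          ext s
          simp only [hA, Finset.mem_filter, Finset.mem_univ, true_and, Finset.mem_insert,
            Nat.lt_succ_iff_lt_or_eq]
          rw [or_comm]
          constructor
          · rintro (h | h)
            · exact Or.inl (hord h)
            · exact Or.inr h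
          · rintro (h | h)
            · exact Or.inl (by rw [h])
            · exact Or.inr h
        have hAS : (A.card : ℝ) ≤ Fintype.card S := by exact_mod_cast Finset.card_le_univ A
        have hAU : A.card < Fintype.card U := lt_of_le_of_lt (Finset.card_le_univ A) hcard
        rw [hins, Finset.sum_insert hs]
        have e1 : ∀ φ : S ↪ U, Real.exp (∑ s ∈ insert s₀ A, f s φ * c (φ s))
            = Real.exp (∑ s ∈ A, f s φ * c (φ s)) * Real.exp (f s₀ φ * c (φ s₀)) := fun φ => by
          rw [Finset.sum_insert hs, ← Real.exp_add]; congr 1; ring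
        simp_rw [e1]
        refine (sum_exp_exposure_le c hc A s₀ hs hAU
          (fun φ => Real.exp (∑ s ∈ A, f s φ * c (φ s))) (fun φ => f s₀ φ)
          (fun _ => (Real.exp_pos _).le) ?_ ?_ ?_).trans ?_
        · intro φ ψ h
          congr 1
          refine Finset.sum_congr rfl fun s hsA => ?_
          rw [h s hsA, hf s φ ψ]
          intro t ht
          apply h
          simp only [hA, Finset.mem_filter, Finset.mem_univ, true_and] at hsA ⊢
          exact ht.trans hsA
        · intro φ ψ h
          exact hf s₀ φ ψ fun t ht => h t (by simp [hA, ht])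
        · intro φ u
          rw [abs_mul]
          exact (mul_le_mul_of_nonneg_right (hB s₀ φ) (abs_nonneg _)).trans (hBc s₀ u)
        · have e2 : ∀ φ : S ↪ U, Real.exp (∑ s ∈ A, f s φ * c (φ s)) *
              Real.exp ((f s₀ φ * (-∑ s ∈ A, c (φ s)) + f s₀ φ ^ 2 * Q) / (Fintype.card U - A.card))
              ≤ Real.exp (∑ s ∈ A, f s φ * c (φ s)) *
                Real.exp ((B s₀ * K + B s₀ ^ 2 * Q) / D) := fun φ => by
            refine mul_le_mul_of_nonneg_left (Real.exp_le_exp.2 ?_) (Real.exp_pos _).le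
            have hB0 : 0 ≤ B s₀ := (abs_nonneg _).trans (hB s₀ φ)
            -- The drift has to be controlled only where the coefficient is nonzero, which a
            -- truncated coefficient guarantees.
            have h1 : f s₀ φ * (-∑ s ∈ A, c (φ s)) ≤ B s₀ * K := by
              by_cases h0 : f s₀ φ = 0
              · rw [h0, zero_mul]; positivity
              · refine (le_abs_self _).trans ?_
                rw [abs_mul, abs_neg]
                exact mul_le_mul (hB s₀ φ) (hK s₀ φ h0) (abs_nonneg _) hB0
            have h2 : f s₀ φ ^ 2 ≤ B s₀ ^ 2 := by
              rw [← sq_abs]; exact pow_le_pow_left₀ (abs_nonneg _) (hB s₀ φ) 2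
            have h3 : f s₀ φ * (-∑ s ∈ A, c (φ s)) + f s₀ φ ^ 2 * Q ≤ B s₀ * K + B s₀ ^ 2 * Q := by
              gcongr
            have h4 : D ≤ (Fintype.card U : ℝ) - A.card := by rw [hD]; linarith
            have h5 : 0 ≤ B s₀ * K + B s₀ ^ 2 * Q := by positivity
            refine (div_le_div_of_nonneg_right h3 (by linarith)).trans ?_
            exact div_le_div_of_nonneg_left h5 hpos h4
          refine (Finset.sum_le_sum fun φ _ => e2 φ).trans ?_
          rw [← Finset.sum_mul]
          refine (mul_le_mul_of_nonneg_right ih (Real.exp_pos _).le).trans ?_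
          rw [mul_assoc, ← Real.exp_add]
          apply le_of_eq
          congr 2
          ring
      · have : (Finset.univ.filter fun s => ord s < r + 1)
            = (Finset.univ.filter fun s => ord s < r) := by
          ext s
          simp only [Finset.mem_filter, Finset.mem_univ, true_and, Nat.lt_succ_iff_lt_or_eq]
          constructor
          · rintro (h | h)
            · exact h
            · exact absurd ⟨s, h⟩ hr
          · exact Or.inl
        rw [this]
        exact ih
  have hall : (Finset.univ.filter fun s => ord s < Finset.univ.sup ord + 1) = Finset.univ := by
    ext s
    simp only [Finset.mem_filter, Finset.mem_univ, true_and, iff_true, Nat.lt_succ_iff]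
    exact Finset.le_sup (f := ord) (Finset.mem_univ s)
  have := main (Finset.univ.sup ord + 1)
  rwa [hall] at this

end Injections

/-! ### Tail bounds from the exponential moments. -/

section Tails

variable {S U : Type*} [Fintype S] [Fintype U] [DecidableEq U] [DecidableEq S]

lemma frac_sample_ge_le (c : U → ℝ) (hc : ∑ u, c u = 0)
    (hcard : Fintype.card S < Fintype.card U) (A : Finset S) {r C : ℝ} (hr0 : 0 < r)
    (hr : ∀ u, |r * c u| ≤ 1)
    (hC : r ^ 2 * A.card * (∑ u, c u ^ 2) ≤ C * (Fintype.card U - Fintype.card S)) (t : ℝ) :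
    frac (fun φ : S ↪ U => t / r ≤ |∑ s ∈ A, c (φ s)|) ≤ 2 * Real.exp (C - t) := by
  have hpos : (0 : ℝ) < (Fintype.card U : ℝ) - Fintype.card S := by
    rw [sub_pos]; exact_mod_cast hcard
  have hle : r ^ 2 * A.card * (∑ u, c u ^ 2) / (Fintype.card U - Fintype.card S) ≤ C := by
    rwa [div_le_iff₀ hpos]
  have h1 := sum_exp_sample_le c hc hcard A r hr
  have h2 := sum_exp_sample_le c hc hcard A (-r) (fun u => by rw [neg_mul, abs_neg]; exact hr u)
  rw [neg_sq] at h2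
  have h3 := frac_abs_le_of_exp_moment (fun φ : S ↪ U => r * ∑ s ∈ A, c (φ s)) C t
    (h1.trans (by gcongr)) (by
      simp_rw [neg_mul] at h2
      exact h2.trans (by gcongr))
  refine (frac_mono fun φ h => ?_).trans h3
  rw [abs_mul, abs_of_pos hr0]
  rwa [div_le_iff₀' hr0] at h

lemma frac_adapted_ge_le (c : U → ℝ) (hc : ∑ u, c u = 0)
    (hcard : Fintype.card S < Fintype.card U) (ord : S → ℕ) (hord : Function.Injective ord)
    (f : S → (S ↪ U) → ℝ)
    (hf : ∀ s (φ ψ : S ↪ U), (∀ t, ord t < ord s → φ t = ψ t) → f s φ = f s ψ)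
    (B : S → ℝ) (K : ℝ) (hB : ∀ s φ, |f s φ| ≤ B s) (hBc : ∀ s u, B s * |c u| ≤ 1)
    (hK : ∀ s φ, f s φ ≠ 0 → |∑ t with ord t < ord s, c (φ t)| ≤ K) (hK0 : 0 ≤ K) {C : ℝ}
    (hC : ∑ s, (B s * K + B s ^ 2 * ∑ u, c u ^ 2) ≤ C * (Fintype.card U - Fintype.card S))
    (t : ℝ) :
    frac (fun φ : S ↪ U => t ≤ |∑ s, f s φ * c (φ s)|) ≤ 2 * Real.exp (C - t) := by
  have hpos : (0 : ℝ) < (Fintype.card U : ℝ) - Fintype.card S := by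
    rw [sub_pos]; exact_mod_cast hcard
  have hle : (∑ s, (B s * K + B s ^ 2 * ∑ u, c u ^ 2)) / (Fintype.card U - Fintype.card S) ≤ C := by
    rwa [div_le_iff₀ hpos]
  have h1 := sum_exp_adapted_le c hc hcard ord hord f hf B K hB hBc hK hK0
  have h2 := sum_exp_adapted_le c hc hcard ord hord (fun s φ => -f s φ)
    (fun s φ ψ h => by rw [hf s φ ψ h]) B K (fun s φ => by rw [abs_neg]; exact hB s φ) hBc
    (fun s φ h => hK s φ (by simpa using h)) hK0
  refine frac_abs_le_of_exp_moment _ C t (h1.trans (by gcongr)) ?_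
  simp_rw [neg_mul, Finset.sum_neg_distrib] at h2
  exact h2.trans (by gcongr)

end Tails

/-! ### Linear statistics of a random injection. -/

section Linear

variable {v m : ℕ} {U : Type*} [Fintype U] [DecidableEq U]

/-- An enumeration of the rule slots. -/
def slotRank (v m : ℕ) (s : Fin v × Fin m) : ℕ := (Fintype.equivFin (Fin v × Fin m) s).val

lemma slotRank_injective (v m : ℕ) : Function.Injective (slotRank v m) :=
  Fin.val_injective.comp (Fintype.equivFin _).injective

lemma sum_slots_fst (x : Fin v → ℝ) : ∑ s : Fin v × Fin m, x s.1 = m * ∑ z, x z := by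
  rw [Fintype.sum_prod_type]
  simp [Finset.mul_sum]

lemma sum_abs_le_sqrt_mul (x : Fin v → ℝ) {N : ℝ} (hN : 0 ≤ N) (hx : ∑ z, x z ^ 2 ≤ N ^ 2) :
    ∑ z, |x z| ≤ √v * N := by
  have h := sq_sum_le_card_mul_sum_sq (s := Finset.univ) (f := fun z : Fin v => |x z|)
  simp only [sq_abs, Finset.card_univ, Fintype.card_fin] at h
  refine (le_abs_self _).trans (abs_le_of_sq_le_sq ?_ (by positivity))
  rw [mul_pow, Real.sq_sqrt (by positivity)]
  exact h.trans (by gcongr)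

/-- Tail bound for a linear statistic of a random injection of the rule slots. -/
lemma frac_linear_ge_le {η : ℝ} (hη : 0 < η) (hv : 0 < v) (hm : 0 < m)
    (hcard : (v * m : ℝ) + η * Fintype.card U ≤ Fintype.card U)
    (c : U → ℝ) (hc : ∑ u, c u = 0) {τ : ℝ} (hτ : 0 < τ) (hcτ : ∀ u, |c u| ≤ τ)
    (hQ : ∑ u, c u ^ 2 ≤ v * τ ^ 2) (x : Fin v → ℝ) {N : ℝ} (hN : 0 < N)
    (hx : ∑ z, x z ^ 2 ≤ N ^ 2) {ρ' : ℝ} (hρ' : 0 ≤ ρ') (ρ : ℝ) :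
    frac (fun φ : (Fin v × Fin m) ↪ U => ρ * (N * τ) ≤ |∑ s, x s.1 * c (φ s)|) ≤
      (v * m) * (2 * Real.exp (1 / η - ρ')) + 2 * Real.exp ((ρ' + 1) / η - ρ) := by
  classical
  have hv1 : (1 : ℝ) ≤ v := by exact_mod_cast hv
  have hvm : (0 : ℝ) < v * m := by positivity
  have hU0 : (0 : ℝ) < Fintype.card U := by
    by_contra h
    have : (Fintype.card U : ℝ) = 0 := le_antisymm (not_lt.1 h) (by positivity)
    rw [this] at hcard; linarith
  have hSc : (Fintype.card (Fin v × Fin m) : ℝ) = v * m := by simp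
  have hgap : η * Fintype.card U ≤ (Fintype.card U : ℝ) - Fintype.card (Fin v × Fin m) := by
    rw [hSc]; linarith
  have hlt : Fintype.card (Fin v × Fin m) < Fintype.card U := by
    have : (Fintype.card (Fin v × Fin m) : ℝ) < Fintype.card U := by
      nlinarith [mul_pos hη hU0]
    exact_mod_cast this
  have hvmU : (v * m : ℝ) ≤ Fintype.card U := by nlinarith [mul_pos hη hU0]
  have hgap' : (v * m : ℝ) * η ≤ (Fintype.card U : ℝ) - Fintype.card (Fin v × Fin m) := by
    refine le_trans ?_ hgap; nlinarith
  set ord := slotRank v m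
  -- A partial sum has at most `v * m ≤ |U|` terms of mean square at most `v * τ ^ 2 / |U|`, so its
  -- standard deviation is of order at most `√v * τ`.
  set K : ℝ := ρ' * (√v * τ) with hK
  have hsv : (1 : ℝ) ≤ √v := Real.one_le_sqrt.2 hv1
  have hsv2 : √(v : ℝ) ^ 2 = v := Real.sq_sqrt (by positivity)
  set P1 : (Fin v × Fin m) → ((Fin v × Fin m) ↪ U) → Prop := fun s φ =>
    K ≤ |∑ t with ord t < ord s, c (φ t)| with hP1
  have b1 : ∀ s, frac (P1 s) ≤ 2 * Real.exp (1 / η - ρ') := by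
    intro s
    have := frac_sample_ge_le c hc hlt (Finset.univ.filter fun t => ord t < ord s)
      (r := 1 / (√v * τ)) (C := 1 / η) (by positivity) ?_ ?_ ρ'
    · refine (frac_mono fun φ h => ?_).trans this
      simp only [hP1, hK] at h
      rwa [div_div_eq_mul_div, div_one]
    · intro u
      rw [abs_mul, abs_of_pos (by positivity : 0 < 1 / (√v * τ)), one_div_mul_eq_div,
        div_le_one (by positivity)]
      nlinarith [hcτ u]
    · have hA : ((Finset.univ.filter fun t => ord t < ord s).card : ℝ) ≤ v * m := by
        rw [← hSc]; exact_mod_cast Finset.card_le_univ _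
      calc (1 / (√v * τ)) ^ 2 * ((Finset.univ.filter fun t => ord t < ord s).card : ℝ)
            * ∑ u, c u ^ 2
          ≤ (1 / (√v * τ)) ^ 2 * (v * m) * (v * τ ^ 2) := by gcongr
        _ = 1 / η * (v * m * η) := by
          rw [div_pow, mul_pow, hsv2]; field_simp
        _ ≤ _ := by gcongr
  -- The coefficient is switched off when the drift exceeds `K`. The decision depends on earlier
  -- slots only, so the sum stays adapted, and outside the events `P1` nothing is switched off.
  set f : (Fin v × Fin m) → ((Fin v × Fin m) ↪ U) → ℝ := fun s φ =>
    if |∑ t with ord t < ord s, c (φ t)| ≤ K then x s.1 / (τ * N) else 0 with hf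
  have hxN : ∀ z, |x z| ≤ N := fun z => by
    apply abs_le_of_sq_le_sq _ hN.le
    exact (Finset.single_le_sum (f := fun z => x z ^ 2) (fun _ _ => sq_nonneg _)
      (Finset.mem_univ z)).trans hx
  have b2 : frac (fun φ => ρ ≤ |∑ s, f s φ * c (φ s)|) ≤ 2 * Real.exp ((ρ' + 1) / η - ρ) := by
    refine frac_adapted_ge_le c hc hlt ord (slotRank_injective v m) f ?_
      (fun s => |x s.1| / (τ * N)) K ?_ ?_ ?_ (by positivity) ?_ ρ
    · intro s φ ψ h
      have : ∑ t with ord t < ord s, c (φ t) = ∑ t with ord t < ord s, c (ψ t) :=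
        Finset.sum_congr rfl fun t ht => by rw [h t (Finset.mem_filter.1 ht).2]
      simp only [hf, this]
    · intro s φ
      simp only [hf]
      split_ifs
      · rw [abs_div, abs_of_pos (by positivity : 0 < τ * N)]
      · rw [abs_zero]; positivity
    · intro s u
      rw [div_mul_eq_mul_div, div_le_one (by positivity), mul_comm τ]
      exact mul_le_mul (hxN _) (hcτ u) (abs_nonneg _) hN.le
    · intro s φ h
      simp only [hf] at h
      by_contra h'
      simp [h'] at h
    · rw [Finset.sum_add_distrib, ← Finset.sum_mul, ← Finset.sum_mul]
      have e1 : ∑ s : Fin v × Fin m, |x s.1| / (τ * N) ≤ m * √v / τ := by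
        rw [sum_slots_fst (fun z => |x z| / (τ * N)), ← Finset.sum_div, mul_div_assoc]
        refine mul_le_mul_of_nonneg_left ?_ (by positivity)
        rw [div_le_div_iff₀ (by positivity) hτ]
        nlinarith [mul_le_mul_of_nonneg_right (sum_abs_le_sqrt_mul x hN.le hx) hτ.le]
      have e2 : ∑ s : Fin v × Fin m, (|x s.1| / (τ * N)) ^ 2 ≤ m / τ ^ 2 := by
        rw [sum_slots_fst (fun z => (|x z| / (τ * N)) ^ 2)]
        simp_rw [div_pow, sq_abs]
        rw [← Finset.sum_div, div_eq_mul_one_div (m : ℝ)]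
        refine mul_le_mul_of_nonneg_left ?_ (by positivity)
        rw [div_le_div_iff₀ (by positivity) (by positivity), mul_pow]
        nlinarith [mul_le_mul_of_nonneg_right hx (sq_nonneg τ)]
      calc _ ≤ m * √v / τ * K + m / τ ^ 2 * (v * τ ^ 2) := by gcongr
        _ = (ρ' + 1) / η * (v * m * η) := by
          have : m * √v / τ * K = m * (√v) ^ 2 * ρ' := by rw [hK]; field_simp
          rw [this, hsv2]; field_simp
        _ ≤ _ := by gcongr
  have hunion : frac (fun φ : (Fin v × Fin m) ↪ U => ρ * (N * τ) ≤ |∑ s, x s.1 * c (φ s)|) ≤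
      frac (fun φ => (∃ s, P1 s φ) ∨ ρ ≤ |∑ s, f s φ * c (φ s)|) := by
    refine frac_mono fun φ h => ?_
    by_contra hcon
    push Not at hcon
    obtain ⟨h1, h2⟩ := hcon
    have : ∑ s, f s φ * c (φ s) = (∑ s, x s.1 * c (φ s)) / (τ * N) := by
      rw [Finset.sum_div]
      refine Finset.sum_congr rfl fun s _ => ?_
      have := h1 s
      simp only [hP1, not_le] at this
      simp only [hf, this.le, if_true]
      ring
    rw [this, abs_div, abs_of_pos (by positivity : 0 < τ * N), div_lt_iff₀ (by positivity),
      mul_comm τ] at h2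
    linarith
  refine hunion.trans ((frac_or_le _ _).trans (add_le_add ?_ b2))
  have := frac_exists_le P1 _ b1
  rwa [hSc] at this

end Linear

/-! ### Quadratic statistics of a random injection. -/

section Quadratic

variable {v m : ℕ}

/-- Ordering the slots of a block turns the off-diagonal part into an adapted sum: the coefficient
of a slot is the sum of the earlier values in its block. -/
lemma sum_sq_block_eq (ord : Fin v × Fin m → ℕ) (hord : Function.Injective ord)
    (y : Fin v × Fin m → ℝ) :
    ∑ z, (∑ j, y (z, j)) ^ 2 =
      ∑ s, y s ^ 2 + 2 * ∑ s, (∑ t with t.1 = s.1 ∧ ord t < ord s, y t) * y s := by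
  classical
  have h1 : ∑ z, (∑ j, y (z, j)) ^ 2 = ∑ s, ∑ t with t.1 = s.1, y s * y t := by
    rw [Fintype.sum_prod_type]
    refine Finset.sum_congr rfl fun z _ => ?_
    rw [sq, Finset.sum_mul]
    refine Finset.sum_congr rfl fun j _ => ?_
    rw [Finset.mul_sum, Finset.sum_filter, Fintype.sum_prod_type, Finset.sum_comm]
    simp
  have h2 : ∀ s, ∑ t with t.1 = s.1, y s * y t = y s ^ 2 +
      (∑ t with t.1 = s.1 ∧ ord t < ord s, y t * y s) +
      ∑ t with t.1 = s.1 ∧ ord s < ord t, y t * y s := by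
    intro s
    simp only [Finset.sum_filter]
    rw [← Fintype.sum_ite_eq s (fun t => y t ^ 2), ← Finset.sum_add_distrib,
      ← Finset.sum_add_distrib]
    refine Finset.sum_congr rfl fun t _ => ?_
    rcases lt_trichotomy (ord t) (ord s) with h | h | h
    · have : s ≠ t := by rintro rfl; exact lt_irrefl _ h
      simp [h, this, not_lt.2 h.le, mul_comm]
    · have := hord h
      subst this
      simp [sq]
    · have : s ≠ t := by rintro rfl; exact lt_irrefl _ h
      simp [h, this, not_lt.2 h.le, mul_comm]
  rw [h1, Finset.sum_congr rfl fun s _ => h2 s, Finset.sum_add_distrib, Finset.sum_add_distrib]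
  have h3 : ∑ s, ∑ t with t.1 = s.1 ∧ ord s < ord t, y t * y s
      = ∑ s, ∑ t with t.1 = s.1 ∧ ord t < ord s, y t * y s := by
    simp only [Finset.sum_filter]
    rw [Finset.sum_comm]
    refine Finset.sum_congr rfl fun s _ => Finset.sum_congr rfl fun t _ => ?_
    simp only [eq_comm (a := t.1), mul_comm]
  rw [h3]
  simp_rw [Finset.sum_mul]
  ring

set_option maxHeartbeats 1000000 in
/-- Concentration of the squared norm of the block sums of `h a + h b` along a random injection. -/
lemma frac_quadratic_ge_le {η : ℝ} (hη : 0 < η) (hv : 0 < v) (hm : 0 < m)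
    (hcard : (v * m : ℝ) + η * (v : ℝ) ^ 2 ≤ (v : ℝ) ^ 2) (h : Fin v → ℝ) (hh : ∑ a, h a = 0)
    {H : ℝ} (hH : 0 < H) (hH2 : ∑ a, h a ^ 2 = H ^ 2) {ρ g t : ℝ} (hρ : 0 < ρ) (hg : 1 ≤ g) :
    frac (fun φ : (Fin v × Fin m) ↪ Fin v × Fin v =>
      (4 * ρ * √v + 2 * t + 4 * ρ ^ 2) * H ^ 2 ≤
        |∑ z, (∑ j, (h (φ (z, j)).1 + h (φ (z, j)).2)) ^ 2
          - (∑ z, ∑ j, (h (φ (z, j)).1 + h (φ (z, j)).2)) ^ 2 / v - 2 * m * H ^ 2|) ≤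
      (v * m) * (2 * Real.exp (1 / η - ρ)) + (v * m) * (2 * Real.exp (1 / η - ρ)) +
        (2 * Real.exp (1 / η - ρ) + (2 * Real.exp (1 / η - ρ) +
        2 * Real.exp ((ρ * √v / g + v / (2 * g ^ 2)) / η - t / (4 * ρ * g)))) := by
  classical
  have hv1 : (1 : ℝ) ≤ v := by exact_mod_cast hv
  have hv0 : (0 : ℝ) < v := by linarith
  have hm0 : (0 : ℝ) < m := by exact_mod_cast hm
  have hg0 : 0 < g := by linarith
  have hSc : (Fintype.card (Fin v × Fin m) : ℝ) = v * m := by simp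
  have hUc : (Fintype.card (Fin v × Fin v) : ℝ) = v ^ 2 := by simp [sq]
  have hgap : η * (v : ℝ) ^ 2 ≤
      (Fintype.card (Fin v × Fin v) : ℝ) - Fintype.card (Fin v × Fin m) := by
    rw [hSc, hUc]; linarith
  have hηv : 0 < η * (v : ℝ) ^ 2 := by positivity
  have hlt : Fintype.card (Fin v × Fin m) < Fintype.card (Fin v × Fin v) := by
    have : (Fintype.card (Fin v × Fin m) : ℝ) < Fintype.card (Fin v × Fin v) := by
      rw [hSc, hUc]; linarith
    exact_mod_cast this
  have hvmU : (v * m : ℝ) ≤ (v : ℝ) ^ 2 := by linarith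
  have hmv : (m : ℝ) ≤ v := by nlinarith
  set ord := slotRank v m with hord
  set c : Fin v × Fin v → ℝ := fun u => h u.1 + h u.2 with hc
  have hsv : (1 : ℝ) ≤ √v := Real.one_le_sqrt.2 hv1
  have hsv2 : √(v : ℝ) ^ 2 = v := Real.sq_sqrt (by positivity)
  have hc0 : ∑ u, c u = 0 := by
    rw [Fintype.sum_prod_type]
    simp [hc, Finset.sum_add_distrib, hh, ← Finset.mul_sum]
  have hhH : ∀ a, |h a| ≤ H := fun a => by
    apply abs_le_of_sq_le_sq _ hH.le
    rw [← hH2]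
    exact Finset.single_le_sum (f := fun z => h z ^ 2) (fun _ _ => sq_nonneg _) (Finset.mem_univ a)
  have hcH : ∀ u, |c u| ≤ 2 * H := fun u =>
    (abs_add_le _ _).trans (by linarith [hhH u.1, hhH u.2])
  have hQ : ∑ u, c u ^ 2 = 2 * v * H ^ 2 := by
    have e : ∀ a b, c (a, b) ^ 2 = h a ^ 2 + h b ^ 2 + 2 * h a * h b := fun a b => by
      simp only [hc]; ring
    rw [Fintype.sum_prod_type]
    simp_rw [e, Finset.sum_add_distrib, ← Finset.mul_sum, hh]
    simp [hH2, ← Finset.mul_sum]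
    ring
  -- `K` bounds the drift, a sum over up to `v * m` slots; `κ` bounds the partial sums within a
  -- block, which has only `m ≤ v` slots and hence standard deviation of order at most `H`.
  set K : ℝ := ρ * (2 * H * √v) with hK
  set κ : ℝ := ρ * (2 * H) with hκ
  have samp : ∀ (A : Finset (Fin v × Fin m)),
      frac (fun φ : (Fin v × Fin m) ↪ Fin v × Fin v => K ≤ |∑ t ∈ A, c (φ t)|)
        ≤ 2 * Real.exp (1 / η - ρ) := by
    intro A
    have := frac_sample_ge_le c hc0 hlt A
      (r := 1 / (2 * H * √v)) (C := 1 / η) (by positivity) ?_ ?_ ρ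
    · refine (frac_mono fun φ h => ?_).trans this
      rwa [div_div_eq_mul_div, div_one]
    · intro u
      rw [abs_mul, abs_of_pos (by positivity : 0 < 1 / (2 * H * √v)), one_div_mul_eq_div,
        div_le_one (by positivity)]
      nlinarith [hcH u]
    · have hA : (A.card : ℝ) ≤ (v : ℝ) ^ 2 := by
        refine le_trans ?_ hvmU
        rw [← hSc]; exact_mod_cast Finset.card_le_univ _
      rw [hQ]
      calc (1 / (2 * H * √v)) ^ 2 * (A.card : ℝ) * (2 * v * H ^ 2)
          ≤ (1 / (2 * H * √v)) ^ 2 * (v : ℝ) ^ 2 * (2 * v * H ^ 2) := by gcongr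
        _ = (v : ℝ) ^ 2 / 2 := by
          rw [div_pow, mul_pow, mul_pow, hsv2]; field_simp
        _ ≤ 1 / η * (η * (v : ℝ) ^ 2) := by
          rw [one_div, inv_mul_cancel_left₀ hη.ne']; linarith [sq_nonneg (v : ℝ)]
        _ ≤ _ := by gcongr
  have b1 : ∀ s : Fin v × Fin m, frac (fun φ : (Fin v × Fin m) ↪ Fin v × Fin v =>
      K ≤ |∑ t with ord t < ord s, c (φ t)|) ≤ 2 * Real.exp (1 / η - ρ) := fun s => samp _
  have b2 : ∀ s : Fin v × Fin m, frac (fun φ : (Fin v × Fin m) ↪ Fin v × Fin v =>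
      κ ≤ |∑ t with t.1 = s.1 ∧ ord t < ord s, c (φ t)|) ≤ 2 * Real.exp (1 / η - ρ) := by
    intro s
    have := frac_sample_ge_le c hc0 hlt
      (Finset.univ.filter fun t : Fin v × Fin m => t.1 = s.1 ∧ ord t < ord s)
      (r := 1 / (2 * H)) (C := 1 / η) (by positivity) ?_ ?_ ρ
    · refine (frac_mono fun φ h => ?_).trans this
      rwa [div_div_eq_mul_div, div_one]
    · intro u
      rw [abs_mul, abs_of_pos (by positivity : 0 < 1 / (2 * H)), one_div_mul_eq_div,
        div_le_one (by positivity)]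
      exact hcH u
    · have hA : ((Finset.univ.filter fun t : Fin v × Fin m =>
          t.1 = s.1 ∧ ord t < ord s).card : ℝ) ≤ v := by
        refine le_trans ?_ hmv
        have : (Finset.univ.filter fun t : Fin v × Fin m => t.1 = s.1 ∧ ord t < ord s)
            ⊆ Finset.univ.image (fun j : Fin m => (s.1, j)) := by
          intro t ht
          simp only [Finset.mem_filter, Finset.mem_univ, true_and] at ht
          simp only [Finset.mem_image, Finset.mem_univ, true_and]
          exact ⟨t.2, by rw [← ht.1]⟩
        have h1 := (Finset.card_le_card this).trans Finset.card_image_le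
        simp only [Finset.card_univ, Fintype.card_fin] at h1
        exact_mod_cast h1
      rw [hQ]
      calc (1 / (2 * H)) ^ 2 * ((Finset.univ.filter fun t : Fin v × Fin m =>
            t.1 = s.1 ∧ ord t < ord s).card : ℝ) * (2 * v * H ^ 2)
          ≤ (1 / (2 * H)) ^ 2 * (v : ℝ) * (2 * v * H ^ 2) := by gcongr
        _ = (v : ℝ) ^ 2 / 2 := by field_simp
        _ ≤ 1 / η * (η * (v : ℝ) ^ 2) := by
          rw [one_div, inv_mul_cancel_left₀ hη.ne']; linarith [sq_nonneg (v : ℝ)]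
        _ ≤ _ := by gcongr
  -- The diagonal is again a sample sum, of `c ^ 2` centered at its mean `μ`.
  have b3 : frac (fun φ : (Fin v × Fin m) ↪ Fin v × Fin v =>
      ρ * (4 * H ^ 2 * √v) ≤ |∑ s, c (φ s) ^ 2 - 2 * m * H ^ 2|) ≤ 2 * Real.exp (1 / η - ρ) := by
    set μ : ℝ := 2 * H ^ 2 / v with hμ
    have hμle : μ ≤ 4 * H ^ 2 := by
      rw [hμ, div_le_iff₀ hv0]; nlinarith [sq_nonneg H]
    have hμ0 : 0 ≤ μ := by positivity
    have hc2 : ∀ u, c u ^ 2 ≤ 4 * H ^ 2 := fun u => by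
      rw [← sq_abs]
      calc |c u| ^ 2 ≤ (2 * H) ^ 2 := pow_le_pow_left₀ (abs_nonneg _) (hcH u) 2
        _ = _ := by ring
    have hcU : ∑ u : Fin v × Fin v, μ = 2 * v * H ^ 2 := by
      rw [Finset.sum_const, Finset.card_univ, nsmul_eq_mul, hUc, hμ]; field_simp
    have hd0 : ∑ u, (c u ^ 2 - μ) = 0 := by
      rw [Finset.sum_sub_distrib, hQ, hcU, sub_self]
    have hdQ : ∑ u, (c u ^ 2 - μ) ^ 2 ≤ 4 * H ^ 2 * (2 * v * H ^ 2) := by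
      calc ∑ u, (c u ^ 2 - μ) ^ 2 = ∑ u, (c u ^ 2 - μ) * c u ^ 2 - (∑ u, (c u ^ 2 - μ)) * μ := by
            rw [Finset.sum_mul, ← Finset.sum_sub_distrib]
            exact Finset.sum_congr rfl fun u _ => by ring
        _ = ∑ u, (c u ^ 2 - μ) * c u ^ 2 := by rw [hd0]; ring
        _ ≤ ∑ u, (4 * H ^ 2) * c u ^ 2 := Finset.sum_le_sum fun u _ => by
            refine mul_le_mul_of_nonneg_right ?_ (sq_nonneg _)
            linarith [hc2 u]
        _ = _ := by rw [← Finset.mul_sum, hQ]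
    have := frac_sample_ge_le (fun u => c u ^ 2 - μ) hd0 hlt
      (Finset.univ : Finset (Fin v × Fin m))
      (r := 1 / (4 * H ^ 2 * √v)) (C := 1 / η) (by positivity) ?_ ?_ ρ
    · refine (frac_mono fun φ h => ?_).trans this
      rw [div_div_eq_mul_div, div_one, Finset.sum_sub_distrib]
      have : ∑ s : Fin v × Fin m, μ = 2 * m * H ^ 2 := by
        rw [Finset.sum_const, Finset.card_univ, nsmul_eq_mul, hSc, hμ]; field_simp
      rwa [this]
    · intro u
      rw [abs_mul, abs_of_pos (by positivity : 0 < 1 / (4 * H ^ 2 * √v)), one_div_mul_eq_div,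
        div_le_one (by positivity)]
      have : |c u ^ 2 - μ| ≤ 4 * H ^ 2 := by
        rw [abs_le]; constructor <;> linarith [hc2 u, sq_nonneg (c u)]
      nlinarith [sq_nonneg H]
    · rw [Finset.card_univ, hSc]
      calc (1 / (4 * H ^ 2 * √v)) ^ 2 * (v * m) * ∑ u, (c u ^ 2 - μ) ^ 2
          ≤ (1 / (4 * H ^ 2 * √v)) ^ 2 * (v : ℝ) ^ 2 * (4 * H ^ 2 * (2 * v * H ^ 2)) := by gcongr
        _ = (v : ℝ) ^ 2 / 2 := by
          rw [div_pow, mul_pow, hsv2]; field_simp; norm_num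
        _ ≤ 1 / η * (η * (v : ℝ) ^ 2) := by
          rw [one_div, inv_mul_cancel_left₀ hη.ne']; linarith [sq_nonneg (v : ℝ)]
        _ ≤ _ := by rw [← hSc]; gcongr
  -- With this scaling the truncated coefficients are at most `1 / (2 * H * g)`. The free parameter
  -- `g` balances the second-order term `v / (2 * g ^ 2)` of the exponent against the threshold `t /
  -- (4 * ρ * g)`.
  set l : ℝ := 1 / (4 * H ^ 2 * ρ * g) with hl
  have hl0 : 0 < l := by positivity
  set f : (Fin v × Fin m) → ((Fin v × Fin m) ↪ Fin v × Fin v) → ℝ := fun s φ =>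
    if |∑ t with ord t < ord s, c (φ t)| ≤ K ∧ |∑ t with t.1 = s.1 ∧ ord t < ord s, c (φ t)| ≤ κ
    then l * ∑ t with t.1 = s.1 ∧ ord t < ord s, c (φ t) else 0 with hf
  have b4 : frac (fun φ => t / (4 * ρ * g) ≤ |∑ s, f s φ * c (φ s)|) ≤
      2 * Real.exp ((ρ * √v / g + v / (2 * g ^ 2)) / η - t / (4 * ρ * g)) := by
    refine frac_adapted_ge_le c hc0 hlt ord (slotRank_injective v m) f ?_
      (fun s => 1 / (2 * H * g)) K ?_ ?_ ?_ (by positivity) ?_ _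
    · intro s φ ψ h
      have e1 : ∑ t with ord t < ord s, c (φ t) = ∑ t with ord t < ord s, c (ψ t) :=
        Finset.sum_congr rfl fun t ht => by rw [h t (Finset.mem_filter.1 ht).2]
      have e2 : ∑ t with t.1 = s.1 ∧ ord t < ord s, c (φ t)
          = ∑ t with t.1 = s.1 ∧ ord t < ord s, c (ψ t) :=
        Finset.sum_congr rfl fun t ht => by rw [h t (Finset.mem_filter.1 ht).2.2]
      simp only [hf, e1, e2]
    · intro s φ
      simp only [hf]
      split_ifs with hif
      · rw [abs_mul, abs_of_pos hl0]
        calc _ ≤ l * κ := by gcongr; exact hif.2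
          _ = 1 / (2 * H * g) := by rw [hl, hκ]; field_simp; norm_num
      · rw [abs_zero]; positivity
    · intro s u
      rw [one_div_mul_eq_div, div_le_one (by positivity)]
      nlinarith [hcH u]
    · intro s φ h
      simp only [hf] at h
      by_contra h'
      simp [h'] at h
    · rw [Finset.sum_const, Finset.card_univ, nsmul_eq_mul, hSc, hQ]
      have e : 1 / (2 * H * g) * K + (1 / (2 * H * g)) ^ 2 * (2 * v * H ^ 2)
          = ρ * √v / g + v / (2 * g ^ 2) := by
        rw [hK]; field_simp
      rw [e]
      calc (v * m : ℝ) * (ρ * √v / g + v / (2 * g ^ 2))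
          ≤ (v : ℝ) ^ 2 * (ρ * √v / g + v / (2 * g ^ 2)) := by gcongr
        _ = (ρ * √v / g + v / (2 * g ^ 2)) / η * (η * (v : ℝ) ^ 2) := by field_simp
        _ ≤ _ := by rw [← hSc]; gcongr
  have hunion : ∀ φ : (Fin v × Fin m) ↪ Fin v × Fin v,
      ((4 * ρ * √v + 2 * t + 4 * ρ ^ 2) * H ^ 2 ≤
        |∑ z, (∑ j, (h (φ (z, j)).1 + h (φ (z, j)).2)) ^ 2
          - (∑ z, ∑ j, (h (φ (z, j)).1 + h (φ (z, j)).2)) ^ 2 / v - 2 * m * H ^ 2|) →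
      ((∃ s, K ≤ |∑ t with ord t < ord s, c (φ t)|) ∨
        (∃ s, κ ≤ |∑ t with t.1 = s.1 ∧ ord t < ord s, c (φ t)|)) ∨
      (ρ * (4 * H ^ 2 * √v) ≤ |∑ s, c (φ s) ^ 2 - 2 * m * H ^ 2| ∨
        (K ≤ |∑ s ∈ (Finset.univ : Finset (Fin v × Fin m)), c (φ s)| ∨
          t / (4 * ρ * g) ≤ |∑ s, f s φ * c (φ s)|)) := by
    intro φ hbad
    by_contra hcon
    push Not at hcon
    obtain ⟨⟨h1, h2⟩, h3, h4, h5⟩ := hcon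
    have e1 : ∑ s, f s φ * c (φ s)
        = l * ∑ s, (∑ t with t.1 = s.1 ∧ ord t < ord s, c (φ t)) * c (φ s) := by
      rw [Finset.mul_sum]
      refine Finset.sum_congr rfl fun s _ => ?_
      simp only [hf, (h1 s).le, (h2 s).le, and_self, if_true]
      ring
    set Off := ∑ s, (∑ t with t.1 = s.1 ∧ ord t < ord s, c (φ t)) * c (φ s) with hOff
    have e2 : ∑ z, (∑ j, (h (φ (z, j)).1 + h (φ (z, j)).2)) ^ 2
        = ∑ s, c (φ s) ^ 2 + 2 * Off :=
      sum_sq_block_eq ord (slotRank_injective v m) fun s => c (φ s)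
    have e3 : ∑ z, ∑ j, (h (φ (z, j)).1 + h (φ (z, j)).2) = ∑ s, c (φ s) := by
      rw [Fintype.sum_prod_type]
    rw [e1, abs_mul, abs_of_pos hl0] at h5
    have h5' : |Off| < t * H ^ 2 := by
      rw [hl, one_div_mul_eq_div, div_lt_div_iff₀ (by positivity) (by positivity)] at h5
      have : 0 < 4 * ρ * g := by positivity
      nlinarith
    have h4' : (∑ s, c (φ s)) ^ 2 / v ≤ 4 * ρ ^ 2 * H ^ 2 := by
      rw [div_le_iff₀ hv0, ← sq_abs]
      calc |∑ s, c (φ s)| ^ 2 ≤ K ^ 2 := pow_le_pow_left₀ (abs_nonneg _) h4.le 2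
        _ = _ := by rw [hK, mul_pow, mul_pow, hsv2]; ring
    have h4'' : 0 ≤ (∑ s, c (φ s)) ^ 2 / (v : ℝ) := by positivity
    rw [e2, e3] at hbad
    have := abs_lt.1 h3
    have := abs_lt.1 h5'
    refine absurd hbad (not_le.2 ?_)
    rw [abs_lt]
    constructor <;> nlinarith
  refine (frac_mono hunion).trans ((frac_or_le _ _).trans (add_le_add ?_ ?_))
  · refine (frac_or_le _ _).trans (add_le_add ?_ ?_)
    · have := frac_exists_le (fun s (φ : (Fin v × Fin m) ↪ Fin v × Fin v) =>
        K ≤ |∑ t with ord t < ord s, c (φ t)|) _ b1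
      rwa [hSc] at this
    · have := frac_exists_le (fun s (φ : (Fin v × Fin m) ↪ Fin v × Fin v) =>
        κ ≤ |∑ t with t.1 = s.1 ∧ ord t < ord s, c (φ t)|) _ b2
      rwa [hSc] at this
  · refine (frac_or_le _ _).trans (add_le_add b3 ?_)
    exact (frac_or_le _ _).trans (add_le_add (samp _) b4)

end Quadratic

/-! ### Centered vectors and their squared norms. -/

/-- The squared Euclidean norm. -/
def nsq {v : ℕ} (f : Fin v → ℝ) : ℝ := ∑ z, f z ^ 2

/-- Subtraction of the mean. -/
def cen {v : ℕ} (f : Fin v → ℝ) (z : Fin v) : ℝ := f z - (∑ y, f y) / v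

section Centering

variable {v : ℕ}

lemma nsq_nonneg (f : Fin v → ℝ) : 0 ≤ nsq f := Finset.sum_nonneg fun _ _ => sq_nonneg _

lemma sum_cen (f : Fin v → ℝ) : ∑ z, cen f z = 0 := by
  rcases Nat.eq_zero_or_pos v with rfl | hv
  · simp
  have : (v : ℝ) ≠ 0 := by exact_mod_cast hv.ne'
  simp only [cen, Finset.sum_sub_distrib, Finset.sum_const, Finset.card_univ, Fintype.card_fin,
    nsmul_eq_mul]
  field_simp
  simp

lemma nsq_cen (f : Fin v → ℝ) : nsq (cen f) = ∑ z, f z ^ 2 - (∑ z, f z) ^ 2 / v := by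
  rcases Nat.eq_zero_or_pos v with rfl | hv
  · simp [nsq]
  have : (v : ℝ) ≠ 0 := by exact_mod_cast hv.ne'
  have e : ∀ z, cen f z ^ 2 = f z ^ 2 - 2 * ((∑ y, f y) / v) * f z + ((∑ y, f y) / v) ^ 2 :=
    fun z => by simp only [cen]; ring
  simp only [nsq, e, Finset.sum_add_distrib, Finset.sum_sub_distrib, ← Finset.mul_sum,
    Finset.sum_const, Finset.card_univ, Fintype.card_fin, nsmul_eq_mul]
  field_simp
  ring

lemma cen_add_const (f : Fin v → ℝ) (k : ℝ) : cen (fun z => f z + k) = cen f := by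
  rcases Nat.eq_zero_or_pos v with rfl | hv
  · ext z; exact z.elim0
  have : (v : ℝ) ≠ 0 := by exact_mod_cast hv.ne'
  ext z
  simp only [cen, Finset.sum_add_distrib, Finset.sum_const, Finset.card_univ, Fintype.card_fin,
    nsmul_eq_mul]
  field_simp
  ring

lemma cen_add (f g : Fin v → ℝ) : cen (fun z => f z + g z) = fun z => cen f z + cen g z := by
  ext z; simp only [cen, Finset.sum_add_distrib]; ring

lemma cen_mul (k : ℝ) (f : Fin v → ℝ) : cen (fun z => k * f z) = fun z => k * cen f z := by
  ext z; simp only [cen, ← Finset.mul_sum]; ring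

lemma nsq_mul (k : ℝ) (f : Fin v → ℝ) : nsq (fun z => k * f z) = k ^ 2 * nsq f := by
  simp only [nsq, mul_pow, Finset.mul_sum]

end Centering

/-! ### Bounds for large `v` with polynomially small failure probability. -/

lemma eventually_pow_mul_exp_sub_rpow_le (k : ℕ) {a : ℝ} (ha : 0 < a) (C : ℝ) :
    ∀ᶠ v : ℕ in atTop, (v : ℝ) ^ k * Real.exp (C - (v : ℝ) ^ a) ≤ 1 := by
  obtain ⟨n, hn⟩ := exists_nat_ge (k / a)
  have h1 : Tendsto (fun v : ℕ => (v : ℝ) ^ a) atTop atTop :=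
    (tendsto_rpow_atTop ha).comp tendsto_natCast_atTop_atTop
  have h2 := ((Real.tendsto_pow_mul_exp_neg_atTop_nhds_zero n).comp h1).const_mul (Real.exp C)
  rw [mul_zero] at h2
  filter_upwards [h2.eventually (gt_mem_nhds zero_lt_one), eventually_ge_atTop 1] with v hv hv1
  have hv1' : (1 : ℝ) ≤ v := by exact_mod_cast hv1
  refine le_trans ?_ hv.le
  simp only [Function.comp]
  rw [sub_eq_add_neg, Real.exp_add, mul_left_comm]
  gcongr
  rw [← Real.rpow_natCast, ← Real.rpow_natCast, ← Real.rpow_mul (by positivity)]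
  apply Real.rpow_le_rpow_of_exponent_le hv1'
  rw [div_le_iff₀ ha] at hn
  linarith

lemma eventually_const_le_rpow {a : ℝ} (ha : 0 < a) (C : ℝ) :
    ∀ᶠ v : ℕ in atTop, C ≤ (v : ℝ) ^ a :=
  ((tendsto_rpow_atTop ha).comp tendsto_natCast_atTop_atTop).eventually_ge_atTop C

/-- A linear statistic of a random injection of the rule slots is of the order of its standard
deviation. -/
theorem linear_statistic_whp {η δ : ℝ} (hη : 0 < η) (hδ : 0 < δ) :
    ∀ᶠ v : ℕ in atTop, ∀ (m : ℕ) (U : Type) [Fintype U] [DecidableEq U], 0 < m →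
      (v * m : ℝ) + η * Fintype.card U ≤ Fintype.card U → (Fintype.card U : ℝ) ≤ (v : ℝ) ^ 3 →
      ∀ (c : U → ℝ) (c₀ τ : ℝ), 0 < τ → (∀ u, |c u - c₀| ≤ τ) →
      ∑ u, (c u - c₀) ^ 2 ≤ v * τ ^ 2 → ∀ x : Fin v → ℝ, ∑ z, x z = 0 →
      frac (fun φ : (Fin v × Fin m) ↪ U =>
        (v : ℝ) ^ δ * (√(nsq x) * (2 * τ)) < |∑ s, x s.1 * c (φ s)|) ≤ 1 / (v : ℝ) ^ 6 := by
  have hδ2 : 0 < δ / 2 := by positivity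
  filter_upwards [eventually_ge_atTop 1, eventually_pow_mul_exp_sub_rpow_le 10 hδ2 (1 / η),
    eventually_const_le_rpow hδ2 (1 / η + 1), eventually_ge_atTop 4]
    with v hv hexp hbig hv4 m U _ _ hm hcard hU3 c c₀ τ hτ hcτ hQ x hx
  have hv1 : (1 : ℝ) ≤ v := by exact_mod_cast hv
  have hv4' : (4 : ℝ) ≤ v := by exact_mod_cast hv4
  have hv0 : (0 : ℝ) < v := by linarith
  have hm0 : (0 : ℝ) < m := by exact_mod_cast hm
  have hU0 : (0 : ℝ) < Fintype.card U := by
    by_contra h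
    have : (Fintype.card U : ℝ) = 0 := le_antisymm (not_lt.1 h) (by positivity)
    rw [this] at hcard; nlinarith
  rcases (nsq_nonneg x).eq_or_lt with hx0 | hx0
  · have hz : ∀ z, x z = 0 := fun z => by
      have := (Finset.sum_eq_zero_iff_of_nonneg (fun z _ => sq_nonneg (x z))).1 hx0.symm z
        (Finset.mem_univ z)
      simpa using this
    have : frac (fun φ : (Fin v × Fin m) ↪ U =>
        (v : ℝ) ^ δ * (√(nsq x) * (2 * τ)) < |∑ s, x s.1 * c (φ s)|) ≤
        frac (fun _ : (Fin v × Fin m) ↪ U => False) := frac_mono fun φ h => by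
      simp [hz, ← hx0] at h
    refine this.trans ?_
    simp only [frac, Finset.filter_false, Finset.card_empty]
    simp
  set N := √(nsq x) with hN
  have hNpos : 0 < N := Real.sqrt_pos.2 hx0
  -- The tail bound wants the true mean instead of the given `c₀`; moving to it at most doubles the
  -- deviation. The statistic does not change, because `x` sums to zero.
  set M : ℝ := (∑ u, c u) / Fintype.card U with hM
  have hsum : ∑ u, (c u - M) = 0 := by
    rw [Finset.sum_sub_distrib, Finset.sum_const, Finset.card_univ, nsmul_eq_mul, hM]
    field_simp; ring
  have hMc : |M - c₀| ≤ τ := by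
    have : M - c₀ = (∑ u, (c u - c₀)) / Fintype.card U := by
      rw [Finset.sum_sub_distrib, Finset.sum_const, Finset.card_univ, nsmul_eq_mul, hM]
      field_simp
    rw [this, abs_div, abs_of_pos hU0, div_le_iff₀ hU0]
    refine (Finset.abs_sum_le_sum_abs _ _).trans ((Finset.sum_le_sum fun u _ => hcτ u).trans ?_)
    simp [mul_comm]
  have hsq : ∑ u, (c u - M) ^ 2 ≤ v * (2 * τ) ^ 2 := by
    have : ∑ u, (c u - c₀) ^ 2 = ∑ u, (c u - M) ^ 2 + Fintype.card U * (M - c₀) ^ 2 := by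
      have e : ∀ u, (c u - c₀) ^ 2 = (c u - M) ^ 2 + 2 * (M - c₀) * (c u - M) + (M - c₀) ^ 2 :=
        fun u => by ring
      simp only [e, Finset.sum_add_distrib, ← Finset.mul_sum, hsum]
      simp
    nlinarith [mul_nonneg hU0.le (sq_nonneg (M - c₀)), mul_nonneg hv0.le (sq_nonneg τ)]
  -- The truncation level is `v ^ (δ / 2)` and the threshold its square, so for large `v` the
  -- threshold beats the term `(ρ' + 1) / η` of the exponent.
  have main := frac_linear_ge_le hη hv hm hcard (fun u => c u - M) hsum
    (τ := 2 * τ) (by positivity)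
    (fun u => by
      have h1 := abs_le.1 (hcτ u)
      have h2 := abs_le.1 hMc
      rw [abs_le]; constructor <;> linarith) hsq x hNpos (Real.sq_sqrt hx0.le).ge
    (ρ' := (v : ℝ) ^ (δ / 2)) (by positivity) ((v : ℝ) ^ δ)
  have hstat : ∀ φ : (Fin v × Fin m) ↪ U, ∑ s, x s.1 * (c (φ s) - M) = ∑ s, x s.1 * c (φ s) := by
    intro φ
    simp only [mul_sub, Finset.sum_sub_distrib]
    rw [← Finset.sum_mul, sum_slots_fst, hx]; ring
  simp only [hstat] at main
  refine (frac_mono fun φ h => h.le).trans (main.trans ?_)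
  have hδδ : (v : ℝ) ^ δ = (v : ℝ) ^ (δ / 2) * (v : ℝ) ^ (δ / 2) := by
    rw [← Real.rpow_add hv0]; congr 1; ring
  set w := (v : ℝ) ^ (δ / 2) with hw
  have hw0 : 0 < w := by positivity
  have h2 : Real.exp ((w + 1) / η - (v : ℝ) ^ δ) ≤ Real.exp (1 / η - w) := by
    apply Real.exp_le_exp.2
    rw [hδδ]
    have : (w + 1) / η = w * (1 / η) + 1 / η := by ring
    rw [this]
    nlinarith
  have hvm3 : (v * m : ℝ) ≤ (v : ℝ) ^ 3 := by nlinarith [mul_pos hη hU0]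
  calc (v * m : ℝ) * (2 * Real.exp (1 / η - w)) + 2 * Real.exp ((w + 1) / η - (v : ℝ) ^ δ)
      ≤ (v : ℝ) ^ 3 * (2 * Real.exp (1 / η - w)) + 2 * Real.exp (1 / η - w) := by gcongr
    _ ≤ (v : ℝ) ^ 4 * Real.exp (1 / η - w) := by
        have h3 : (2 : ℝ) * v ^ 3 + 2 ≤ v ^ 4 := by
          have : (1 : ℝ) ≤ v ^ 3 := one_le_pow₀ hv1
          nlinarith
        nlinarith [Real.exp_pos (1 / η - w)]
    _ ≤ 1 / (v : ℝ) ^ 6 := by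
        rw [le_div_iff₀ (by positivity)]
        calc _ = (v : ℝ) ^ 10 * Real.exp (1 / η - w) := by ring
          _ ≤ 1 := hexp

/-- For a fixed vector, the squared norm of its centered image under the binary rules concentrates
at its mean value. -/
theorem quadratic_statistic_whp {η ε : ℝ} (hη : 0 < η) (hε : 0 < ε) :
    ∀ᶠ v : ℕ in atTop, ∀ m : ℕ, η * v ≤ m → (v * m : ℝ) + η * (v : ℝ) ^ 2 ≤ (v : ℝ) ^ 2 →
      ∀ h : Fin v → ℝ, frac (fun φ : (Fin v × Fin m) ↪ Fin v × Fin v =>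
        ε * (2 * m * nsq (cen h)) <
          |nsq (cen fun z => ∑ j, (h (φ (z, j)).1 + h (φ (z, j)).2)) - 2 * m * nsq (cen h)|)
        ≤ 1 / (v : ℝ) ^ 6 := by
  have h16 : (0 : ℝ) < 1 / 16 := by norm_num
  filter_upwards [eventually_ge_atTop 16,
    eventually_pow_mul_exp_sub_rpow_le 9 h16 (1 / η),
    eventually_const_le_rpow h16 (4 * (2 / η + 1)),
    eventually_const_le_rpow h16 (10 / (2 * (ε * η)))]
    with v hv16 hexp hbig hbig2 m hmη hcard h
  have hv16' : (16 : ℝ) ≤ v := by exact_mod_cast hv16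
  have hv1 : (1 : ℝ) ≤ v := by linarith
  have hv0 : (0 : ℝ) < v := by linarith
  have hv : 0 < v := by exact_mod_cast hv0
  have hm0 : (0 : ℝ) < m := lt_of_lt_of_le (by positivity) hmη
  have hm : 0 < m := by exact_mod_cast hm0
  have hmv : (v * m : ℝ) ≤ (v : ℝ) ^ 2 := by
    have : 0 < η * (v : ℝ) ^ 2 := by positivity
    linarith
  have hX : ∀ φ : (Fin v × Fin m) ↪ Fin v × Fin v,
      cen (fun z => ∑ j, (h (φ (z, j)).1 + h (φ (z, j)).2))
        = cen (fun z => ∑ j, (cen h (φ (z, j)).1 + cen h (φ (z, j)).2)) := by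
    intro φ
    rw [← cen_add_const (fun z => ∑ j, (cen h (φ (z, j)).1 + cen h (φ (z, j)).2))
      (m * (2 * ((∑ y, h y) / v)))]
    congr 1
    ext z
    have : ∀ j, h (φ (z, j)).1 + h (φ (z, j)).2
        = cen h (φ (z, j)).1 + cen h (φ (z, j)).2 + 2 * ((∑ y, h y) / v) := fun j => by
      simp only [cen]; ring
    simp only [this, Finset.sum_add_distrib, Finset.sum_const, Finset.card_univ, Fintype.card_fin,
      nsmul_eq_mul]
  simp only [hX]
  rcases (nsq_nonneg (cen h)).eq_or_lt with h0 | h0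
  · have hz : ∀ z, cen h z = 0 := fun z => by
      have := (Finset.sum_eq_zero_iff_of_nonneg (fun z _ => sq_nonneg (cen h z))).1 h0.symm z
        (Finset.mem_univ z)
      simpa using this
    have hz2 : nsq (cen fun _ : Fin v => (0 : ℝ)) = 0 := by simp [nsq, cen]
    refine (frac_mono (Q := fun _ => False) fun φ h => ?_).trans ?_
    · simp [hz, ← h0, hz2] at h
    · simp only [frac, Finset.filter_false, Finset.card_empty]
      simp
  -- In powers of `ρ`, `v = ρ ^ 16`. With `g = ρ ^ 4` and `t = ρ ^ 14` the threshold `t / (4 * ρ *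
  -- g) = ρ ^ 9 / 4` beats the exponent terms `ρ ^ 5` and `ρ ^ 8 / 2`, while `t` is negligible
  -- against the main term, of order `m ≥ η * ρ ^ 16`.
  set ρ : ℝ := (v : ℝ) ^ (1 / 16 : ℝ) with hρ
  have hρ0 : 0 < ρ := by positivity
  have pw : ∀ a b : ℝ, (v : ℝ) ^ a * (v : ℝ) ^ b = (v : ℝ) ^ (a + b) := fun a b =>
    (Real.rpow_add hv0 a b).symm
  have hρk : ∀ k : ℕ, ρ ^ k = (v : ℝ) ^ ((k : ℝ) / 16) := fun k => by
    rw [hρ, ← Real.rpow_natCast, ← Real.rpow_mul hv0.le]; congr 1; ring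
  have hρ16 : ρ ^ 16 = v := by rw [hρk]; norm_num
  have hρ8 : √(v : ℝ) = ρ ^ 8 := by
    rw [← hρ16, show ρ ^ 16 = (ρ ^ 8) ^ 2 by ring, Real.sqrt_sq (by positivity)]
  have hρ1 : 1 ≤ ρ := Real.one_le_rpow hv1 (by norm_num)
  have main := frac_quadratic_ge_le hη hv hm hcard (cen h) (sum_cen h) (H := √(nsq (cen h)))
    (Real.sqrt_pos.2 h0) (by rw [Real.sq_sqrt h0.le]; rfl) (ρ := ρ) (g := ρ ^ 4) (t := ρ ^ 14)
    hρ0 (one_le_pow₀ hρ1)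
  rw [Real.sq_sqrt h0.le] at main
  refine (frac_mono fun φ hφ => ?_).trans (main.trans ?_)
  · rw [nsq_cen fun z => ∑ j, (cen h (φ (z, j)).1 + cen h (φ (z, j)).2)] at hφ
    refine le_trans ?_ hφ.le
    rw [← mul_assoc]
    refine mul_le_mul_of_nonneg_right ?_ h0.le
    rw [hρ8]
    have e1 : ρ * ρ ^ 8 ≤ ρ ^ 14 := by
      calc ρ * ρ ^ 8 = ρ ^ 9 := by ring
        _ ≤ ρ ^ 14 := pow_le_pow_right₀ hρ1 (by norm_num)
    have e2 : ρ ^ 2 ≤ ρ ^ 14 := pow_le_pow_right₀ hρ1 (by norm_num)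
    have e3 : 10 * ρ ^ 14 ≤ ε * (2 * (η * v)) := by
      rw [← hρ16]
      rw [div_le_iff₀ (by positivity)] at hbig2
      have e4 : ρ ≤ ρ ^ 2 := by nlinarith
      calc 10 * ρ ^ 14 ≤ (ρ * (2 * (ε * η))) * ρ ^ 14 := by gcongr
        _ ≤ (ρ ^ 2 * (2 * (ε * η))) * ρ ^ 14 := by gcongr
        _ = _ := by ring
    calc 4 * ρ * ρ ^ 8 + 2 * ρ ^ 14 + 4 * ρ ^ 2 ≤ 10 * ρ ^ 14 := by nlinarith
      _ ≤ ε * (2 * (η * v)) := e3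
      _ ≤ ε * (2 * m) := by gcongr
  · have h2 : Real.exp ((ρ * √v / ρ ^ 4 + v / (2 * (ρ ^ 4) ^ 2)) / η - ρ ^ 14 / (4 * ρ * ρ ^ 4))
        ≤ Real.exp (1 / η - ρ) := by
      apply Real.exp_le_exp.2
      have e1 : ρ * √v / ρ ^ 4 = ρ ^ 5 := by rw [hρ8]; field_simp
      have e2 : (v : ℝ) / (2 * (ρ ^ 4) ^ 2) = ρ ^ 8 / 2 := by rw [← hρ16]; field_simp
      have e3 : ρ ^ 14 / (4 * ρ * ρ ^ 4) = ρ * ρ ^ 8 / 4 := by field_simp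
      rw [e1, e2, e3]
      have e4 : ρ ^ 5 ≤ ρ ^ 8 := pow_le_pow_right₀ hρ1 (by norm_num)
      have e5 : ρ ≤ ρ ^ 8 := by
        calc ρ = ρ ^ 1 := by ring
          _ ≤ ρ ^ 8 := pow_le_pow_right₀ hρ1 (by norm_num)
      have e6 : (ρ ^ 5 + ρ ^ 8 / 2) / η ≤ (2 / η) * ρ ^ 8 := by
        rw [div_mul_eq_mul_div]
        gcongr
        nlinarith [pow_pos hρ0 8]
      have e7 : (4 * (2 / η + 1)) * ρ ^ 8 ≤ ρ * ρ ^ 8 := by gcongr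
      have : 0 < 1 / η := by positivity
      nlinarith
    set E := Real.exp (1 / η - ρ) with hE
    have hE0 : 0 < E := Real.exp_pos _
    calc (v * m : ℝ) * (2 * E) + (v * m) * (2 * E) + (2 * E + (2 * E + 2 *
          Real.exp ((ρ * √v / ρ ^ 4 + v / (2 * (ρ ^ 4) ^ 2)) / η - ρ ^ 14 / (4 * ρ * ρ ^ 4))))
        ≤ (v : ℝ) ^ 2 * (2 * E) + (v : ℝ) ^ 2 * (2 * E) + (2 * E + (2 * E + 2 * E)) := by
          gcongr
      _ ≤ (v : ℝ) ^ 3 * E := by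
          have h3 : (4 : ℝ) * v ^ 2 + 6 ≤ v ^ 3 := by nlinarith [sq_nonneg (v : ℝ)]
          nlinarith
      _ ≤ 1 / (v : ℝ) ^ 6 := by
          rw [le_div_iff₀ (by positivity)]
          calc _ = (v : ℝ) ^ 9 * E := by ring
            _ ≤ 1 := hexp

/-! ### Extended nonnegative expectations, which need no summability conditions. -/

/-- The expectation of a nonnegative function under a discrete law. -/
def pexp {β : Type*} (p : PMF β) (f : β → ℝ≥0∞) : ℝ≥0∞ := ∑' b, p b * f b

section Pexp

variable {β γ : Type*}

lemma pexp_pure (b : β) (f : β → ℝ≥0∞) : pexp (PMF.pure b) f = f b := by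
  unfold pexp
  rw [tsum_eq_single b]
  · simp
  · intro b' h; simp [h]

lemma pexp_bind (p : PMF β) (q : β → PMF γ) (f : γ → ℝ≥0∞) :
    pexp (p.bind q) f = pexp p fun b => pexp (q b) f := by
  unfold pexp
  simp_rw [PMF.bind_apply, ← ENNReal.tsum_mul_right, ← ENNReal.tsum_mul_left]
  rw [ENNReal.tsum_comm]
  simp_rw [mul_assoc]

lemma pexp_map (p : PMF β) (g : β → γ) (f : γ → ℝ≥0∞) :
    pexp (p.map g) f = pexp p fun b => f (g b) := by
  rw [PMF.map, pexp_bind]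
  simp only [Function.comp, pexp_pure]

lemma pexp_add (p : PMF β) (f g : β → ℝ≥0∞) :
    pexp p (fun b => f b + g b) = pexp p f + pexp p g := by
  unfold pexp
  simp_rw [mul_add]
  exact ENNReal.tsum_add

lemma pexp_mul_left (p : PMF β) (k : ℝ≥0∞) (f : β → ℝ≥0∞) :
    pexp p (fun b => k * f b) = k * pexp p f := by
  unfold pexp
  simp_rw [mul_left_comm _ k]
  exact ENNReal.tsum_mul_left

lemma pexp_const (p : PMF β) (k : ℝ≥0∞) : pexp p (fun _ => k) = k := by
  unfold pexp
  rw [ENNReal.tsum_mul_right, p.tsum_coe, one_mul]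

lemma pexp_zero (p : PMF β) : pexp p (fun _ => 0) = 0 := pexp_const p 0

lemma pexp_comm (p : PMF β) (q : PMF γ) (f : β → γ → ℝ≥0∞) :
    pexp p (fun b => pexp q fun c => f b c) = pexp q fun c => pexp p fun b => f b c := by
  unfold pexp
  simp_rw [← ENNReal.tsum_mul_left]
  rw [ENNReal.tsum_comm]
  simp_rw [mul_left_comm]

lemma pexp_list_sum (p : PMF β) (l : List γ) (f : γ → β → ℝ≥0∞) :
    pexp p (fun b => (l.map fun c => f c b).sum) = (l.map fun c => pexp p (f c)).sum := by
  induction l with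
  | nil => simp [pexp_zero]
  | cons c l ih => simp only [List.map_cons, List.sum_cons, pexp_add, ih]

lemma pexp_uniform [Fintype β] [Nonempty β] (f : β → ℝ≥0∞) :
    pexp (PMF.uniformOfFintype β) f = (Fintype.card β : ℝ≥0∞)⁻¹ * ∑ b, f b := by
  unfold pexp
  rw [tsum_fintype]
  simp [Finset.mul_sum]

lemma toMeasure_apply_eq_pexp [MeasurableSpace β] (p : PMF β) {A : Set β}
    (hA : MeasurableSet A) : p.toMeasure A = pexp p (A.indicator fun _ => 1) := by
  rw [PMF.toMeasure_apply _ hA]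
  unfold pexp
  congr 1; ext b
  by_cases h : b ∈ A <;> simp [h]

/-- For `N = 0` the law is the point mass at `0` while the right-hand side vanishes; the hypothesis
reconciles the two. -/
lemma pexp_positionLaw {N : ℕ} (f : ℕ → ℝ≥0∞) (h : N = 0 → f 0 = 0) :
    pexp (positionLaw N) f = ENNReal.ofReal (1 / (N : ℝ)) * ∑ i ∈ Finset.range N, f i := by
  unfold positionLaw
  rcases Nat.eq_zero_or_pos N with rfl | hN
  · simp [pexp_pure, h rfl]
  · rw [dif_pos (Finset.nonempty_range_iff.2 hN.ne')]
    unfold pexp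
    have hN' : (0 : ℝ) < N := by exact_mod_cast hN
    rw [tsum_eq_sum (s := Finset.range N)]
    · rw [Finset.mul_sum]
      refine Finset.sum_congr rfl fun i hi => ?_
      rw [PMF.uniformOfFinset_apply_of_mem _ hi, Finset.card_range, one_div,
        ENNReal.ofReal_inv_of_pos hN', ENNReal.ofReal_natCast]
    · intro i hi
      rw [PMF.uniformOfFinset_apply_of_notMem _ hi, zero_mul]

end Pexp

/-! ### Expectations over the rewriting of a string. -/

/-- Sum of a function over the pairs of consecutive entries of a list. -/
def adjSum {β M : Type*} [AddMonoid M] (e : β → β → M) : List β → M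
  | [] => 0
  | [_] => 0
  | b :: b' :: l => e b b' + adjSum e (b' :: l)

/-- One more symbol: the effect on a function of the length of the yield. -/
def lenStep (q : ℝ≥0∞ × ℝ≥0∞) (F : ℕ → ℝ≥0∞) (k : ℕ) : ℝ≥0∞ := q.1 * F (k + 2) + q.2 * F (k + 3)

/-- The probabilities of the two arities. -/
def arityProb (p₂ : unitInterval) : ℝ≥0∞ × ℝ≥0∞ :=
  (ENNReal.ofReal p₂, ENNReal.ofReal (1 - p₂))

section Rewriting

variable {v m₂ m₃ : ℕ} [NeZero m₂] [NeZero m₃] (p₂ : unitInterval) (R : Rules v m₂ m₃)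

lemma pexp_expandLaw (z : Fin v) (f : Production v → ℝ≥0∞) :
    pexp (expandLaw p₂ R z) f =
      (arityProb p₂).1 * ((m₂ : ℝ≥0∞)⁻¹ * ∑ j, f (.bin z (R.1 (z, j)).1 (R.1 (z, j)).2)) +
      (arityProb p₂).2 * ((m₃ : ℝ≥0∞)⁻¹ *
        ∑ j, f (.ter z (R.2 (z, j)).1 (R.2 (z, j)).2.1 (R.2 (z, j)).2.2)) := by
  have h : ∀ g : Bool → ℝ≥0∞, pexp (arityLaw p₂) g =
      (arityProb p₂).1 * g true + (arityProb p₂).2 * g false := fun g => by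
    unfold pexp
    rw [tsum_fintype, Fintype.sum_bool]
    simp [arityLaw, arityProb]
  unfold expandLaw
  rw [pexp_bind, h]
  simp only [if_true, Bool.false_eq_true, if_false, pexp_map, pexp_uniform, Fintype.card_fin]

lemma natCast_inv_mul_sum_const (m : ℕ) [NeZero m] (k : ℝ≥0∞) :
    (m : ℝ≥0∞)⁻¹ * ∑ _j : Fin m, k = k := by
  have hm : (m : ℝ≥0∞) ≠ 0 := by exact_mod_cast NeZero.ne m
  rw [Finset.sum_const, Finset.card_univ, Fintype.card_fin, nsmul_eq_mul, ← mul_assoc,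
    ENNReal.inv_mul_cancel hm (ENNReal.natCast_ne_top m), one_mul]

lemma pexp_expandLaw_length (z : Fin v) (F : ℕ → ℝ≥0∞) (k : ℕ) :
    pexp (expandLaw p₂ R z) (fun b => F (k + b.word.length)) = lenStep (arityProb p₂) F k := by
  rw [pexp_expandLaw]
  simp only [Production.word, List.length_cons, List.length_nil, natCast_inv_mul_sum_const]
  rfl

lemma length_yieldOf_cons (b : Production v) (bs : List (Production v)) :
    (yieldOf (b :: bs)).length = b.word.length + (yieldOf bs).length := by
  simp [yieldOf]

lemma pexp_rewriteLaw_cons (z : Fin v) (zs : List (Fin v)) (f : List (Production v) → ℝ≥0∞) :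
    pexp (rewriteLaw p₂ R (z :: zs)) f =
      pexp (expandLaw p₂ R z) fun b => pexp (rewriteLaw p₂ R zs) fun bs => f (b :: bs) := by
  rw [rewriteLaw, pexp_bind]
  simp_rw [pexp_map]

/-- Arities do not depend on symbols, so only the number of symbols matters. -/
lemma pexp_rewriteLaw_length (zs : List (Fin v)) (F : ℕ → ℝ≥0∞) (k : ℕ) :
    pexp (rewriteLaw p₂ R zs) (fun bs => F (k + (yieldOf bs).length)) =
      ((lenStep (arityProb p₂))^[zs.length] F) k := by
  induction zs generalizing k with
  | nil => simp [rewriteLaw, pexp_pure, yieldOf]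
  | cons z zs ih =>
    rw [pexp_rewriteLaw_cons, List.length_cons, Function.iterate_succ_apply',
      ← pexp_expandLaw_length p₂ R z]
    congr 1; ext b
    rw [← ih]
    simp only [length_yieldOf_cons, add_assoc]

/-- By linearity one symbol at a time is singled out; the others enter only through the length of
what they produce, which accounts for the `zs.length - 1` iterations. -/
lemma pexp_rewriteLaw_sum (f : Production v → ℝ≥0∞) (zs : List (Fin v)) (F : ℕ → ℝ≥0∞) (k : ℕ) :
    pexp (rewriteLaw p₂ R zs) (fun bs => (bs.map f).sum * F (k + (yieldOf bs).length)) =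
      (zs.map fun z => pexp (expandLaw p₂ R z) fun b =>
        f b * ((lenStep (arityProb p₂))^[zs.length - 1] F) (k + b.word.length)).sum := by
  induction zs generalizing k with
  | nil => simp [rewriteLaw, pexp_pure]
  | cons z zs ih =>
    rw [pexp_rewriteLaw_cons]
    simp only [List.map_cons, List.sum_cons, length_yieldOf_cons, add_mul, pexp_add,
      List.length_cons, Nat.add_sub_cancel]
    congr 1
    · congr 1; ext b
      rw [pexp_mul_left, ← pexp_rewriteLaw_length p₂ R]
      simp only [add_assoc]
    · simp only [← add_assoc]
      simp_rw [ih]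
      rw [pexp_list_sum]
      congr 1
      refine List.map_congr_left fun z' hz' => ?_
      rw [pexp_comm]
      congr 1; ext b'
      rw [pexp_mul_left]
      congr 1
      have hlen : zs.length = (zs.length - 1) + 1 := by
        have := List.length_pos_of_mem hz'
        omega
      conv_rhs => rw [hlen, Function.iterate_succ_apply', ← pexp_expandLaw_length p₂ R z]
      simp only [add_right_comm]

/-- The guard is there for the next induction: a truncated subtraction `length - 2` is a true one
exactly when a pair exists. -/
lemma adjSum_congr_of {β M : Type*} [AddMonoid M] {e e' : β → β → M} {l : List β}
    (h : 2 ≤ l.length → ∀ b b', e b b' = e' b b') : adjSum e l = adjSum e' l := by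
  induction l with
  | nil => rfl
  | cons b l ih =>
    cases l with
    | nil => rfl
    | cons b' l =>
      have h' := h (by simp)
      simp only [adjSum]
      rw [h', ih fun _ => h']

lemma pexp_adjSum {β γ : Type*} (p : PMF β) (e : β → γ → γ → ℝ≥0∞) (l : List γ) :
    pexp p (fun b => adjSum (e b) l) = adjSum (fun c c' => pexp p fun b => e b c c') l := by
  induction l with
  | nil => simp [adjSum, pexp_zero]
  | cons c l ih =>
    cases l with
    | nil => simp [adjSum, pexp_zero]
    | cons c' l => simp only [adjSum, pexp_add, ih]

lemma pexp_rewriteLaw_adjSum (e : Production v → Production v → ℝ≥0∞) (zs : List (Fin v))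
    (F : ℕ → ℝ≥0∞) (k : ℕ) :
    pexp (rewriteLaw p₂ R zs) (fun bs => adjSum e bs * F (k + (yieldOf bs).length)) =
      adjSum (fun z z' => pexp (expandLaw p₂ R z) fun b => pexp (expandLaw p₂ R z') fun b' =>
        e b b' * ((lenStep (arityProb p₂))^[zs.length - 2] F)
          (k + b.word.length + b'.word.length)) zs := by
  induction zs generalizing k with
  | nil => simp [rewriteLaw, pexp_pure, adjSum]
  | cons z zs ih =>
    cases zs with
    | nil =>
      rw [pexp_rewriteLaw_cons]
      simp [rewriteLaw, pexp_pure, adjSum, pexp_zero]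
    | cons z' zs =>
      rw [pexp_rewriteLaw_cons]
      have e1 : ∀ b, (pexp (rewriteLaw p₂ R (z' :: zs)) fun bs =>
          adjSum e (b :: bs) * F (k + (yieldOf (b :: bs)).length)) =
          (pexp (expandLaw p₂ R z') fun b' => e b b' *
            ((lenStep (arityProb p₂))^[zs.length] F) (k + b.word.length + b'.word.length)) +
          (pexp (rewriteLaw p₂ R (z' :: zs)) fun bs => adjSum e bs *
            F (k + b.word.length + (yieldOf bs).length)) := by
        intro b
        rw [pexp_rewriteLaw_cons, pexp_rewriteLaw_cons, ← pexp_add]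
        congr 1; ext b'
        rw [← pexp_rewriteLaw_length p₂ R zs, ← pexp_mul_left, ← pexp_add]
        congr 1; ext bs
        simp only [adjSum, add_mul, length_yieldOf_cons, add_assoc]
      simp_rw [e1, ih]
      rw [pexp_add]
      simp only [adjSum, List.length_cons]
      congr 1
      rw [pexp_adjSum]
      refine adjSum_congr_of fun hl y y' => ?_
      rw [pexp_comm]
      congr 1; ext b
      rw [pexp_comm]
      congr 1; ext b'
      rw [pexp_mul_left]
      congr 1
      have hlen : zs.length + 1 + 1 - 2 = (zs.length + 1 - 2) + 1 := by
        simp only [List.length_cons] at hl; omega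
      rw [hlen, Function.iterate_succ_apply', ← pexp_expandLaw_length p₂ R z]
      congr 1; ext b''
      ring_nf

end Rewriting

/-! ### Positions of the sentence as pairs inside productions and between them. -/

section Positions

variable {v : ℕ}

/-- The first child. -/
def Production.first : Production v → Fin v
  | .bin _ a _ => a
  | .ter _ a _ _ => a

/-- The last child. -/
def Production.last : Production v → Fin v
  | .bin _ _ b => b
  | .ter _ _ _ c => c

/-- The symbol that is rewritten. -/
def Production.parent : Production v → Fin v
  | .bin z _ _ => z
  | .ter z _ _ _ => z

/-- Sum of a function of type, parent and tokens over the sibling pairs of a production. -/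
def siblingSum {M : Type*} [Add M]
    (h : PairType → Option (Fin v) → Option (Fin v) → Option (Fin v) → M) : Production v → M
  | .bin z a b => h .bin (some z) (some a) (some b)
  | .ter z a b c => h .ter (some z) (some a) (some b) + h .ter (some z) (some b) (some c)

/-- An adjacent pair either lies inside one production or consists of the last child of a production
and the first child of the next. -/
lemma sum_positions_eq
    (h : PairType → Option (Fin v) → Option (Fin v) → Option (Fin v) → ℝ≥0∞)
    (bs : List (Production v)) :
    ∑ i ∈ Finset.range ((yieldOf bs).length - 1),
        h (pairTypeAt bs i) (parentAt bs i) (yieldOf bs)[i]? (yieldOf bs)[i + 1]? =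
      (bs.map (siblingSum h)).sum +
        adjSum (fun b b' => h .cross (some b.parent) (some b.last) (some b'.first)) bs := by
  induction bs with
  | nil => simp [yieldOf, adjSum]
  | cons b bs ih =>
    cases bs with
    | nil =>
      cases b with
      | bin z x y => simp [yieldOf, Production.word, adjSum, pairTypeAt, parentAt, siblingSum]
      | ter z x y w =>
        simp [yieldOf, Production.word, adjSum, pairTypeAt, parentAt, siblingSum,
          Finset.sum_range_succ]
    | cons b' bs =>
      have hf : (yieldOf (b' :: bs))[0]? = some b'.first := by
        cases b' <;> simp [yieldOf, Production.word, Production.first]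
      have hl : (yieldOf (b' :: bs)).length = ((yieldOf (b' :: bs)).length - 1) + 1 := by
        have : 0 < (yieldOf (b' :: bs)).length := by
          cases b' <;> simp [yieldOf, Production.word]
        omega
      rw [List.map_cons, List.sum_cons]
      simp only [adjSum]
      cases b with
      | bin z x y =>
        have e : yieldOf (.bin z x y :: b' :: bs) = x :: y :: yieldOf (b' :: bs) := rfl
        have e1 : (yieldOf (.bin z x y :: b' :: bs)).length - 1
            = ((yieldOf (b' :: bs)).length - 1) + 1 + 1 := by
          rw [e, List.length_cons, List.length_cons]; omega
        rw [e1, Finset.sum_range_succ', Finset.sum_range_succ', e]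
        simp only [pairTypeAt, parentAt, List.getElem?_cons_succ, List.getElem?_cons_zero, hf,
          siblingSum, zero_add]
        rw [ih]
        simp only [show (Production.bin z x y).parent = z from rfl,
          show (Production.bin z x y).last = y from rfl]
        ring
      | ter z x y w =>
        have e : yieldOf (.ter z x y w :: b' :: bs) = x :: y :: w :: yieldOf (b' :: bs) := rfl
        have e1 : (yieldOf (.ter z x y w :: b' :: bs)).length - 1
            = ((yieldOf (b' :: bs)).length - 1) + 1 + 1 + 1 := by
          rw [e, List.length_cons, List.length_cons, List.length_cons]; omega
        rw [e1, Finset.sum_range_succ', Finset.sum_range_succ', Finset.sum_range_succ', e]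
        simp only [pairTypeAt, parentAt, List.getElem?_cons_succ, List.getElem?_cons_zero, hf,
          siblingSum, zero_add, Nat.reduceAdd]
        rw [ih]
        simp only [show (Production.ter z x y w).parent = z from rfl,
          show (Production.ter z x y w).last = w from rfl]
        ring

lemma sum_map_yieldOf (g : Fin v → ℝ≥0∞) (bs : List (Production v)) :
    ((yieldOf bs).map g).sum = (bs.map fun b => (b.word.map g).sum).sum := by
  induction bs with
  | nil => simp [yieldOf]
  | cons b bs ih =>
    have : yieldOf (b :: bs) = b.word ++ yieldOf bs := by simp [yieldOf]
    rw [this, List.map_append, List.sum_append, ih, List.map_cons, List.sum_cons]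

lemma adjSum_eq_sum_range {β : Type*} (c : β → β → ℝ≥0∞)
    (h : Option β → Option β → ℝ≥0∞) (hc : ∀ a b, h (some a) (some b) = c a b) (l : List β) :
    ∑ i ∈ Finset.range (l.length - 1), h l[i]? l[i + 1]? = adjSum c l := by
  induction l with
  | nil => simp [adjSum]
  | cons b l ih =>
    cases l with
    | nil => simp [adjSum]
    | cons b' l =>
      have : (b :: b' :: l).length - 1 = ((b' :: l).length - 1) + 1 := by simp
      rw [this, Finset.sum_range_succ']
      simp only [List.getElem?_cons_succ, List.getElem?_cons_zero, zero_add, hc, adjSum]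
      rw [← ih, add_comm]
      rfl

lemma adjSum_yieldOf (c : Fin v → Fin v → ℝ≥0∞) (bs : List (Production v)) :
    adjSum c (yieldOf bs) = (bs.map fun b => adjSum c b.word).sum +
      adjSum (fun b b' => c b.last b'.first) bs := by
  classical
  let h : Option (Fin v) → Option (Fin v) → ℝ≥0∞ := fun a b =>
    match a, b with
    | some a, some b => c a b
    | _, _ => 0
  rw [← adjSum_eq_sum_range c h (fun _ _ => rfl), sum_positions_eq (fun _ _ a b => h a b)]
  congr 2
  refine List.map_congr_left fun b _ => ?_
  cases b <;> simp [siblingSum, h, Production.word, adjSum]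

lemma sum_map_eq_sum_range {β : Type*} (g : Option β → ℝ≥0∞) (l : List β) :
    ∑ i ∈ Finset.range l.length, g l[i]? = (l.map fun a => g (some a)).sum := by
  induction l with
  | nil => simp
  | cons b l ih =>
    rw [List.length_cons, Finset.sum_range_succ']
    simp only [List.getElem?_cons_succ, List.getElem?_cons_zero, List.map_cons, List.sum_cons]
    rw [ih, add_comm]

end Positions

/-! ### Real recursions over the levels for functions of symbols and of adjacent pairs. -/

/-- The effect of one more symbol on a function of the length, in real numbers. -/
def lenStepR (p : ℝ) (F : ℕ → ℝ) (k : ℕ) : ℝ := p * F (k + 2) + (1 - p) * F (k + 3)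

/-- The probability of an arity (`true` is binary). -/
def arityWeight (p : ℝ) (s : Bool) : ℝ := if s then p else 1 - p

/-- The number of children of an arity. -/
def arityLen (s : Bool) : ℕ := if s then 2 else 3

/-- The weight of a string of length `N` one of whose symbols is rewritten with arity `s`. -/
def liftOne (p : ℝ) (s : Bool) (F : ℕ → ℝ) (N : ℕ) : ℝ :=
  arityWeight p s * (lenStepR p)^[N - 1] F (arityLen s)

/-- The weight of a string of length `N` two of whose symbols are rewritten with arities `s`,
`s'`. -/
def liftTwo (p : ℝ) (s s' : Bool) (F : ℕ → ℝ) (N : ℕ) : ℝ :=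
  arityWeight p s * arityWeight p s' * (lenStepR p)^[N - 2] F (arityLen s + arityLen s')

/-- The average of a function over the rules of a symbol with a given arity. -/
def ruleAvg {v m₂ m₃ : ℕ} (R : Rules v m₂ m₃) : Bool → (Production v → ℝ) → Fin v → ℝ
  | true, f, z => 1 / (m₂ : ℝ) * ∑ j, f (.bin z (R.1 (z, j)).1 (R.1 (z, j)).2)
  | false, f, z => 1 / (m₃ : ℝ) * ∑ j, f (.ter z (R.2 (z, j)).1 (R.2 (z, j)).2.1 (R.2 (z, j)).2.2)

/-- The sum of the values of a function at the children, weighted by position. -/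
def childSum {v : ℕ} (θ : ℝ × ℝ × ℝ) (f : Fin v → ℝ) : Production v → ℝ
  | .bin _ a b => θ.1 * f a + θ.2.2 * f b
  | .ter _ a b c => θ.1 * f a + θ.2.1 * f b + θ.2.2 * f c

/-- The action of the rules of one level and one arity on functions of the symbols. -/
def ruleOp {v m₂ m₃ : ℕ} (R : Rules v m₂ m₃) (θ : ℝ × ℝ × ℝ) (s : Bool) (f : Fin v → ℝ) :
    Fin v → ℝ := ruleAvg R s (childSum θ f)

/-- The position weights that select all children. -/
def allPos : ℝ × ℝ × ℝ := (1, 1, 1)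

/-- The position weights that select the first child. -/
def firstPos : ℝ × ℝ × ℝ := (1, 0, 0)

/-- The position weights that select the last child. -/
def lastPos : ℝ × ℝ × ℝ := (0, 0, 1)

/-- Sum of a function over the adjacent siblings of a production. -/
def siblingPairs {v : ℕ} (c : Fin v → Fin v → ℝ) : Production v → ℝ
  | .bin _ a b => c a b
  | .ter _ x y w => c x y + c y w

/-- The action of the rules of a pair of adjacent symbols on functions of adjacent pairs. -/
def crossOp {v m₂ m₃ : ℕ} (R : Rules v m₂ m₃) (s s' : Bool) (c : Fin v → Fin v → ℝ)
    (z z' : Fin v) : ℝ :=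
  ruleAvg R s (fun b => ruleAvg R s' (fun b' => c b.last b'.first) z') z

/-- The expectation, given the root, of the sum of `f` over the level-`ℓ` symbols, weighted by
`F` of the length. -/
def symFun {v m₂ m₃ : ℕ} (p : ℝ) (R : ℕ → Rules v m₂ m₃) :
    ℕ → (ℕ → ℝ) → (Fin v → ℝ) → Fin v → ℝ
  | 0, F, f, α => F 1 * f α
  | ℓ + 1, F, f, α =>
    ∑ s : Bool, symFun p R ℓ (liftOne p s F) (ruleOp (R ℓ) allPos s f) α

/-- The expectation, given the root, of the sum of `c` over the pairs of adjacent level-`ℓ`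
symbols, weighted by `F` of the length. -/
def pairFun {v m₂ m₃ : ℕ} (p : ℝ) (R : ℕ → Rules v m₂ m₃) :
    ℕ → (ℕ → ℝ) → (Fin v → Fin v → ℝ) → Fin v → ℝ
  | 0, _, _, _ => 0
  | ℓ + 1, F, c, α =>
    ∑ s : Bool, symFun p R ℓ (liftOne p s F) (ruleAvg (R ℓ) s (siblingPairs c)) α +
    ∑ s : Bool, ∑ s' : Bool, pairFun p R ℓ (liftTwo p s s' F) (crossOp (R ℓ) s s' c) α

section Basic

variable {v m₂ m₃ : ℕ}

lemma lenStepR_nonneg {p : ℝ} (hp0 : 0 ≤ p) (hp1 : p ≤ 1) {F : ℕ → ℝ} (hF : ∀ k, 0 ≤ F k)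
    (k : ℕ) : 0 ≤ lenStepR p F k := by
  have : 0 ≤ 1 - p := by linarith
  have := hF (k + 2)
  have := hF (k + 3)
  unfold lenStepR; positivity

lemma lenStepR_iterate_nonneg {p : ℝ} (hp0 : 0 ≤ p) (hp1 : p ≤ 1) {F : ℕ → ℝ}
    (hF : ∀ k, 0 ≤ F k) (n k : ℕ) : 0 ≤ (lenStepR p)^[n] F k := by
  induction n generalizing k with
  | zero => exact hF k
  | succ n ih =>
    rw [Function.iterate_succ_apply']
    exact lenStepR_nonneg hp0 hp1 ih k

lemma arityWeight_nonneg {p : ℝ} (hp0 : 0 ≤ p) (hp1 : p ≤ 1) (s : Bool) : 0 ≤ arityWeight p s := by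
  unfold arityWeight; split_ifs <;> linarith

lemma liftOne_nonneg {p : ℝ} (hp0 : 0 ≤ p) (hp1 : p ≤ 1) {F : ℕ → ℝ} (hF : ∀ k, 0 ≤ F k)
    (s : Bool) (N : ℕ) : 0 ≤ liftOne p s F N :=
  mul_nonneg (arityWeight_nonneg hp0 hp1 s) (lenStepR_iterate_nonneg hp0 hp1 hF _ _)

lemma liftTwo_nonneg {p : ℝ} (hp0 : 0 ≤ p) (hp1 : p ≤ 1) {F : ℕ → ℝ} (hF : ∀ k, 0 ≤ F k)
    (s s' : Bool) (N : ℕ) : 0 ≤ liftTwo p s s' F N :=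
  mul_nonneg (mul_nonneg (arityWeight_nonneg hp0 hp1 s) (arityWeight_nonneg hp0 hp1 s'))
    (lenStepR_iterate_nonneg hp0 hp1 hF _ _)

lemma ruleAvg_nonneg (R : Rules v m₂ m₃) (s : Bool) {f : Production v → ℝ} (hf : ∀ b, 0 ≤ f b)
    (z : Fin v) : 0 ≤ ruleAvg R s f z := by
  cases s <;> exact mul_nonneg (by positivity) (Finset.sum_nonneg fun _ _ => hf _)

lemma ruleAvg_add (R : Rules v m₂ m₃) (s : Bool) (f g : Production v → ℝ) (z : Fin v) :
    ruleAvg R s (fun b => f b + g b) z = ruleAvg R s f z + ruleAvg R s g z := by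
  cases s <;> simp only [ruleAvg, Finset.sum_add_distrib, mul_add]

lemma ruleAvg_mul (R : Rules v m₂ m₃) (s : Bool) (k : ℝ) (f : Production v → ℝ) (z : Fin v) :
    ruleAvg R s (fun b => k * f b) z = k * ruleAvg R s f z := by
  cases s <;> simp only [ruleAvg, ← Finset.mul_sum] <;> ring

lemma ruleAvg_const [NeZero m₂] [NeZero m₃] (R : Rules v m₂ m₃) (s : Bool) (k : ℝ) (z : Fin v) :
    ruleAvg R s (fun _ => k) z = k := by
  have h2 : (m₂ : ℝ) ≠ 0 := by exact_mod_cast NeZero.ne m₂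
  have h3 : (m₃ : ℝ) ≠ 0 := by exact_mod_cast NeZero.ne m₃
  cases s <;> simp [ruleAvg] <;> field_simp

lemma symFun_nonneg {p : ℝ} (hp0 : 0 ≤ p) (hp1 : p ≤ 1) (R : ℕ → Rules v m₂ m₃) (ℓ : ℕ)
    {F : ℕ → ℝ} (hF : ∀ k, 0 ≤ F k) {f : Fin v → ℝ} (hf : ∀ z, 0 ≤ f z) (α : Fin v) :
    0 ≤ symFun p R ℓ F f α := by
  induction ℓ generalizing F f with
  | zero => exact mul_nonneg (hF 1) (hf α)
  | succ ℓ ih =>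
    refine Finset.sum_nonneg fun s _ => ih (liftOne_nonneg hp0 hp1 hF s) fun z => ?_
    refine ruleAvg_nonneg _ _ (fun b => ?_) z
    cases b <;> simp only [childSum, allPos, one_mul]
    · exact add_nonneg (hf _) (hf _)
    · exact add_nonneg (add_nonneg (hf _) (hf _)) (hf _)

lemma siblingPairs_nonneg {c : Fin v → Fin v → ℝ} (hc : ∀ z z', 0 ≤ c z z') (b : Production v) :
    0 ≤ siblingPairs c b := by
  cases b
  · exact hc _ _
  · exact add_nonneg (hc _ _) (hc _ _)

lemma pairFun_nonneg {p : ℝ} (hp0 : 0 ≤ p) (hp1 : p ≤ 1) (R : ℕ → Rules v m₂ m₃) (ℓ : ℕ)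
    {F : ℕ → ℝ} (hF : ∀ k, 0 ≤ F k) {c : Fin v → Fin v → ℝ} (hc : ∀ z z', 0 ≤ c z z')
    (α : Fin v) : 0 ≤ pairFun p R ℓ F c α := by
  induction ℓ generalizing F c with
  | zero => exact le_rfl
  | succ ℓ ih =>
    refine add_nonneg (Finset.sum_nonneg fun s _ => symFun_nonneg hp0 hp1 R ℓ
      (liftOne_nonneg hp0 hp1 hF s) (ruleAvg_nonneg _ _ (siblingPairs_nonneg hc)) α)
      (Finset.sum_nonneg fun s _ => Finset.sum_nonneg fun s' _ =>
        ih (liftTwo_nonneg hp0 hp1 hF s s') fun z z' => ?_)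
    exact ruleAvg_nonneg _ _ (fun b => ruleAvg_nonneg _ _ (fun b' => hc _ _) _) _

end Basic

/-! ### The recursions compute the expectations under the law of the string. -/

section Transfer

variable {v m₂ m₃ : ℕ} [NeZero v] [NeZero m₂] [NeZero m₃] (p₂ : unitInterval)

lemma natCast_inv_mul_sum_ofReal (m : ℕ) [NeZero m] {g : Fin m → ℝ} (hg : ∀ j, 0 ≤ g j) :
    (m : ℝ≥0∞)⁻¹ * ∑ j, ENNReal.ofReal (g j) = ENNReal.ofReal (1 / (m : ℝ) * ∑ j, g j) := by
  have hm : (0 : ℝ) < m := by exact_mod_cast NeZero.pos m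
  rw [ENNReal.ofReal_mul (by positivity), ENNReal.ofReal_sum_of_nonneg fun j _ => hg j, one_div,
    ENNReal.ofReal_inv_of_pos hm, ENNReal.ofReal_natCast]

lemma lenStep_ofReal {F : ℕ → ℝ} (hF : ∀ k, 0 ≤ F k) :
    lenStep (arityProb p₂) (fun k => ENNReal.ofReal (F k)) =
      fun k => ENNReal.ofReal (lenStepR p₂ F k) := by
  have h0 : (0 : ℝ) ≤ p₂ := p₂.2.1
  have h1 : (0 : ℝ) ≤ 1 - (p₂ : ℝ) := sub_nonneg.2 p₂.2.2
  ext k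
  simp only [lenStep, arityProb, lenStepR]
  rw [ENNReal.ofReal_add (mul_nonneg h0 (hF _)) (mul_nonneg h1 (hF _)), ENNReal.ofReal_mul h0,
    ENNReal.ofReal_mul h1]

lemma lenStep_iterate_ofReal {F : ℕ → ℝ} (hF : ∀ k, 0 ≤ F k) (n : ℕ) :
    (lenStep (arityProb p₂))^[n] (fun k => ENNReal.ofReal (F k)) =
      fun k => ENNReal.ofReal ((lenStepR p₂)^[n] F k) := by
  induction n with
  | zero => rfl
  | succ n ih =>
    rw [Function.iterate_succ_apply', ih,
      lenStep_ofReal p₂ (lenStepR_iterate_nonneg p₂.2.1 p₂.2.2 hF n)]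
    ext k
    rw [Function.iterate_succ_apply']

omit [NeZero v] in
lemma pexp_expandLaw_ofReal (R : Rules v m₂ m₃) (z : Fin v) {f : Production v → ℝ}
    (hf : ∀ b, 0 ≤ f b) (G : ℕ → ℝ) :
    pexp (expandLaw p₂ R z) (fun b => ENNReal.ofReal (f b) * ENNReal.ofReal (G b.word.length)) =
      ∑ s : Bool, ENNReal.ofReal (arityWeight p₂ s * G (arityLen s)) *
        ENNReal.ofReal (ruleAvg R s f z) := by
  have h0 : (0 : ℝ) ≤ p₂ := p₂.2.1
  have h1 : (0 : ℝ) ≤ 1 - (p₂ : ℝ) := sub_nonneg.2 p₂.2.2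
  rw [pexp_expandLaw, Fintype.sum_bool]
  simp only [Production.word, List.length_cons, List.length_nil, ← Finset.sum_mul, ← mul_assoc,
    arityLen, arityWeight, if_true, Bool.false_eq_true, if_false, ruleAvg, arityProb]
  rw [ENNReal.ofReal_mul h0, ENNReal.ofReal_mul h1,
    ← natCast_inv_mul_sum_ofReal m₂ fun j => hf _, ← natCast_inv_mul_sum_ofReal m₃ fun j => hf _]
  ring

lemma list_sum_map_finset_sum {β ι : Type*} (t : Finset ι) (k : ι → ℝ≥0∞)
    (g : ι → β → ℝ≥0∞) (l : List β) :
    (l.map fun z => ∑ s ∈ t, k s * g s z).sum = ∑ s ∈ t, k s * (l.map (g s)).sum := by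
  induction l with
  | nil => simp
  | cons z l ih => simp only [List.map_cons, List.sum_cons, ih, mul_add, Finset.sum_add_distrib]

lemma adjSum_finset_sum {β ι : Type*} (t : Finset ι) (k : ι → ℝ≥0∞)
    (g : ι → β → β → ℝ≥0∞) (l : List β) :
    adjSum (fun z z' => ∑ s ∈ t, k s * g s z z') l = ∑ s ∈ t, k s * adjSum (g s) l := by
  induction l with
  | nil => simp [adjSum]
  | cons z l ih =>
    cases l with
    | nil => simp [adjSum]
    | cons z' l => simp only [adjSum, ih, mul_add, Finset.sum_add_distrib]

omit [NeZero v] in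
lemma pexp_rewriteLaw_sum_ofReal (R : Rules v m₂ m₃) {f : Production v → ℝ} (hf : ∀ b, 0 ≤ f b)
    {F : ℕ → ℝ} (hF : ∀ k, 0 ≤ F k) (zs : List (Fin v)) :
    pexp (rewriteLaw p₂ R zs) (fun bs => (bs.map fun b => ENNReal.ofReal (f b)).sum *
        ENNReal.ofReal (F (yieldOf bs).length)) =
      ∑ s : Bool, ENNReal.ofReal (liftOne p₂ s F zs.length) *
        (zs.map fun z => ENNReal.ofReal (ruleAvg R s f z)).sum := by
  have := pexp_rewriteLaw_sum p₂ R (fun b => ENNReal.ofReal (f b)) zs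
    (fun k => ENNReal.ofReal (F k)) 0
  simp only [zero_add, lenStep_iterate_ofReal p₂ hF] at this
  rw [this, ← list_sum_map_finset_sum]
  congr 1
  refine List.map_congr_left fun z _ => ?_
  rw [pexp_expandLaw_ofReal p₂ R z hf]
  rfl

omit [NeZero v] in
lemma pexp_rewriteLaw_adjSum_ofReal (R : Rules v m₂ m₃) {e : Production v → Production v → ℝ}
    (he : ∀ b b', 0 ≤ e b b') {F : ℕ → ℝ} (hF : ∀ k, 0 ≤ F k) (zs : List (Fin v)) :
    pexp (rewriteLaw p₂ R zs) (fun bs => adjSum (fun b b' => ENNReal.ofReal (e b b')) bs *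
        ENNReal.ofReal (F (yieldOf bs).length)) =
      ∑ s : Bool, ∑ s' : Bool, ENNReal.ofReal (liftTwo p₂ s s' F zs.length) *
        adjSum (fun z z' => ENNReal.ofReal
          (ruleAvg R s (fun b => ruleAvg R s' (fun b' => e b b') z') z)) zs := by
  have := pexp_rewriteLaw_adjSum p₂ R (fun b b' => ENNReal.ofReal (e b b')) zs
    (fun k => ENNReal.ofReal (F k)) 0
  simp only [zero_add, lenStep_iterate_ofReal p₂ hF] at this
  rw [this, ← Fintype.sum_prod_type', ← adjSum_finset_sum]
  congr 1
  ext z z'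
  set G := (lenStepR p₂)^[zs.length - 2] F 
  have e1 : ∀ b : Production v, (pexp (expandLaw p₂ R z') fun b' => ENNReal.ofReal (e b b') *
      ENNReal.ofReal (G (b.word.length + b'.word.length))) =
      ∑ s' : Bool, ENNReal.ofReal (ruleAvg R s' (fun b' => e b b') z') *
        ENNReal.ofReal (arityWeight p₂ s' * G (b.word.length + arityLen s')) := fun b => by
    rw [pexp_expandLaw_ofReal p₂ R z' (he b) fun k => G (b.word.length + k)]
    exact Finset.sum_congr rfl fun _ _ => mul_comm _ _
  simp_rw [e1, Fintype.sum_bool]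
  rw [pexp_add, Fintype.sum_prod_type, Fintype.sum_bool, Fintype.sum_bool, Fintype.sum_bool]
  have e2 : ∀ s' : Bool, (pexp (expandLaw p₂ R z) fun b =>
      ENNReal.ofReal (ruleAvg R s' (fun b' => e b b') z') *
        ENNReal.ofReal (arityWeight p₂ s' * G (b.word.length + arityLen s'))) =
      ∑ s : Bool, ENNReal.ofReal (liftTwo p₂ s s' F zs.length) * ENNReal.ofReal
          (ruleAvg R s (fun b => ruleAvg R s' (fun b' => e b b') z') z) := fun s' => by
    rw [pexp_expandLaw_ofReal p₂ R z (fun b => ruleAvg_nonneg R s' (he b) z')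
      fun k => arityWeight p₂ s' * G (k + arityLen s')]
    simp only [liftTwo, mul_assoc, G]
  rw [e2, e2, Fintype.sum_bool, Fintype.sum_bool]
  ring

/-- The contribution of the root `α`. -/
def rootInd (α β : Fin v) : ℝ≥0∞ := if β = α then 1 else 0

lemma pexp_stringLaw_zero (G : Grammar 0 v m₂ m₃) (f : Fin v × List (Fin v) → ℝ≥0∞) :
    pexp (stringLaw p₂ 0 G) f = (v : ℝ≥0∞)⁻¹ * ∑ α, f (α, [α]) := by
  rw [stringLaw, pexp_map, pexp_uniform, Fintype.card_fin]

lemma pexp_stringLaw_succ (R : ℕ → Rules v m₂ m₃) (ℓ : ℕ) (f : Fin v × List (Fin v) → ℝ≥0∞) :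
    pexp (stringLaw p₂ (ℓ + 1) fun i => R i) f =
      pexp (stringLaw p₂ ℓ fun i => R i) fun s =>
        pexp (rewriteLaw p₂ (R ℓ) s.2) fun bs => f (s.1, yieldOf bs) := by
  rw [stringLaw, pexp_bind]
  simp_rw [pexp_map]
  rfl

lemma pexp_stringLaw_root (R : ℕ → Rules v m₂ m₃) (ℓ : ℕ) (α : Fin v) :
    pexp (stringLaw p₂ ℓ fun i => R i) (fun s => rootInd α s.1) = (v : ℝ≥0∞)⁻¹ := by
  induction ℓ with
  | zero =>
    rw [pexp_stringLaw_zero]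
    simp [rootInd]
  | succ ℓ ih =>
    rw [pexp_stringLaw_succ, ← ih]
    simp only [pexp_const]

lemma pexp_finset_sum {β ι : Type*} (p : PMF β) (t : Finset ι) (f : ι → β → ℝ≥0∞) :
    pexp p (fun b => ∑ i ∈ t, f i b) = ∑ i ∈ t, pexp p (f i) := by
  classical
  induction t using Finset.induction_on with
  | empty => simp [pexp_zero]
  | insert i t hi ih => simp only [Finset.sum_insert hi, pexp_add, ih]

/-- Peeling off the last level replaces `f` by its image under the rules of that level and `F` by
the weight of a string one of whose symbols has been rewritten. Working from the bottom keeps the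
root fixed. -/
lemma pexp_stringLaw_sum (R : ℕ → Rules v m₂ m₃) (ℓ : ℕ) {f : Fin v → ℝ} (hf : ∀ z, 0 ≤ f z)
    {F : ℕ → ℝ} (hF : ∀ k, 0 ≤ F k) (α : Fin v) :
    pexp (stringLaw p₂ ℓ fun i => R i) (fun s => rootInd α s.1 *
        ((s.2.map fun z => ENNReal.ofReal (f z)).sum * ENNReal.ofReal (F s.2.length))) =
      (v : ℝ≥0∞)⁻¹ * ENNReal.ofReal (symFun p₂ R ℓ F f α) := by
  induction ℓ generalizing F f with
  | zero =>
    rw [pexp_stringLaw_zero]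
    simp only [rootInd, List.map_cons, List.map_nil, List.sum_cons, List.sum_nil, add_zero,
      List.length_cons, List.length_nil, zero_add, ite_mul, one_mul, zero_mul,
      Finset.sum_ite_eq', Finset.mem_univ, if_true, symFun]
    rw [ENNReal.ofReal_mul (hF 1), mul_comm (ENNReal.ofReal (f α))]
  | succ ℓ ih =>
    rw [pexp_stringLaw_succ]
    have hw : ∀ b : Production v, (b.word.map fun z => ENNReal.ofReal (f z)).sum
        = ENNReal.ofReal (childSum allPos f b) := fun b => by
      cases b <;> simp [Production.word, childSum, allPos, ENNReal.ofReal_add, hf, add_nonneg,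
        add_assoc]
    have hcs : ∀ b : Production v, 0 ≤ childSum allPos f b := fun b => by
      cases b <;> simp only [childSum, allPos, one_mul]
      · exact add_nonneg (hf _) (hf _)
      · exact add_nonneg (add_nonneg (hf _) (hf _)) (hf _)
    simp only [sum_map_yieldOf, hw, pexp_mul_left, pexp_rewriteLaw_sum_ofReal p₂ (R ℓ) hcs hF,
      Finset.mul_sum, pexp_finset_sum, symFun]
    have hop : ∀ s z, 0 ≤ ruleOp (R ℓ) allPos s f z := fun s => ruleAvg_nonneg _ _ hcs
    rw [ENNReal.ofReal_sum_of_nonneg fun s _ => symFun_nonneg p₂.2.1 p₂.2.2 R ℓ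
      (liftOne_nonneg p₂.2.1 p₂.2.2 hF s) (hop s) α, Finset.mul_sum]
    refine Finset.sum_congr rfl fun s _ => ?_
    rw [← ih (hop s) (liftOne_nonneg p₂.2.1 p₂.2.2 hF s)]
    congr 1; ext t
    rw [mul_comm (ENNReal.ofReal (liftOne _ _ _ _))]
    rfl

/-- A pair comes from one symbol, which hands over to the recursion for symbols, or from two
adjacent symbols, which continues this one; a string of length one has no pair. -/
lemma pexp_stringLaw_adjSum (R : ℕ → Rules v m₂ m₃) (ℓ : ℕ) {c : Fin v → Fin v → ℝ}
    (hc : ∀ z z', 0 ≤ c z z') {F : ℕ → ℝ} (hF : ∀ k, 0 ≤ F k) (α : Fin v) :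
    pexp (stringLaw p₂ ℓ fun i => R i) (fun s => rootInd α s.1 *
        (adjSum (fun z z' => ENNReal.ofReal (c z z')) s.2 * ENNReal.ofReal (F s.2.length))) =
      (v : ℝ≥0∞)⁻¹ * ENNReal.ofReal (pairFun p₂ R ℓ F c α) := by
  induction ℓ generalizing F c with
  | zero =>
    rw [pexp_stringLaw_zero]
    simp [adjSum, pairFun]
  | succ ℓ ih =>
    rw [pexp_stringLaw_succ]
    have hw : ∀ b : Production v, adjSum (fun z z' => ENNReal.ofReal (c z z')) b.word
        = ENNReal.ofReal (siblingPairs c b) := fun b => by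
      cases b <;> simp [Production.word, adjSum, siblingPairs, ENNReal.ofReal_add, hc]
    have hcr : ∀ s s' z z', 0 ≤ crossOp (R ℓ) s s' c z z' := fun s s' z z' =>
      ruleAvg_nonneg _ _ (fun b => ruleAvg_nonneg _ _ (fun b' => hc _ _) _) _
    have hL1 := fun s => liftOne_nonneg p₂.2.1 p₂.2.2 hF s
    have hL2 := fun s s' => liftTwo_nonneg p₂.2.1 p₂.2.2 hF s s'
    have hsp := siblingPairs_nonneg hc
    simp only [adjSum_yieldOf, hw, pexp_mul_left, add_mul, pexp_add,
      pexp_rewriteLaw_sum_ofReal p₂ (R ℓ) hsp hF,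
      pexp_rewriteLaw_adjSum_ofReal p₂ (R ℓ) (fun b b' => hc b.last b'.first) hF,
      mul_add, Finset.mul_sum, pexp_finset_sum, pairFun]
    rw [ENNReal.ofReal_add (Finset.sum_nonneg fun s _ => symFun_nonneg p₂.2.1 p₂.2.2 R ℓ
        (hL1 s) (ruleAvg_nonneg _ _ hsp) α)
      (Finset.sum_nonneg fun s _ => Finset.sum_nonneg fun s' _ =>
        pairFun_nonneg p₂.2.1 p₂.2.2 R ℓ (hL2 s s') (hcr s s') α), mul_add]
    congr 1
    · rw [ENNReal.ofReal_sum_of_nonneg fun s _ => symFun_nonneg p₂.2.1 p₂.2.2 R ℓ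
        (hL1 s) (ruleAvg_nonneg _ _ hsp) α, Finset.mul_sum]
      refine Finset.sum_congr rfl fun s _ => ?_
      rw [← pexp_stringLaw_sum p₂ R ℓ (ruleAvg_nonneg _ _ hsp) (hL1 s)]
      congr 1; ext t
      rw [mul_comm (ENNReal.ofReal (liftOne _ _ _ _))]
    · rw [ENNReal.ofReal_sum_of_nonneg fun s _ => Finset.sum_nonneg fun s' _ =>
        pairFun_nonneg p₂.2.1 p₂.2.2 R ℓ (hL2 s s') (hcr s s') α, Finset.mul_sum]
      refine Finset.sum_congr rfl fun s _ => ?_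
      rw [ENNReal.ofReal_sum_of_nonneg fun s' _ =>
        pairFun_nonneg p₂.2.1 p₂.2.2 R ℓ (hL2 s s') (hcr s s') α, Finset.mul_sum]
      refine Finset.sum_congr rfl fun s' _ => ?_
      rw [← ih (hcr s s') (hL2 s s')]
      congr 1; ext t
      rw [mul_comm (ENNReal.ofReal (liftTwo _ _ _ _ _))]
      rfl

end Transfer

/-! ### Covariances of indicators. -/

/-- The weight of one adjacent pair of a string of length `d`. -/
def pairWeight (d : ℕ) : ℝ := 1 / ((d - 1 : ℕ) : ℝ)

/-- The weight of one position of a string of length `d`. -/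
def posWeight (d : ℕ) : ℝ := 1 / (d : ℝ)

lemma pairWeight_nonneg (d : ℕ) : 0 ≤ pairWeight d := by unfold pairWeight; positivity

lemma posWeight_nonneg (d : ℕ) : 0 ≤ posWeight d := by unfold posWeight; positivity

instance (v : ℕ) : DiscreteMeasurableSpace (Draw v) := ⟨fun _ => trivial⟩

instance (v : ℕ) : DiscreteMeasurableSpace (SymbolDraw v) := ⟨fun _ => trivial⟩

section Covariance

variable {Ω : Type*} [MeasurableSpace Ω] [DiscreteMeasurableSpace Ω]

lemma cov_ind (μ : Measure Ω) [IsProbabilityMeasure μ] (A B : Set Ω) :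
    cov[ind A, ind B; μ] = μ.real (A ∩ B) - μ.real A * μ.real B := by
  have hA : MeasurableSet A := MeasurableSet.of_discrete
  have hB : MeasurableSet B := MeasurableSet.of_discrete
  have mA : MemLp (ind A) 2 μ := memLp_indicator_const 2 hA 1 (Or.inr (measure_ne_top _ _))
  have mB : MemLp (ind B) 2 μ := memLp_indicator_const 2 hB 1 (Or.inr (measure_ne_top _ _))
  rw [covariance_eq_sub mA mB]
  have e : ind A * ind B = ind (A ∩ B) := by
    ext x
    by_cases h1 : x ∈ A <;> by_cases h2 : x ∈ B <;> simp [ind, h1, h2]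
  have i : ∀ C : Set Ω, μ[ind C] = μ.real C := fun C => by
    unfold ind
    rw [integral_indicator_const _ MeasurableSet.of_discrete]
    simp
  rw [e, i, i, i]

/-- The hypothesis says that `B` is independent of `T` when `k` is its probability. On a null event
both sides vanish, so types of probability zero need no separate treatment. -/
lemma real_mul_cov_cond (μ : Measure Ω) [IsProbabilityMeasure μ] (T A B : Set Ω) {k : ℝ}
    (h : μ.real (T ∩ B) = μ.real T * k) :
    μ.real T * cov[ind A, ind B; μ[|T]] = μ.real (T ∩ (A ∩ B)) - μ.real (T ∩ A) * k := by
  by_cases hT : μ T = 0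
  · have h0 : μ.real T = 0 := by simp [Measure.real, hT]
    have h1 : ∀ C, μ.real (T ∩ C) = 0 := fun C => by
      have : μ (T ∩ C) = 0 := measure_mono_null Set.inter_subset_left hT
      simp [Measure.real, this]
    rw [h0, h1, h1]; simp
  · have := cond_isProbabilityMeasure hT
    have hne : μ.real T ≠ 0 := by
      rw [Measure.real, ENNReal.toReal_ne_zero]
      exact ⟨hT, measure_ne_top _ _⟩
    have hc : ∀ C, (μ[|T]).real C = (μ.real T)⁻¹ * μ.real (T ∩ C) := fun C =>
      by rw [Measure.real, cond_apply MeasurableSet.of_discrete, ENNReal.toReal_mul,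
        ENNReal.toReal_inv]; rfl
    rw [cov_ind, hc, hc, hc, h]
    field_simp

end Covariance

/-! ### Joint probabilities of the root and a local event. -/

section Laws

variable {n v m₂ m₃ : ℕ} [NeZero v] [NeZero m₂] [NeZero m₃] (p₂ : unitInterval)

instance (G : Grammar (n + 1) v m₂ m₃) : IsProbabilityMeasure (drawMeasure p₂ G) := by
  unfold drawMeasure; infer_instance

instance {ℓ : ℕ} (G : Grammar ℓ v m₂ m₃) : IsProbabilityMeasure (symbolMeasure p₂ G) := by
  unfold symbolMeasure; infer_instance

omit [NeZero v] in
lemma siblingSum_ofReal {h : PairType → Option (Fin v) → Option (Fin v) → Option (Fin v) → ℝ}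
    (h0 : ∀ t z a b, 0 ≤ h t z a b) (b : Production v) :
    siblingSum (fun t z a b => ENNReal.ofReal (h t z a b)) b = ENNReal.ofReal (siblingSum h b) := by
  cases b
  · rfl
  · simp only [siblingSum]
    rw [ENNReal.ofReal_add (h0 _ _ _ _) (h0 _ _ _ _)]

omit [NeZero v] in
lemma siblingSum_nonneg {h : PairType → Option (Fin v) → Option (Fin v) → Option (Fin v) → ℝ}
    (h0 : ∀ t z a b, 0 ≤ h t z a b) (b : Production v) : 0 ≤ siblingSum h b := by
  cases b
  · exact h0 _ _ _ _
  · exact add_nonneg (h0 _ _ _ _) (h0 _ _ _ _)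

/-- The joint probability of the root and of a local event of the selected pair. -/
lemma drawMeasure_real_eq (R : ℕ → Rules v m₂ m₃) (A : Set (Draw v)) (α : Fin v)
    (h : PairType → Option (Fin v) → Option (Fin v) → Option (Fin v) → ℝ)
    (h0 : ∀ t z a b, 0 ≤ h t z a b) (hnone : h .cross none none none = 0)
    (hA : ∀ r bs i, A.indicator (fun _ => (1 : ℝ≥0∞)) ⟨r, bs, i⟩ = rootInd α r *
      ENNReal.ofReal (h (pairTypeAt bs i) (parentAt bs i) (yieldOf bs)[i]? (yieldOf bs)[i + 1]?)) :
    (drawMeasure p₂ (fun i : Fin (n + 1) => R i)).real A = (v : ℝ)⁻¹ *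
      (∑ s : Bool, symFun p₂ R n (liftOne p₂ s pairWeight) (ruleAvg (R n) s (siblingSum h)) α +
        ∑ s : Bool, ∑ s' : Bool, pairFun p₂ R n (liftTwo p₂ s s' pairWeight)
          (fun z z' => ruleAvg (R n) s (fun b => ruleAvg (R n) s' (fun b' =>
            h .cross (some b.parent) (some b.last) (some b'.first)) z') z) α) := by
  have hL1 := fun s => liftOne_nonneg p₂.2.1 p₂.2.2 pairWeight_nonneg s
  have hL2 := fun s s' => liftTwo_nonneg p₂.2.1 p₂.2.2 pairWeight_nonneg s s'
  have hs := siblingSum_nonneg h0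
  have hc : ∀ s s' z z', 0 ≤ ruleAvg (R n) s (fun b => ruleAvg (R n) s' (fun b' =>
      h .cross (some b.parent) (some b.last) (some b'.first)) z') z := fun s s' z z' =>
    ruleAvg_nonneg _ _ (fun b => ruleAvg_nonneg _ _ (fun b' => h0 _ _ _ _) _) _
  have hsum1 := fun s => symFun_nonneg p₂.2.1 p₂.2.2 R n (hL1 s) (ruleAvg_nonneg (R n) s hs) α
  have hsum2 := fun s s' => pairFun_nonneg p₂.2.1 p₂.2.2 R n (hL2 s s') (hc s s') α
  have hpos : ∀ bs : List (Production v),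
      pexp (positionLaw ((yieldOf bs).length - 1)) (fun i =>
        ENNReal.ofReal (h (pairTypeAt bs i) (parentAt bs i) (yieldOf bs)[i]?
          (yieldOf bs)[i + 1]?)) =
      (bs.map fun b => ENNReal.ofReal (siblingSum h b)).sum *
          ENNReal.ofReal (pairWeight (yieldOf bs).length) +
        adjSum (fun b b' => ENNReal.ofReal (h .cross (some b.parent) (some b.last)
          (some b'.first))) bs * ENNReal.ofReal (pairWeight (yieldOf bs).length) := by
    intro bs
    rw [pexp_positionLaw]
    · rw [sum_positions_eq fun t z a b => ENNReal.ofReal (h t z a b)]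
      rw [List.map_congr_left fun b _ => siblingSum_ofReal h0 b]
      simp only [pairWeight]
      ring
    -- A nonempty list of productions has at least two tokens, so only the empty list has no
    -- position. There the default position reads type `.cross` and `none` everywhere, which `hnone`
    -- removes.
    · intro hlen
      cases bs with
      | nil => simp [pairTypeAt, parentAt, yieldOf, hnone]
      | cons b bs =>
        exfalso
        rw [length_yieldOf_cons] at hlen
        cases b <;> simp only [Production.word, List.length_cons] at hlen <;> omega
  have key : drawMeasure p₂ (fun i : Fin (n + 1) => R i) A = (v : ℝ≥0∞)⁻¹ * ENNReal.ofReal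
      (∑ s : Bool, symFun p₂ R n (liftOne p₂ s pairWeight) (ruleAvg (R n) s (siblingSum h)) α +
        ∑ s : Bool, ∑ s' : Bool, pairFun p₂ R n (liftTwo p₂ s s' pairWeight)
          (fun z z' => ruleAvg (R n) s (fun b => ruleAvg (R n) s' (fun b' =>
            h .cross (some b.parent) (some b.last) (some b'.first)) z') z) α) := by
    unfold drawMeasure
    rw [toMeasure_apply_eq_pexp _ MeasurableSet.of_discrete, pexp_bind]
    simp_rw [pexp_bind, pexp_map, hA, pexp_mul_left, hpos, pexp_add]
    have e : (fun i : Fin (n + 1) => R i) (Fin.last n) = R n := rfl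
    simp only [e, pexp_rewriteLaw_sum_ofReal p₂ (R n) hs pairWeight_nonneg,
      pexp_rewriteLaw_adjSum_ofReal p₂ (R n) (fun b b' => h0 _ _ _ _) pairWeight_nonneg,
      mul_add, Finset.mul_sum, pexp_finset_sum, pexp_add]
    rw [ENNReal.ofReal_add (Finset.sum_nonneg fun s _ => hsum1 s)
      (Finset.sum_nonneg fun s _ => Finset.sum_nonneg fun s' _ => hsum2 s s'), mul_add]
    congr 1
    · rw [ENNReal.ofReal_sum_of_nonneg fun s _ => hsum1 s, Finset.mul_sum]
      refine Finset.sum_congr rfl fun s _ => ?_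
      rw [← pexp_stringLaw_sum p₂ R n (ruleAvg_nonneg _ _ hs) (hL1 s)]
      congr 1; ext t
      rw [mul_comm (ENNReal.ofReal (liftOne _ _ _ _))]
    · rw [ENNReal.ofReal_sum_of_nonneg fun s _ => Finset.sum_nonneg fun s' _ => hsum2 s s',
        Finset.mul_sum]
      refine Finset.sum_congr rfl fun s _ => ?_
      rw [ENNReal.ofReal_sum_of_nonneg fun s' _ => hsum2 s s', Finset.mul_sum]
      refine Finset.sum_congr rfl fun s' _ => ?_
      rw [← pexp_stringLaw_adjSum p₂ R n (hc s s') (hL2 s s')]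
      congr 1; ext t
      rw [mul_comm (ENNReal.ofReal (liftTwo _ _ _ _ _))]
  rw [Measure.real, key, ENNReal.toReal_mul, ENNReal.toReal_ofReal
    (add_nonneg (Finset.sum_nonneg fun s _ => hsum1 s)
      (Finset.sum_nonneg fun s _ => Finset.sum_nonneg fun s' _ => hsum2 s s'))]
  simp

lemma drawMeasure_real_root (R : ℕ → Rules v m₂ m₃) (α : Fin v) :
    (drawMeasure p₂ (fun i : Fin (n + 1) => R i)).real (Draw.rootEvent α) = (v : ℝ)⁻¹ := by
  have : drawMeasure p₂ (fun i : Fin (n + 1) => R i) (Draw.rootEvent α) = (v : ℝ≥0∞)⁻¹ := by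
    unfold drawMeasure
    rw [toMeasure_apply_eq_pexp _ MeasurableSet.of_discrete, pexp_bind,
      ← pexp_stringLaw_root p₂ R n α]
    simp_rw [pexp_bind, pexp_map]
    congr 1; ext s
    have : ∀ bs i, (Draw.rootEvent α).indicator (fun _ => (1 : ℝ≥0∞)) (⟨s.1, bs, i⟩ : Draw v)
        = rootInd α s.1 := fun bs i => by
      unfold rootInd Draw.rootEvent
      rw [Set.indicator_apply]; rfl
    simp only [this, pexp_const]
  rw [Measure.real, this]; simp

lemma symbolMeasure_real_eq (R : ℕ → Rules v m₂ m₃) (ℓ : ℕ) (z α : Fin v) :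
    (symbolMeasure p₂ (fun i : Fin ℓ => R i)).real
      ({ω : SymbolDraw v | ω.symbol = some z} ∩ {ω : SymbolDraw v | ω.root = α}) =
      (v : ℝ)⁻¹ * symFun p₂ R ℓ posWeight (fun y => if y = z then 1 else 0) α := by
  have h0 : ∀ y, (0 : ℝ) ≤ (fun y => if y = z then (1 : ℝ) else 0) y := fun y => by
    simp only; split_ifs <;> simp
  have key : symbolMeasure p₂ (fun i : Fin ℓ => R i)
      ({ω : SymbolDraw v | ω.symbol = some z} ∩ {ω : SymbolDraw v | ω.root = α}) =
      (v : ℝ≥0∞)⁻¹ * ENNReal.ofReal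
        (symFun p₂ R ℓ posWeight (fun y => if y = z then 1 else 0) α) := by
    unfold symbolMeasure
    rw [toMeasure_apply_eq_pexp _ MeasurableSet.of_discrete, pexp_bind,
      ← pexp_stringLaw_sum p₂ R ℓ h0 posWeight_nonneg]
    simp_rw [pexp_map]
    congr 1; ext s
    have e : ∀ i : ℕ, ({ω : SymbolDraw v | ω.symbol = some z} ∩
        {ω : SymbolDraw v | ω.root = α}).indicator (fun _ => (1 : ℝ≥0∞)) ⟨s.1, s.2[i]?⟩ =
        rootInd α s.1 * (fun o : Option (Fin v) => if o = some z then 1 else 0) s.2[i]? := by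
      intro i
      by_cases h1 : s.1 = α <;> by_cases h2 : s.2[i]? = some z <;> simp [rootInd, h1, h2]
    simp only [e, pexp_mul_left]
    congr 1
    rw [pexp_positionLaw, sum_map_eq_sum_range
      (fun o : Option (Fin v) => if o = some z then (1 : ℝ≥0∞) else 0), mul_comm]
    · congr 2
      refine List.map_congr_left fun y _ => ?_
      by_cases h : y = z <;> simp [h]
    · intro hl
      have := List.length_eq_zero_iff.1 hl
      simp [this]
  rw [Measure.real, key, ENNReal.toReal_mul, ENNReal.toReal_ofReal
    (symFun_nonneg p₂.2.1 p₂.2.2 R ℓ posWeight_nonneg h0 α)]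
  simp

lemma symbolMeasure_real_root (R : ℕ → Rules v m₂ m₃) (ℓ : ℕ) (α : Fin v) :
    (symbolMeasure p₂ (fun i : Fin ℓ => R i)).real {ω : SymbolDraw v | ω.root = α}
      = (v : ℝ)⁻¹ := by
  have : symbolMeasure p₂ (fun i : Fin ℓ => R i) {ω : SymbolDraw v | ω.root = α}
      = (v : ℝ≥0∞)⁻¹ := by
    unfold symbolMeasure
    rw [toMeasure_apply_eq_pexp _ MeasurableSet.of_discrete, pexp_bind,
      ← pexp_stringLaw_root p₂ R ℓ α]
    simp_rw [pexp_map]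
    congr 1; ext s
    have : ∀ i : ℕ, {ω : SymbolDraw v | ω.root = α}.indicator (fun _ => (1 : ℝ≥0∞))
        (⟨s.1, s.2[i]?⟩ : SymbolDraw v) = rootInd α s.1 := fun i => by
      unfold rootInd
      rw [Set.indicator_apply]; rfl
    simp only [this, pexp_const]
  rw [Measure.real, this]; simp

end Laws

/-! ### The covariances as centered functions of the root, and the exact decomposition. -/

/-- The value of `symFun` on the constant function `1`. -/
def symConst (p : ℝ) : ℕ → (ℕ → ℝ) → ℝ
  | 0, F => F 1
  | ℓ + 1, F => 2 * symConst p ℓ (liftOne p true F) + 3 * symConst p ℓ (liftOne p false F)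

/-- The indicator of a pair of symbols. -/
def pairInd {v : ℕ} (a b x y : Fin v) : ℝ := if x = a ∧ y = b then 1 else 0

/-- The indicator of a symbol. -/
def symInd {v : ℕ} (z y : Fin v) : ℝ := if y = z then 1 else 0

/-- The expectation, given the root, of a function of the selected pair on the event that it has
a given type. -/
def contribFun {v m₂ m₃ : ℕ} (p : ℝ) (R : ℕ → Rules v m₂ m₃) (n : ℕ) :
    PairType → (Fin v → Fin v → ℝ) → Fin v → ℝ
  | .bin, c, α => symFun p R n (liftOne p true pairWeight) (ruleAvg (R n) true (siblingPairs c)) α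
  | .ter, c, α => symFun p R n (liftOne p false pairWeight) (ruleAvg (R n) false (siblingPairs c)) α
  | .cross, c, α => ∑ s : Bool, ∑ s' : Bool,
      pairFun p R n (liftTwo p s s' pairWeight) (crossOp (R n) s s' c) α

section Linear

variable {v m₂ m₃ : ℕ} (p : ℝ) (R : ℕ → Rules v m₂ m₃)

lemma ruleOp_add (r : Rules v m₂ m₃) (θ : ℝ × ℝ × ℝ) (s : Bool) (f g : Fin v → ℝ) :
    ruleOp r θ s (fun z => f z + g z) = fun z => ruleOp r θ s f z + ruleOp r θ s g z := by
  ext z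
  unfold ruleOp
  rw [← ruleAvg_add]
  congr 1; ext b
  cases b <;> simp only [childSum] <;> ring

lemma ruleOp_mul (r : Rules v m₂ m₃) (θ : ℝ × ℝ × ℝ) (s : Bool) (k : ℝ) (f : Fin v → ℝ) :
    ruleOp r θ s (fun z => k * f z) = fun z => k * ruleOp r θ s f z := by
  ext z
  unfold ruleOp
  rw [← ruleAvg_mul]
  congr 1; ext b
  cases b <;> simp only [childSum] <;> ring

lemma symFun_add (ℓ : ℕ) (F : ℕ → ℝ) (f g : Fin v → ℝ) (α : Fin v) :
    symFun p R ℓ F (fun z => f z + g z) α = symFun p R ℓ F f α + symFun p R ℓ F g α := by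
  induction ℓ generalizing F f g with
  | zero => simp only [symFun, mul_add]
  | succ ℓ ih => simp only [symFun, ruleOp_add, ih, Finset.sum_add_distrib]

lemma symFun_mul (ℓ : ℕ) (F : ℕ → ℝ) (k : ℝ) (f : Fin v → ℝ) (α : Fin v) :
    symFun p R ℓ F (fun z => k * f z) α = k * symFun p R ℓ F f α := by
  induction ℓ generalizing F f with
  | zero => simp only [symFun]; ring
  | succ ℓ ih => simp only [symFun, ruleOp_mul, ih, Finset.mul_sum]

lemma symFun_zero (ℓ : ℕ) (F : ℕ → ℝ) (α : Fin v) : symFun p R ℓ F (fun _ => 0) α = 0 := by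
  simpa using symFun_mul p R ℓ F 0 (fun _ => 0) α

lemma symFun_finset_sum {ι : Type*} (t : Finset ι) (ℓ : ℕ) (F : ℕ → ℝ) (f : ι → Fin v → ℝ)
    (α : Fin v) :
    symFun p R ℓ F (fun z => ∑ i ∈ t, f i z) α = ∑ i ∈ t, symFun p R ℓ F (f i) α := by
  classical
  induction t using Finset.induction_on with
  | empty => simpa using symFun_zero p R ℓ F α
  | insert i t hi ih =>
    simp only [Finset.sum_insert hi, symFun_add, ih]

lemma ruleOp_allPos_const [NeZero m₂] [NeZero m₃] (r : Rules v m₂ m₃) (s : Bool) (k : ℝ) :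
    ruleOp r allPos s (fun _ => k) = fun _ => (arityLen s : ℝ) * k := by
  have h2 : (m₂ : ℝ) ≠ 0 := by exact_mod_cast NeZero.ne m₂
  have h3 : (m₃ : ℝ) ≠ 0 := by exact_mod_cast NeZero.ne m₃
  ext z
  cases s <;> simp [ruleOp, ruleAvg, childSum, allPos, arityLen] <;> field_simp <;> ring

lemma symFun_const [NeZero m₂] [NeZero m₃] (ℓ : ℕ) (F : ℕ → ℝ) (k : ℝ) (α : Fin v) :
    symFun p R ℓ F (fun _ => k) α = k * symConst p ℓ F := by
  induction ℓ generalizing F k with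
  | zero => simp only [symFun, symConst]; ring
  | succ ℓ ih =>
    simp only [symFun, ruleOp_allPos_const, ih, symConst, Fintype.sum_bool, arityLen, if_true,
      Bool.false_eq_true, if_false]
    push_cast; ring

lemma ruleAvg_zero (r : Rules v m₂ m₃) (s : Bool) (z : Fin v) : ruleAvg r s (fun _ => 0) z = 0 := by
  cases s <;> simp [ruleAvg]

lemma pairFun_zero (ℓ : ℕ) (F : ℕ → ℝ) (α : Fin v) : pairFun p R ℓ F (fun _ _ => 0) α = 0 := by
  induction ℓ generalizing F with
  | zero => rfl
  | succ ℓ ih =>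
    have h1 : siblingPairs (fun _ _ : Fin v => (0 : ℝ)) = fun _ => 0 := by
      ext b; cases b <;> simp [siblingPairs]
    have h2 : ∀ s s', crossOp (R ℓ) s s' (fun _ _ : Fin v => (0 : ℝ)) = fun _ _ => 0 := by
      intro s s'; ext z z'; simp [crossOp, ruleAvg_zero]
    have h3 : ∀ s, ruleAvg (R ℓ) s (fun _ => 0) = fun _ => 0 := fun s => by
      ext z; exact ruleAvg_zero _ _ _
    simp [pairFun, h1, h2, h3, ih, symFun_zero]

end Linear

section Formulas

variable {n v m₂ m₃ : ℕ} [NeZero v] [NeZero m₂] [NeZero m₃] (p₂ : unitInterval)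
  (R : ℕ → Rules v m₂ m₃)

/-- Abbreviation for the law of a sentence of the grammar of depth `n + 1` with rules `R`. -/
abbrev drawOf (n : ℕ) : Measure (Draw v) := drawMeasure p₂ (fun i : Fin (n + 1) => R i)

lemma drawOf_type_pair (t : PairType) (a b α : Fin v) :
    (drawOf p₂ R n).real (Draw.typeEvent t ∩ (Draw.pairEvent a b ∩ Draw.rootEvent α)) =
      (v : ℝ)⁻¹ * contribFun p₂ R n t (pairInd a b) α := by
  classical
  have hrule : ∀ f, (∀ z x y, f (Production.bin z x y) = 0) →
      ruleAvg (R n) true f = fun _ => 0 := fun f hf => by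
    ext z; simp [ruleAvg, hf]
  have hrule' : ∀ f, (∀ z x y w, f (Production.ter z x y w) = 0) →
      ruleAvg (R n) false f = fun _ => 0 := fun f hf => by
    ext z; simp [ruleAvg, hf]
  rw [drawMeasure_real_eq p₂ R _ α
    (fun τ _ x y => if τ = t ∧ x = some a ∧ y = some b then 1 else 0)
    (fun τ _ x y => by split_ifs <;> simp) (by simp)]
  · congr 1
    cases t with
    | bin =>
      simp only [contribFun, Fintype.sum_bool, reduceCtorEq, false_and, if_false, ruleAvg_zero,
        pairFun_zero, add_zero]
      rw [hrule' (siblingSum _) (by simp [siblingSum]), symFun_zero, add_zero]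
      congr 1
      ext z
      simp [ruleAvg, siblingSum, siblingPairs, pairInd]
    | ter =>
      simp only [contribFun, Fintype.sum_bool, reduceCtorEq, false_and, if_false, ruleAvg_zero,
        pairFun_zero, add_zero]
      rw [hrule (siblingSum _) (by simp [siblingSum]), symFun_zero, zero_add]
      congr 1
      ext z
      simp [ruleAvg, siblingSum, siblingPairs, pairInd]
    | cross =>
      rw [Fintype.sum_bool (fun s => symFun _ _ _ _ _ _), hrule' (siblingSum _) (by simp [siblingSum]),
        hrule (siblingSum _) (by simp [siblingSum]), symFun_zero, symFun_zero, add_zero, zero_add]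
      simp only [contribFun, true_and, Option.some.injEq]
      rfl
  · intro r bs i
    simp only [Set.indicator_apply, Set.mem_inter_iff, Draw.typeEvent, Draw.pairEvent,
      Draw.rootEvent, Set.mem_ofPred_eq, rootInd]
    by_cases h1 : r = α <;> simp [h1, apply_ite ENNReal.ofReal]

lemma drawOf_bin_parent (z α : Fin v) :
    (drawOf p₂ R n).real (Draw.typeEvent .bin ∩ (Draw.parentEvent z ∩ Draw.rootEvent α)) =
      (v : ℝ)⁻¹ * symFun p₂ R n (liftOne p₂ true pairWeight) (symInd z) α := by
  classical
  have hm : (m₂ : ℝ) ≠ 0 := by exact_mod_cast NeZero.ne m₂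
  rw [drawMeasure_real_eq p₂ R _ α
    (fun τ y _ _ => if τ = .bin ∧ y = some z then 1 else 0)
    (fun τ _ x y => by split_ifs <;> simp) (by simp)]
  · congr 1
    simp only [Fintype.sum_bool, reduceCtorEq, false_and, if_false, ruleAvg_zero,
        pairFun_zero, add_zero]
    have h1 : ruleAvg (R n) false (siblingSum fun τ y _ _ : _ => if τ = PairType.bin ∧ y = some z
        then (1 : ℝ) else 0) = fun _ => 0 := by
      ext y; simp [ruleAvg, siblingSum]
    rw [h1, symFun_zero, add_zero]
    congr 1
    ext y
    simp [ruleAvg, siblingSum, symInd]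
  · intro r bs i
    simp only [Set.indicator_apply, Set.mem_inter_iff, Draw.typeEvent, Draw.parentEvent,
      Draw.rootEvent, Set.mem_ofPred_eq, rootInd]
    by_cases h1 : r = α <;> simp [h1, apply_ite ENNReal.ofReal]

lemma drawOf_bin_root (α : Fin v) :
    (drawOf p₂ R n).real (Draw.typeEvent .bin ∩ Draw.rootEvent α) =
      symConst p₂ n (liftOne p₂ true pairWeight) * (v : ℝ)⁻¹ := by
  classical
  rw [drawMeasure_real_eq p₂ R _ α (fun τ _ _ _ => if τ = .bin then 1 else 0)
    (fun τ _ x y => by split_ifs <;> simp) (by simp), mul_comm]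
  · congr 1
    simp only [Fintype.sum_bool, reduceCtorEq, if_false, ruleAvg_zero,
        pairFun_zero, add_zero]
    have h1 : ruleAvg (R n) false (siblingSum fun τ (_ _ _ : Option (Fin v)) =>
        if τ = PairType.bin then (1 : ℝ) else 0) = fun _ => 0 := by
      ext y; simp [ruleAvg, siblingSum]
    have h2 : ruleAvg (R n) true (siblingSum fun τ (_ _ _ : Option (Fin v)) =>
        if τ = PairType.bin then (1 : ℝ) else 0) = fun _ => 1 := by
      ext y; rw [← ruleAvg_const (R n) true 1 y]; simp [ruleAvg, siblingSum]
    rw [h1, h2, symFun_zero, add_zero, symFun_const, one_mul]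
  · intro r bs i
    simp only [Set.indicator_apply, Set.mem_inter_iff, Draw.typeEvent,
      Draw.rootEvent, Set.mem_ofPred_eq, rootInd]
    by_cases h1 : r = α <;> simp [h1, apply_ite ENNReal.ofReal]

lemma drawOf_ter_root (α : Fin v) :
    (drawOf p₂ R n).real (Draw.typeEvent .ter ∩ Draw.rootEvent α) =
      2 * symConst p₂ n (liftOne p₂ false pairWeight) * (v : ℝ)⁻¹ := by
  classical
  rw [drawMeasure_real_eq p₂ R _ α (fun τ _ _ _ => if τ = .ter then 1 else 0)
    (fun τ _ x y => by split_ifs <;> simp) (by simp), mul_comm]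
  · congr 1
    simp only [Fintype.sum_bool, reduceCtorEq, if_false, ruleAvg_zero,
        pairFun_zero, add_zero]
    have h1 : ruleAvg (R n) true (siblingSum fun τ (_ _ _ : Option (Fin v)) =>
        if τ = PairType.ter then (1 : ℝ) else 0) = fun _ => 0 := by
      ext y; simp [ruleAvg, siblingSum]
    have h2 : ruleAvg (R n) false (siblingSum fun τ (_ _ _ : Option (Fin v)) =>
        if τ = PairType.ter then (1 : ℝ) else 0) = fun _ => 2 := by
      ext y; rw [← ruleAvg_const (R n) false 2 y]; simp [ruleAvg, siblingSum]; left; ring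
    rw [h1, h2, symFun_zero, zero_add, symFun_const]
  · intro r bs i
    simp only [Set.indicator_apply, Set.mem_inter_iff, Draw.typeEvent,
      Draw.rootEvent, Set.mem_ofPred_eq, rootInd]
    by_cases h1 : r = α <;> simp [h1, apply_ite ENNReal.ofReal]

omit [NeZero v] in
lemma sum_real_inter_fiber {Ω : Type*} [MeasurableSpace Ω] [DiscreteMeasurableSpace Ω]
    (μ : Measure Ω) [IsProbabilityMeasure μ] (r : Ω → Fin v) (A : Set Ω) :
    ∑ α, μ.real (A ∩ {ω | r ω = α}) = μ.real A := by
  rw [← measureReal_biUnion_finset]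
  · congr 1
    ext ω; simp
  · intro α _ β _ h
    rw [Function.onFun, Set.disjoint_left]
    rintro ω ⟨_, h1⟩ ⟨_, h2⟩
    exact h (h1.symm.trans h2)
  · intro _ _; exact MeasurableSet.of_discrete

omit [NeZero v] in
lemma sum_real_type_inter (μ : Measure (Draw v)) [IsProbabilityMeasure μ] (A : Set (Draw v)) :
    μ.real (Draw.typeEvent .bin ∩ A) + μ.real (Draw.typeEvent .ter ∩ A)
      + μ.real (Draw.typeEvent .cross ∩ A) = μ.real A := by
  have h1 : Disjoint (Draw.typeEvent (v := v) .bin ∩ A) (Draw.typeEvent .ter ∩ A) := by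
    rw [Set.disjoint_left]; rintro ω ⟨h1, _⟩ ⟨h2, _⟩
    simp [Draw.typeEvent] at h1 h2; simp [h1] at h2
  have h2 : Disjoint (Draw.typeEvent (v := v) .bin ∩ A ∪ Draw.typeEvent .ter ∩ A)
      (Draw.typeEvent .cross ∩ A) := by
    rw [Set.disjoint_left]; rintro ω (⟨h1, _⟩ | ⟨h1, _⟩) ⟨h2, _⟩ <;>
    · simp [Draw.typeEvent] at h1 h2; simp [h1] at h2
  rw [← measureReal_union h1 MeasurableSet.of_discrete,
    ← measureReal_union h2 MeasurableSet.of_discrete]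
  congr 1
  ext ω
  simp only [Draw.typeEvent, Set.mem_union, Set.mem_inter_iff, Set.mem_ofPred_eq]
  cases pairTypeAt ω.productions ω.pos <;> simp

lemma typeProb_eq_of_root (t : PairType) {k : ℝ}
    (h : ∀ α, (drawOf p₂ R n).real (Draw.typeEvent t ∩ Draw.rootEvent α) = k * (v : ℝ)⁻¹) :
    typeProb p₂ (fun i : Fin (n + 1) => R i) t = k := by
  have hv : (v : ℝ) ≠ 0 := by exact_mod_cast NeZero.ne v
  rw [typeProb, ← sum_real_inter_fiber _ Draw.root]
  have e : ∀ α, (drawOf p₂ R n).real (Draw.typeEvent t ∩ {ω | ω.root = α}) = k * (v : ℝ)⁻¹ := h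
  rw [Finset.sum_congr rfl fun α _ => e α]
  simp; field_simp

/-- The probability of a binary pair depends on `n` and `p₂` alone, not on the rules or their
numbers; this is needed for a constant `κ`. -/
lemma typeProb_bin : typeProb p₂ (fun i : Fin (n + 1) => R i) .bin =
    symConst p₂ n (liftOne p₂ true pairWeight) :=
  typeProb_eq_of_root p₂ R .bin (drawOf_bin_root p₂ R)

/-- The type is determined by arities and position, which carry no information on the root. The
cross case is the complement of the other two within the mass `1 / v` of each root. -/
lemma drawOf_type_root (t : PairType) (α : Fin v) :
    (drawOf p₂ R n).real (Draw.typeEvent t ∩ Draw.rootEvent α) =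
      typeProb p₂ (fun i : Fin (n + 1) => R i) t * (v : ℝ)⁻¹ := by
  cases t with
  | bin => rw [typeProb_bin, drawOf_bin_root]
  | ter => rw [typeProb_eq_of_root p₂ R .ter (drawOf_ter_root p₂ R), drawOf_ter_root]
  | cross =>
    have h : ∀ α, (drawOf p₂ R n).real (Draw.typeEvent .cross ∩ Draw.rootEvent α) =
        (1 - symConst p₂ n (liftOne p₂ true pairWeight)
          - 2 * symConst p₂ n (liftOne p₂ false pairWeight)) * (v : ℝ)⁻¹ := fun α => by
      have := sum_real_type_inter (drawOf p₂ R n) (Draw.rootEvent α)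
      rw [drawOf_bin_root, drawOf_ter_root, drawMeasure_real_root] at this
      linarith
    rw [typeProb_eq_of_root p₂ R .cross h, h]

-- Since the root is uniform, subtracting the product of the probabilities is subtracting the mean
-- over the roots.
omit [NeZero v] in
lemma real_inter_root_sub (μ : Measure (Draw v)) [IsProbabilityMeasure μ] (A : Set (Draw v))
    (f : Fin v → ℝ) (h : ∀ α, μ.real (A ∩ Draw.rootEvent α) = f α) (α : Fin v) :
    μ.real (A ∩ Draw.rootEvent α) - μ.real A * (v : ℝ)⁻¹ = cen f α := by
  rw [← sum_real_inter_fiber μ Draw.root A, cen, h, div_eq_mul_inv]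
  congr 2
  exact Finset.sum_congr rfl fun α _ => h α

/-- The contribution of a pair type as a centered function of the root. -/
lemma typeContribution_eq (t : PairType) (a b α : Fin v) :
    typeContribution p₂ (fun i : Fin (n + 1) => R i) t a b α =
      (v : ℝ)⁻¹ * cen (contribFun p₂ R n t (pairInd a b)) α := by
  have h := real_mul_cov_cond (drawOf p₂ R n) (Draw.typeEvent t) (Draw.pairEvent a b)
    (Draw.rootEvent α) (drawOf_type_root p₂ R t α)
  rw [typeContribution]
  refine h.trans ?_
  rw [← Set.inter_assoc, real_inter_root_sub _ _
    (fun α => (v : ℝ)⁻¹ * contribFun p₂ R n t (pairInd a b) α), cen_mul]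
  intro α
  rw [Set.inter_assoc, drawOf_type_pair]

lemma typeProb_mul_parentCov (z α : Fin v) :
    typeProb p₂ (fun i : Fin (n + 1) => R i) .bin * parentCov p₂ (fun i : Fin (n + 1) => R i) z α =
      (v : ℝ)⁻¹ * cen (symFun p₂ R n (liftOne p₂ true pairWeight) (symInd z)) α := by
  have h := real_mul_cov_cond (drawOf p₂ R n) (Draw.typeEvent .bin) (Draw.parentEvent z)
    (Draw.rootEvent α) (drawOf_type_root p₂ R .bin α)
  rw [parentCov]
  refine h.trans ?_
  rw [← Set.inter_assoc, real_inter_root_sub _ _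
    (fun α => (v : ℝ)⁻¹ * symFun p₂ R n (liftOne p₂ true pairWeight) (symInd z) α), cen_mul]
  intro α
  rw [Set.inter_assoc, drawOf_bin_parent]

lemma symbolCov_eq (ℓ : ℕ) (z α : Fin v) :
    symbolCov p₂ (fun i : Fin ℓ => R i) z α =
      (v : ℝ)⁻¹ * cen (symFun p₂ R ℓ posWeight (symInd z)) α := by
  rw [symbolCov, cov_ind, symbolMeasure_real_root, symbolMeasure_real_eq,
    ← sum_real_inter_fiber _ SymbolDraw.root]
  have e : ∀ β : Fin v, (symbolMeasure p₂ (fun i : Fin ℓ => R i)).real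
      ({ω : SymbolDraw v | ω.symbol = some z} ∩ {ω | ω.root = β}) =
      (v : ℝ)⁻¹ * symFun p₂ R ℓ posWeight (symInd z) β := fun β => symbolMeasure_real_eq p₂ R ℓ z β
  rw [Finset.sum_congr rfl fun β _ => e β, ← Finset.mul_sum, cen]
  change (v : ℝ)⁻¹ * symFun p₂ R ℓ posWeight (symInd z) α - _ = _
  ring

/-- This is the law of total covariance; its between-type term is zero, because every type is
independent of the root. -/
lemma pairCov_eq_sum (a b α : Fin v) :
    pairCov p₂ (fun i : Fin (n + 1) => R i) a b α =
      typeContribution p₂ (fun i : Fin (n + 1) => R i) .bin a b α +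
      typeContribution p₂ (fun i : Fin (n + 1) => R i) .ter a b α +
      typeContribution p₂ (fun i : Fin (n + 1) => R i) .cross a b α := by
  have h := fun t => real_mul_cov_cond (drawOf p₂ R n) (Draw.typeEvent t) (Draw.pairEvent a b)
    (Draw.rootEvent α) (drawOf_type_root p₂ R t α)
  have h' : ∀ t, typeContribution p₂ (fun i : Fin (n + 1) => R i) t a b α =
      (drawOf p₂ R n).real (Draw.typeEvent t ∩ (Draw.pairEvent a b ∩ Draw.rootEvent α)) -
      (drawOf p₂ R n).real (Draw.typeEvent t ∩ Draw.pairEvent a b) * (v : ℝ)⁻¹ := h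
  rw [pairCov, cov_ind, drawMeasure_real_root, h', h', h']
  have h1 := sum_real_type_inter (drawOf p₂ R n) (Draw.pairEvent a b ∩ Draw.rootEvent α)
  have h2 := sum_real_type_inter (drawOf p₂ R n) (Draw.pairEvent a b)
  rw [← h1, ← h2]
  ring

omit [NeZero v] [NeZero m₂] [NeZero m₃] in
lemma ruleAvg_pairInd_eq (a b z : Fin v) :
    ruleAvg (R n) true (siblingPairs (pairInd a b)) z =
      binaryRuleProb (fun i : Fin (n + 1) => R i) z a b := by
  classical
  have hR : (fun i : Fin (n + 1) => R i) (Fin.last n) = R n := rfl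
  unfold binaryRuleProb
  simp only [ruleAvg, siblingPairs, pairInd]
  split_ifs with h
  · obtain ⟨j, hj⟩ := h
    rw [hR] at hj
    rw [Finset.sum_eq_single j]
    · simp [hj]
    · intro j' _ hne
      rw [if_neg]
      rintro ⟨h1, h2⟩
      have : (R n).1 (z, j') = (R n).1 (z, j) := by rw [hj]; exact Prod.ext h1 h2
      exact hne (Prod.ext_iff.1 ((R n).1.injective this)).2
    · simp
  · rw [Finset.sum_eq_zero, mul_zero]
    intro j _
    rw [if_neg]
    rintro ⟨h1, h2⟩
    exact h ⟨j, by rw [hR]; exact Prod.ext h1 h2⟩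

/-- Given the parent, a binary pair is independent of the root. In the recursion this is linearity
of `symFun` in the last-level function, expanded into indicators of the parent. -/
lemma binaryTerm_parentCov (a b α : Fin v) :
    binaryTerm p₂ (fun i : Fin (n + 1) => R i) (parentCov p₂ fun i : Fin (n + 1) => R i) a b α =
      typeContribution p₂ (fun i : Fin (n + 1) => R i) .bin a b α := by
  have e1 : ruleAvg (R n) true (siblingPairs (pairInd a b)) =
      fun y => ∑ z, binaryRuleProb (fun i : Fin (n + 1) => R i) z a b * symInd z y := by
    ext y
    rw [ruleAvg_pairInd_eq]
    simp [symInd]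
  have e2 : contribFun p₂ R n .bin (pairInd a b) = fun α =>
      ∑ z, binaryRuleProb (fun i : Fin (n + 1) => R i) z a b *
        symFun p₂ R n (liftOne p₂ true pairWeight) (symInd z) α := by
    ext α
    simp only [contribFun, e1, symFun_finset_sum, symFun_mul]
  have e3 : cen (contribFun p₂ R n .bin (pairInd a b)) α =
      ∑ z, binaryRuleProb (fun i : Fin (n + 1) => R i) z a b *
        cen (symFun p₂ R n (liftOne p₂ true pairWeight) (symInd z)) α := by
    rw [e2]
    simp only [cen, mul_sub, Finset.sum_sub_distrib]
    congr 1
    rw [Finset.sum_comm, Finset.sum_div]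
    refine Finset.sum_congr rfl fun z _ => ?_
    rw [← Finset.mul_sum]; ring
  rw [typeContribution_eq, e3, binaryTerm, Finset.mul_sum, Finset.mul_sum]
  refine Finset.sum_congr rfl fun z _ => ?_
  rw [mul_left_comm, typeProb_mul_parentCov]
  ring

omit [NeZero m₃] [NeZero m₂] [NeZero v] in
lemma binaryRuleProb_unique (G : Grammar (n + 1) v m₂ m₃) {z a b : Fin v}
    (h : IsBinaryRule G z a b) (C : Fin v → ℝ) :
    ∑ y, binaryRuleProb G y a b * C y = 1 / (m₂ : ℝ) * C z := by
  classical
  rw [Finset.sum_eq_single z]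
  · rw [binaryRuleProb, if_pos h]
  · intro y _ hy
    rw [binaryRuleProb, if_neg, zero_mul]
    rintro ⟨j, hj⟩
    obtain ⟨i, hi⟩ := h
    have := (G (Fin.last n)).1.injective (hj.trans hi.symm)
    exact hy (Prod.ext_iff.1 this).1
  · simp

omit [NeZero m₃] [NeZero m₂] [NeZero v] in
lemma binaryRuleProb_sum_eq_zero (G : Grammar (n + 1) v m₂ m₃) {a b : Fin v}
    (h : ∀ y, ¬ IsBinaryRule G y a b) (C : Fin v → ℝ) :
    ∑ y, binaryRuleProb G y a b * C y = 0 := by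
  classical
  refine Finset.sum_eq_zero fun y _ => ?_
  rw [binaryRuleProb, if_neg (h y), zero_mul]

/-- The rules of a grammar as a sequence. -/
def levels (G : Grammar (n + 1) v m₂ m₃) (i : ℕ) : Rules v m₂ m₃ :=
  if h : i < n + 1 then G ⟨i, h⟩ else G 0

omit [NeZero m₃] [NeZero m₂] [NeZero v] in
lemma levels_eq (G : Grammar (n + 1) v m₂ m₃) : (fun i : Fin (n + 1) => levels G i) = G := by
  ext1 i
  exact dif_pos i.2

lemma pairCov_decomposition (G : Grammar (n + 1) v m₂ m₃) (a b α : Fin v) :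
    pairCov p₂ G a b α = binaryTerm p₂ G (parentCov p₂ G) a b α
      + typeContribution p₂ G .ter a b α + typeContribution p₂ G .cross a b α := by
  rw [← levels_eq G, pairCov_eq_sum, binaryTerm_parentCov]

end Formulas

/-! ### Expansion over words of arities. -/

section Expansion

variable {v m₂ m₃ : ℕ}

/-- The centered influence of the root `α` on a level-`i` symbol along the arities of a word of
length `i`, whose head is the arity of the last level. -/
def row (R : ℕ → Rules v m₂ m₃) (α : Fin v) : List Bool → Fin v → ℝ
  | [], y => cen (symInd y) α
  | s :: w, y => ∑ u, row R α w u * ruleOp (R w.length) allPos s (symInd y) u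

/-- The function of a level-`i` symbol obtained by pulling back `f` along the arities of a word,
whose head is the arity of the first level. -/
def leaf (R : ℕ → Rules v m₂ m₃) (θ : ℝ × ℝ × ℝ) : ℕ → List Bool → (Fin v → ℝ) → Fin v → ℝ
  | _, [], f => f
  | i, s :: w, f => ruleOp (R i) θ s (leaf R θ (i + 1) w f)

/-- The product of two functions of one symbol. -/
def pairMul (A A' : Fin v → ℝ) (x y : Fin v) : ℝ := A x * A' y

lemma pairInd_eq (a b : Fin v) : pairInd a b = pairMul (symInd a) (symInd b) := by
  ext x y
  simp only [pairInd, pairMul, symInd]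
  split_ifs <;> simp_all

lemma sum_mul_symInd (f : Fin v → ℝ) (x : Fin v) : ∑ y, f y * symInd y x = f x := by
  simp [symInd]

lemma ruleOp_finset_sum {ι : Type*} (t : Finset ι) (r : Rules v m₂ m₃) (θ : ℝ × ℝ × ℝ) (s : Bool)
    (f : ι → Fin v → ℝ) (z : Fin v) :
    ruleOp r θ s (fun x => ∑ i ∈ t, f i x) z = ∑ i ∈ t, ruleOp r θ s (f i) z := by
  classical
  induction t using Finset.induction_on with
  | empty =>
    simp only [Finset.sum_empty]
    have := congrFun (ruleOp_mul r θ s 0 (fun _ => 0)) z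
    simpa using this
  | insert i t hi ih =>
    simp only [Finset.sum_insert hi, ruleOp_add, ih]

lemma ruleOp_eq_sum (r : Rules v m₂ m₃) (θ : ℝ × ℝ × ℝ) (s : Bool) (f : Fin v → ℝ) (z : Fin v) :
    ruleOp r θ s f z = ∑ y, f y * ruleOp r θ s (symInd y) z := by
  have h : f = fun x => ∑ y, f y * symInd y x := funext fun x => (sum_mul_symInd f x).symm
  conv_lhs => rw [h]
  rw [ruleOp_finset_sum]
  exact Finset.sum_congr rfl fun y _ => congrFun (ruleOp_mul r θ s (f y) (symInd y)) z

lemma cen_sum {ι : Type*} (t : Finset ι) (f : ι → Fin v → ℝ) (α : Fin v) :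
    cen (fun z => ∑ i ∈ t, f i z) α = ∑ i ∈ t, cen (f i) α := by
  simp only [cen, Finset.sum_sub_distrib]
  rw [Finset.sum_comm, Finset.sum_div]

lemma sum_row_nil_mul (R : ℕ → Rules v m₂ m₃) (α : Fin v) (f : Fin v → ℝ) :
    ∑ y, row R α [] y * f y = cen f α := by
  have h : f = fun x => ∑ y, f y * symInd y x := funext fun x => (sum_mul_symInd f x).symm
  conv_rhs => rw [h]
  rw [cen_sum]
  refine Finset.sum_congr rfl fun y _ => ?_
  rw [congrFun (cen_mul (f y) (symInd y)) α, mul_comm]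
  rfl

lemma sum_row_cons_mul (R : ℕ → Rules v m₂ m₃) (α : Fin v) (s : Bool) (w : List Bool)
    (f : Fin v → ℝ) :
    ∑ y, row R α (s :: w) y * f y = ∑ u, row R α w u * ruleOp (R w.length) allPos s f u := by
  simp only [row, Finset.sum_mul]
  rw [Finset.sum_comm]
  refine Finset.sum_congr rfl fun u _ => ?_
  rw [ruleOp_eq_sum (R w.length) allPos s f u, Finset.mul_sum]
  exact Finset.sum_congr rfl fun y _ => by ring

lemma row_eq_sum (R : ℕ → Rules v m₂ m₃) (α : Fin v) (w : List Bool) (z : Fin v) :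
    row R α w z = ∑ y, row R α w y * symInd z y := by
  simp [symInd]

/-- The operators send constants to constants, so the influence keeps sum zero at all levels. This
permits the functions below to be recentered freely. -/
lemma sum_row [NeZero m₂] [NeZero m₃] (R : ℕ → Rules v m₂ m₃) (α : Fin v) (w : List Bool) :
    ∑ y, row R α w y = 0 := by
  induction w with
  | nil =>
    have := sum_row_nil_mul R α (fun _ => 1)
    simp only [mul_one] at this
    have hv : (v : ℝ) ≠ 0 := by
      have : 0 < v := Fin.pos α
      positivity
    rw [this]; simp [cen, hv]
  | cons s w ih =>
    have := sum_row_cons_mul R α s w (fun _ => 1)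
    simp only [mul_one, ruleOp_allPos_const] at this
    rw [this, ← Finset.sum_mul, ih, zero_mul]

/-- Adjointness: levels can be moved one by one from the pulled-back function to the transported
influence. -/
lemma sum_row_mul_leaf (R : ℕ → Rules v m₂ m₃) (α : Fin v) (f : Fin v → ℝ) (j k : ℕ) :
    ∑ y, row R α (List.replicate k true) y * leaf R allPos k (List.replicate j true) f y =
      ∑ y, row R α (List.replicate (k + j) true) y * f y := by
  induction j generalizing k with
  | zero => rfl
  | succ j ih =>
    have := sum_row_cons_mul R α true (List.replicate k true)
      (leaf R allPos (k + 1) (List.replicate j true) f)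
    rw [List.length_replicate] at this
    rw [List.replicate_succ, leaf, ← this, ← List.replicate_succ, ih]
    rw [show k + 1 + j = k + (j + 1) by omega]

/-- One number read from both ends: the influence of `α` carried down, or the indicator of `z`
pulled up. The second form gives access to the norm over the roots. -/
lemma row_replicate (R : ℕ → Rules v m₂ m₃) (α z : Fin v) (n : ℕ) :
    row R α (List.replicate n true) z =
      cen (leaf R allPos 0 (List.replicate n true) (symInd z)) α := by
  rw [row_eq_sum, ← sum_row_nil_mul R α]
  have := sum_row_mul_leaf R α (symInd z) n 0
  rw [zero_add] at this
  rw [← this]; rfl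

lemma lenStepR_iterate_le_one {p : ℝ} (hp0 : 0 ≤ p) (hp1 : p ≤ 1) {F : ℕ → ℝ}
    (hF : ∀ k, F k ≤ 1) (n k : ℕ) : (lenStepR p)^[n] F k ≤ 1 := by
  induction n generalizing k with
  | zero => exact hF k
  | succ n ih =>
    rw [Function.iterate_succ_apply', lenStepR]
    nlinarith [ih (k + 2), ih (k + 3)]

lemma arityWeight_le_one {p : ℝ} (hp0 : 0 ≤ p) (hp1 : p ≤ 1) (s : Bool) : arityWeight p s ≤ 1 := by
  unfold arityWeight; split_ifs <;> linarith

lemma liftOne_le_one {p : ℝ} (hp0 : 0 ≤ p) (hp1 : p ≤ 1) {F : ℕ → ℝ}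
    (hF0 : ∀ k, 0 ≤ F k) (hF : ∀ k, F k ≤ 1) (s : Bool) (N : ℕ) : liftOne p s F N ≤ 1 :=
  mul_le_one₀ (arityWeight_le_one hp0 hp1 s) (lenStepR_iterate_nonneg hp0 hp1 hF0 _ _)
    (lenStepR_iterate_le_one hp0 hp1 hF _ _)

lemma liftTwo_le_one {p : ℝ} (hp0 : 0 ≤ p) (hp1 : p ≤ 1) {F : ℕ → ℝ}
    (hF0 : ∀ k, 0 ≤ F k) (hF : ∀ k, F k ≤ 1) (s s' : Bool) (N : ℕ) : liftTwo p s s' F N ≤ 1 :=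
  mul_le_one₀ (mul_le_one₀ (arityWeight_le_one hp0 hp1 s) (arityWeight_nonneg hp0 hp1 s')
    (arityWeight_le_one hp0 hp1 s')) (lenStepR_iterate_nonneg hp0 hp1 hF0 _ _)
    (lenStepR_iterate_le_one hp0 hp1 hF _ _)

/-- The centered expectation of an additive function is bounded by its bound along every word. -/
lemma abs_cen_symFun_le {p : ℝ} (hp0 : 0 ≤ p) (hp1 : p ≤ 1) (R : ℕ → Rules v m₂ m₃) (α : Fin v)
    (ℓ : ℕ) {F : ℕ → ℝ} (hF0 : ∀ k, 0 ≤ F k) (hF : ∀ k, F k ≤ 1) {f : Fin v → ℝ} {τ : ℝ}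
    (h : ∀ w : List Bool, w.length = ℓ → |∑ y, row R α w y * f y| ≤ τ) :
    |cen (symFun p R ℓ F f) α| ≤ 2 ^ ℓ * τ := by
  induction ℓ generalizing F f with
  | zero =>
    have h0 := h [] rfl
    rw [sum_row_nil_mul] at h0
    have e : symFun p R 0 F f = fun α => F 1 * f α := rfl
    rw [e, cen_mul, abs_mul, abs_of_nonneg (hF0 1), pow_zero, one_mul]
    exact (mul_le_of_le_one_left (abs_nonneg _) (hF 1)).trans h0
  | succ ℓ ih =>
    have e : symFun p R (ℓ + 1) F f =
        fun α => ∑ s : Bool, symFun p R ℓ (liftOne p s F) (ruleOp (R ℓ) allPos s f) α := rfl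
    rw [e, cen_sum, Fintype.sum_bool]
    have hs : ∀ s, |cen (symFun p R ℓ (liftOne p s F) (ruleOp (R ℓ) allPos s f)) α| ≤ 2 ^ ℓ * τ :=
      fun s => ih (liftOne_nonneg hp0 hp1 hF0 s) (liftOne_le_one hp0 hp1 hF0 hF s) fun w hw => by
        have := h (s :: w) (by simp [hw])
        rwa [sum_row_cons_mul, hw] at this
    refine (abs_add_le _ _).trans ((add_le_add (hs true) (hs false)).trans (le_of_eq ?_))
    ring

/-- The weight of the derivations that are binary along the ancestral line. -/
def binaryWeight (p : ℝ) (ℓ : ℕ) (F : ℕ → ℝ) : ℝ := ((liftOne p true)^[ℓ] F) 1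

/-- The all-binary word dominates the centered expectation of an additive function. -/
lemma abs_cen_symFun_sub_le {p : ℝ} (hp0 : 0 ≤ p) (hp1 : p ≤ 1) (R : ℕ → Rules v m₂ m₃)
    (α : Fin v) (ℓ : ℕ) {F : ℕ → ℝ} (hF0 : ∀ k, 0 ≤ F k) (hF : ∀ k, F k ≤ 1) {f : Fin v → ℝ}
    {τ : ℝ} (hτ : 0 ≤ τ) (h : ∀ w : List Bool, w.length = ℓ → false ∈ w →
      |∑ y, row R α w y * f y| ≤ τ) :
    |cen (symFun p R ℓ F f) α - binaryWeight p ℓ F *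
      ∑ y, row R α (List.replicate ℓ true) y * f y| ≤ 2 ^ ℓ * τ := by
  induction ℓ generalizing F f with
  | zero =>
    have e : symFun p R 0 F f = fun α => F 1 * f α := rfl
    rw [e, cen_mul, List.replicate_zero, sum_row_nil_mul]
    simpa [binaryWeight] using hτ
  | succ ℓ ih =>
    have e : symFun p R (ℓ + 1) F f =
        fun α => ∑ s : Bool, symFun p R ℓ (liftOne p s F) (ruleOp (R ℓ) allPos s f) α := rfl
    rw [e, cen_sum, Fintype.sum_bool]
    have h1 := ih (liftOne_nonneg hp0 hp1 hF0 true) (liftOne_le_one hp0 hp1 hF0 hF true)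
      (f := ruleOp (R ℓ) allPos true f) fun w hw hf => by
        have := h (true :: w) (by simp [hw]) (by simp [hf])
        rwa [sum_row_cons_mul, hw] at this
    have h2 := abs_cen_symFun_le hp0 hp1 R α ℓ (liftOne_nonneg hp0 hp1 hF0 false)
      (liftOne_le_one hp0 hp1 hF0 hF false) (f := ruleOp (R ℓ) allPos false f) (τ := τ)
      fun w hw => by
        have := h (false :: w) (by simp [hw]) (by simp)
        rwa [sum_row_cons_mul, hw] at this
    have e2 : ∑ y, row R α (List.replicate (ℓ + 1) true) y * f y =
        ∑ y, row R α (List.replicate ℓ true) y * ruleOp (R ℓ) allPos true f y := by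
      rw [List.replicate_succ, sum_row_cons_mul, List.length_replicate]
    have e3 : binaryWeight p (ℓ + 1) F = binaryWeight p ℓ (liftOne p true F) := rfl
    rw [e2, e3, add_sub_right_comm]
    refine (abs_add_le _ _).trans ((add_le_add h1 h2).trans (le_of_eq ?_))
    ring

/-- Adjacent symbols are rewritten independently, and the boundary pair consists of the last child
of one and the first child of the other, so products remain products. -/
lemma crossOp_pairMul (r : Rules v m₂ m₃) (s s' : Bool) (A A' : Fin v → ℝ) :
    crossOp r s s' (pairMul A A') = pairMul (ruleOp r lastPos s A) (ruleOp r firstPos s' A') := by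
  ext z z'
  have h1 : ∀ b : Production v, A b.last = childSum lastPos A b := fun b => by
    cases b <;> simp [Production.last, childSum, lastPos]
  have h2 : ∀ b : Production v, A' b.first = childSum firstPos A' b := fun b => by
    cases b <;> simp [Production.first, childSum, firstPos]
  simp only [crossOp, pairMul, ruleOp, h1, h2, ruleAvg_mul]
  simp only [mul_comm _ (ruleAvg r s' _ z'), ruleAvg_mul]

/-- The centered expectation of an additive function of the adjacent pairs is bounded by the
contributions of the words that join the root to the lowest common ancestor and the ancestor to the
pair. -/
lemma abs_cen_pairFun_le {p : ℝ} (hp0 : 0 ≤ p) (hp1 : p ≤ 1) (R : ℕ → Rules v m₂ m₃) {n : ℕ}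
    (a b α : Fin v) {τ : ℝ} (hτ : 0 ≤ τ)
    (h : ∀ (i : ℕ) (u w w' : List Bool) (s : Bool), u.length = i → i + w.length = n →
      w.length = w'.length → w ≠ [] → |∑ y, row R α u y * ruleAvg (R i) s
        (siblingPairs (pairMul (leaf R lastPos (i + 1) w (symInd a))
          (leaf R firstPos (i + 1) w' (symInd b)))) y| ≤ τ)
    (ℓ : ℕ) {F : ℕ → ℝ} (hF0 : ∀ k, 0 ≤ F k) (hF : ∀ k, F k ≤ 1) (w w' : List Bool)
    (hw : ℓ + w.length = n + 1) (hw' : w.length = w'.length) (hne : w ≠ []) :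
    |cen (pairFun p R ℓ F (pairMul (leaf R lastPos ℓ w (symInd a))
      (leaf R firstPos ℓ w' (symInd b)))) α| ≤ ℓ * 4 ^ ℓ * τ := by
  induction ℓ generalizing F w w' with
  | zero =>
    have e : pairFun p R 0 F (pairMul (leaf R lastPos 0 w (symInd a))
      (leaf R firstPos 0 w' (symInd b))) = fun _ => 0 := rfl
    rw [e]; simp [cen]
  | succ ℓ ih =>
    set c := pairMul (leaf R lastPos (ℓ + 1) w (symInd a))
      (leaf R firstPos (ℓ + 1) w' (symInd b)) with hc
    have e : pairFun p R (ℓ + 1) F c = fun α =>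
        ∑ s : Bool, symFun p R ℓ (liftOne p s F) (ruleAvg (R ℓ) s (siblingPairs c)) α +
        ∑ s : Bool, ∑ s' : Bool, pairFun p R ℓ (liftTwo p s s' F) (crossOp (R ℓ) s s' c) α := rfl
    have h1 : ∀ s, |cen (symFun p R ℓ (liftOne p s F) (ruleAvg (R ℓ) s (siblingPairs c))) α| ≤
        2 ^ ℓ * τ := fun s =>
      abs_cen_symFun_le hp0 hp1 R α ℓ (liftOne_nonneg hp0 hp1 hF0 s)
        (liftOne_le_one hp0 hp1 hF0 hF s) fun u hu => h ℓ u w w' s hu (by omega) hw' hne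
    have h2 : ∀ s s', |cen (pairFun p R ℓ (liftTwo p s s' F) (crossOp (R ℓ) s s' c)) α| ≤
        ℓ * 4 ^ ℓ * τ := fun s s' => by
      rw [hc, crossOp_pairMul]
      exact ih (liftTwo_nonneg hp0 hp1 hF0 s s') (liftTwo_le_one hp0 hp1 hF0 hF s s') (s :: w)
        (s' :: w') (by simp; omega) (by simp [hw']) (by simp)
    have hcs : cen (pairFun p R (ℓ + 1) F c) α =
        ∑ s : Bool, cen (symFun p R ℓ (liftOne p s F) (ruleAvg (R ℓ) s (siblingPairs c))) α +
        ∑ s : Bool, ∑ s' : Bool,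
          cen (pairFun p R ℓ (liftTwo p s s' F) (crossOp (R ℓ) s s' c)) α := by
      rw [e, cen_add]
      simp only [cen_sum]
    rw [hcs]
    simp only [Fintype.sum_bool]
    -- Two sibling terms and four cross terms give `2 * 2 ^ ℓ + 4 * (ℓ * 4 ^ ℓ) ≤ (ℓ + 1) * 4 ^ (ℓ +
    -- 1)`.
    have hpow : (2 : ℝ) ^ ℓ * 2 ≤ 4 ^ ℓ * 4 := by
      have : (2 : ℝ) ^ ℓ ≤ 4 ^ ℓ := pow_le_pow_left₀ (by norm_num) (by norm_num) _
      nlinarith [pow_pos (show (0 : ℝ) < 4 by norm_num) ℓ]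
    have hp := mul_le_mul_of_nonneg_right hpow hτ
    have b1 := abs_le.1 (h1 true)
    have b2 := abs_le.1 (h1 false)
    have b3 := abs_le.1 (h2 true true)
    have b4 := abs_le.1 (h2 true false)
    have b5 := abs_le.1 (h2 false true)
    have b6 := abs_le.1 (h2 false false)
    push_cast
    rw [abs_le]
    rw [pow_succ]
    constructor <;> nlinarith

end Expansion

/-! ### Typical rules, and the order of the influence of the root. -/

section Typical

variable {v m₂ m₃ : ℕ}

/-- The number of rules of a symbol with a given arity. -/
def slots (m₂ m₃ : ℕ) (s : Bool) : ℝ := if s then m₂ else m₃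

/-- A function of the children deviates from `c₀` by at most `τ`, and the sum of its squared
deviations is at most `v * τ ^ 2`. -/
def Spread (s : Bool) (c : Production v → ℝ) (c₀ τ : ℝ) : Prop :=
  match s with
  | true => ∀ z, (∀ u : Fin v × Fin v, |c (.bin z u.1 u.2) - c₀| ≤ τ) ∧
      ∑ u : Fin v × Fin v, (c (.bin z u.1 u.2) - c₀) ^ 2 ≤ v * τ ^ 2
  | false => ∀ z, (∀ u : Fin v × Fin v × Fin v, |c (.ter z u.1 u.2.1 u.2.2) - c₀| ≤ τ) ∧
      ∑ u : Fin v × Fin v × Fin v, (c (.ter z u.1 u.2.1 u.2.2) - c₀) ^ 2 ≤ v * τ ^ 2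

/-- The linear statistic of `x` and `c` is of the order of its standard deviation. -/
def Tame (ρ : ℝ) (r : Rules v m₂ m₃) (x : Fin v → ℝ) (c : Production v → ℝ) : Prop :=
  ∀ (s : Bool) (c₀ τ : ℝ), 0 ≤ τ → Spread s c c₀ τ →
    |∑ y, x y * ruleAvg r s c y| ≤ ρ * (√(nsq x) * (4 * τ)) / slots m₂ m₃ s

/-- The binary rules of a level contract the centered norm of `h` by the typical factor. -/
def QuadTame (ε : ℝ) (r : Rules v m₂ m₃) (h : Fin v → ℝ) : Prop :=
  |nsq (cen (ruleOp r allPos true h)) - 2 / m₂ * nsq (cen h)| ≤ ε * (2 / m₂ * nsq (cen h))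

/-- The position weights in use. -/
def posVec (k : Fin 3) : ℝ × ℝ × ℝ :=
  match k with
  | 0 => allPos
  | 1 => firstPos
  | 2 => lastPos

/-- The pull-back of the indicator of `z` along binary rules. -/
def binLeaf (R : ℕ → Rules v m₂ m₃) (i k : ℕ) (z : Fin v) : Fin v → ℝ :=
  leaf R allPos i (List.replicate k true) (symInd z)

/-- The rules behave typically: all the linear and quadratic statistics in use are of the expected
order. -/
structure Typical (ρ ε : ℝ) (n : ℕ) (R : ℕ → Rules v m₂ m₃) : Prop where
  child : ∀ (i : ℕ) (u w : List Bool) (k : Fin 3) (α a : Fin v), u.length ≤ i →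
    i + w.length ≤ n →
    Tame ρ (R i) (row R α u) (childSum (posVec k) (leaf R (posVec k) (i + 1) w (symInd a)))
  pair : ∀ (i : ℕ) (u w w' : List Bool) (α a b : Fin v), u.length ≤ i → i + w.length ≤ n →
    w.length = w'.length →
    Tame ρ (R i) (row R α u) (siblingPairs (pairMul (leaf R lastPos (i + 1) w (symInd a))
      (leaf R firstPos (i + 1) w' (symInd b))))
  -- The coefficient runs over `-1`, `0`, `1`: a single symbol, and the difference and sum needed
  -- for polarization.
  quad : ∀ (i k : ℕ) (σ : Fin 3) (z z' : Fin v), i + 1 + k = n →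
    QuadTame ε (R i) fun y => binLeaf R (i + 1) k z y + ((σ : ℕ) - 1 : ℝ) * binLeaf R (i + 1) k z' y

lemma posVec_mem (k : Fin 3) : (0 ≤ (posVec k).1 ∧ (posVec k).1 ≤ 1) ∧
    (0 ≤ (posVec k).2.1 ∧ (posVec k).2.1 ≤ 1) ∧ (0 ≤ (posVec k).2.2 ∧ (posVec k).2.2 ≤ 1) := by
  fin_cases k <;> simp [posVec, allPos, firstPos, lastPos]

lemma symInd_nonneg (a x : Fin v) : 0 ≤ symInd a x := by unfold symInd; split_ifs <;> simp

lemma symInd_le_one (a x : Fin v) : symInd a x ≤ 1 := by unfold symInd; split_ifs <;> simp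

lemma sum_symInd (a : Fin v) : ∑ x, symInd a x = 1 := by simp [symInd]

lemma sum_symInd_pair (a : Fin v) : ∑ u : Fin v × Fin v, (symInd a u.1 + symInd a u.2) = 2 * v := by
  rw [Fintype.sum_prod_type]
  simp [Finset.sum_add_distrib, ← Finset.mul_sum, sum_symInd]; ring

lemma sum_symInd_triple (a : Fin v) :
    ∑ u : Fin v × Fin v × Fin v, (symInd a u.1 + symInd a u.2.1 + symInd a u.2.2) =
      3 * (v : ℝ) ^ 2 := by
  simp only [Fintype.sum_prod_type]
  simp [Finset.sum_add_distrib, sum_symInd, ← Finset.mul_sum]; ring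

lemma childSum_symInd_bin (k : Fin 3) (a z x y : Fin v) :
    0 ≤ childSum (posVec k) (symInd a) (.bin z x y) ∧
      childSum (posVec k) (symInd a) (.bin z x y) ≤ symInd a x + symInd a y := by
  obtain ⟨⟨h1, h1'⟩, -, ⟨h3, h3'⟩⟩ := posVec_mem k
  have := symInd_nonneg a x
  have := symInd_nonneg a y
  simp only [childSum]
  constructor
  · positivity
  · nlinarith

lemma childSum_symInd_ter (k : Fin 3) (a z x y w : Fin v) :
    0 ≤ childSum (posVec k) (symInd a) (.ter z x y w) ∧
      childSum (posVec k) (symInd a) (.ter z x y w) ≤ symInd a x + symInd a y + symInd a w := by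
  obtain ⟨⟨h1, h1'⟩, ⟨h2, h2'⟩, ⟨h3, h3'⟩⟩ := posVec_mem k
  have := symInd_nonneg a x
  have := symInd_nonneg a y
  have := symInd_nonneg a w
  simp only [childSum]
  constructor
  · positivity
  · nlinarith

/-- A fixed symbol is rare among the tuples: the squares sum to at most `4 * v` over pairs and `9 *
v ^ 2` over triples. In the ternary case this second moment, not the maximum, determines the
deviation scale. -/
lemma spread_childSum (hv : 1 ≤ v) (s : Bool) (k : Fin 3) (a : Fin v) :
    Spread s (childSum (posVec k) (symInd a)) 0 (if s then 2 else 3 * √(v : ℝ)) := by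
  have hs : 1 ≤ √(v : ℝ) := Real.one_le_sqrt.2 (by exact_mod_cast hv)
  have hs2 : √(v : ℝ) ^ 2 = v := Real.sq_sqrt (by positivity)
  cases s with
  | true =>
    intro z
    simp only [sub_zero, if_true]
    have hb := fun u : Fin v × Fin v => childSum_symInd_bin k a z u.1 u.2
    have h1 := fun x => symInd_le_one a x
    constructor
    · intro u
      rw [abs_of_nonneg (hb u).1]
      linarith [(hb u).2, h1 u.1, h1 u.2]
    · calc ∑ u : Fin v × Fin v, childSum (posVec k) (symInd a) (.bin z u.1 u.2) ^ 2
          ≤ ∑ u : Fin v × Fin v, 2 * (symInd a u.1 + symInd a u.2) := by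
            refine Finset.sum_le_sum fun u _ => ?_
            nlinarith [hb u, h1 u.1, h1 u.2]
        _ = v * 2 ^ 2 := by rw [← Finset.mul_sum, sum_symInd_pair]; ring
  | false =>
    intro z
    simp only [sub_zero, Bool.false_eq_true, if_false]
    have hb := fun u : Fin v × Fin v × Fin v => childSum_symInd_ter k a z u.1 u.2.1 u.2.2
    have h1 := fun x => symInd_le_one a x
    constructor
    · intro u
      rw [abs_of_nonneg (hb u).1]
      linarith [(hb u).2, h1 u.1, h1 u.2.1, h1 u.2.2]
    · calc ∑ u : Fin v × Fin v × Fin v, childSum (posVec k) (symInd a) (.ter z u.1 u.2.1 u.2.2) ^ 2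
          ≤ ∑ u : Fin v × Fin v × Fin v, 3 * (symInd a u.1 + symInd a u.2.1 + symInd a u.2.2) := by
            refine Finset.sum_le_sum fun u _ => ?_
            nlinarith [hb u, h1 u.1, h1 u.2.1, h1 u.2.2]
        _ = v * (3 * √(v : ℝ)) ^ 2 := by
            rw [← Finset.mul_sum, sum_symInd_triple, mul_pow, hs2]; ring

/-- Only the maximum is used; the factor makes `v * τ ^ 2` cover all `v ^ 2` pairs or `v ^ 3`
triples. -/
lemma spread_of_bound (hv : 1 ≤ v) (s : Bool) {c : Production v → ℝ} {c₀ κ : ℝ} (hκ : 0 ≤ κ)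
    (h : match s with
      | true => ∀ z x y, |c (.bin z x y) - c₀| ≤ κ
      | false => ∀ z x y w, |c (.ter z x y w) - c₀| ≤ κ) :
    Spread s c c₀ (if s then √(v : ℝ) * κ else v * κ) := by
  have hv' : (1 : ℝ) ≤ v := by exact_mod_cast hv
  have hs : 1 ≤ √(v : ℝ) := Real.one_le_sqrt.2 hv'
  have hs2 : √(v : ℝ) ^ 2 = v := Real.sq_sqrt (by positivity)
  cases s with
  | true =>
    refine fun z => ⟨fun u => (h z _ _).trans (by simpa using le_mul_of_one_le_left hκ hs), ?_⟩
    refine (Finset.sum_le_sum fun u _ => sq_le_sq' (abs_le.1 (h z u.1 u.2)).1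
      (abs_le.1 (h z u.1 u.2)).2).trans (le_of_eq ?_)
    simp [mul_pow, hs2]; ring
  | false =>
    refine fun z => ⟨fun u => (h z _ _ _).trans (by simpa using le_mul_of_one_le_left hκ hv'), ?_⟩
    refine (Finset.sum_le_sum fun u _ => sq_le_sq' (abs_le.1 (h z u.1 u.2.1 u.2.2)).1
      (abs_le.1 (h z u.1 u.2.1 u.2.2)).2).trans (le_of_eq ?_)
    simp [mul_pow]; ring

/-- A fixed pair occupies two adjacent places of only about `2 * v` triples, so here a constant
scale is enough. -/
lemma spread_pairInd_ter (a b : Fin v) : Spread false (siblingPairs (pairInd a b)) 0 3 := by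
  intro z
  have hp : ∀ x y, 0 ≤ pairInd a b x y ∧ pairInd a b x y ≤ 1 := fun x y => by
    unfold pairInd; split_ifs <;> simp
  simp only [sub_zero, siblingPairs]
  constructor
  · intro u
    rw [abs_le]; constructor <;> linarith [hp u.1 u.2.1, hp u.2.1 u.2.2]
  · calc ∑ u : Fin v × Fin v × Fin v, (pairInd a b u.1 u.2.1 + pairInd a b u.2.1 u.2.2) ^ 2
        ≤ ∑ u : Fin v × Fin v × Fin v, 2 * (pairInd a b u.1 u.2.1 + pairInd a b u.2.1 u.2.2) := by
          refine Finset.sum_le_sum fun u _ => ?_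
          nlinarith [hp u.1 u.2.1, hp u.2.1 u.2.2]
      _ = 4 * v := by
          simp only [pairInd_eq, pairMul, Fintype.sum_prod_type]
          simp [Finset.sum_add_distrib, ← Finset.mul_sum, sum_symInd]; ring
      _ ≤ v * 3 ^ 2 := by
          have : (0 : ℝ) ≤ v := by positivity
          linarith

lemma Tame.abs_le {ρ : ℝ} {r : Rules v m₂ m₃} {x : Fin v → ℝ} {c : Production v → ℝ}
    (h : Tame ρ r x c) {s : Bool} {c₀ τ κ : ℝ} (hτ : 0 ≤ τ) (hc : Spread s c c₀ τ)
    (hm : 0 < slots m₂ m₃ s) (hκ : 4 * ρ * τ ≤ κ * slots m₂ m₃ s) :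
    |∑ y, x y * ruleAvg r s c y| ≤ κ * √(nsq x) := by
  refine (h s c₀ τ hτ hc).trans ?_
  rw [div_le_iff₀ hm]
  calc ρ * (√(nsq x) * (4 * τ)) = √(nsq x) * (4 * ρ * τ) := by ring
    _ ≤ √(nsq x) * (κ * slots m₂ m₃ s) := by gcongr
    _ = _ := by ring

lemma sqrt_nsq_le {f : Fin v → ℝ} {κ : ℝ} (hκ : 0 ≤ κ) (h : ∀ y, |f y| ≤ κ) :
    √(nsq f) ≤ √(v : ℝ) * κ := by
  rw [Real.sqrt_le_left (by positivity), mul_pow, Real.sq_sqrt (by positivity)]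
  refine (Finset.sum_le_sum fun y _ => sq_le_sq' (_root_.abs_le.1 (h y)).1 (_root_.abs_le.1 (h y)).2).trans ?_
  simp

lemma nsq_row_nil_le (R : ℕ → Rules v m₂ m₃) (α : Fin v) : nsq (row R α []) ≤ 1 := by
  have hv : 0 < v := Fin.pos α
  have hv' : (0 : ℝ) < v := by exact_mod_cast hv
  have e : row R α [] = cen (symInd α) := by
    ext y
    simp only [row, cen, sum_symInd]
    simp only [symInd, eq_comm]
  rw [e, nsq_cen, sum_symInd]
  have : ∑ z, symInd α z ^ 2 = 1 := by simp [symInd]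
  rw [this]
  have : (0 : ℝ) ≤ 1 ^ 2 / v := by positivity
  linarith

lemma count_false_cons (s : Bool) (w : List Bool) :
    (s :: w).count false = w.count false + [s].count false := by
  rw [← List.singleton_append, List.count_append, add_comm]

/-- Standing quantitative assumptions: `s` is the square root of the vocabulary size. -/
structure Scales (v m₂ m₃ : ℕ) (ρ η q : ℝ) : Prop where
  one_le_v : 1 ≤ v
  rho : 1 ≤ ρ
  eta_pos : 0 < η
  eta_le : η ≤ 1
  bin : η * v ≤ m₂
  ter : η * (v : ℝ) ^ 2 ≤ m₃
  q_ge : 12 * ρ ≤ η * q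

variable {ρ ε η q : ℝ} {n : ℕ} {R : ℕ → Rules v m₂ m₃}

namespace Scales

variable (h : Scales v m₂ m₃ ρ η q)
include h

lemma v_pos : (0 : ℝ) < v := by exact_mod_cast h.one_le_v

lemma sqrt_pos : 0 < √(v : ℝ) := Real.sqrt_pos.2 h.v_pos

lemma one_le_sqrt : 1 ≤ √(v : ℝ) := Real.one_le_sqrt.2 (by exact_mod_cast h.one_le_v)

lemma sqrt_sq : √(v : ℝ) ^ 2 = v := Real.sq_sqrt h.v_pos.le

lemma q_ge_twelve : 12 ≤ q := by
  have := h.q_ge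
  have := h.rho
  have := h.eta_pos
  have := h.eta_le
  have hq : 0 < q := by
    by_contra hq
    nlinarith
  nlinarith

lemma q_pos : 0 < q := by linarith [h.q_ge_twelve]

lemma inv_eta_le : 1 / η ≤ q := by
  rw [div_le_iff₀ h.eta_pos]
  linarith [h.q_ge, h.rho]

lemma slots_pos (s : Bool) : 0 < slots m₂ m₃ s := by
  have := h.v_pos
  have := h.eta_pos
  have h2 := h.bin
  have h3 := h.ter
  cases s <;> simp only [slots, if_true, Bool.false_eq_true, if_false]
  · exact lt_of_lt_of_le (by positivity) h3
  · exact lt_of_lt_of_le (by positivity) h2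

/-- The factor `q` absorbs the deviation factor `ρ`, the numerical constant `4 * 3` and the density
`1 / η` of the rules. -/
lemma tame_bin_le {κ τ : ℝ} (hκ : 0 ≤ κ) (hle : τ ≤ 3 * (κ * v)) :
    4 * ρ * τ ≤ q * κ * slots m₂ m₃ true := by
  have h0 := h.rho
  have h1 := h.v_pos
  have h4 := h.q_pos
  calc 4 * ρ * τ ≤ 4 * ρ * (3 * (κ * v)) := by gcongr
    _ = (12 * ρ) * (κ * v) := by ring
    _ ≤ (η * q) * (κ * v) := mul_le_mul_of_nonneg_right h.q_ge (by positivity)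
    _ = q * κ * (η * v) := by ring
    _ ≤ q * κ * slots m₂ m₃ true := by gcongr; exact h.bin

lemma tame_ter_le {κ τ : ℝ} (hκ : 0 ≤ κ) (hle : τ ≤ 3 * (κ * (v : ℝ) ^ 2)) :
    4 * ρ * τ ≤ q * κ * slots m₂ m₃ false := by
  have h0 := h.rho
  have h1 := h.v_pos
  have h4 := h.q_pos
  calc 4 * ρ * τ ≤ 4 * ρ * (3 * (κ * (v : ℝ) ^ 2)) := by gcongr
    _ = (12 * ρ) * (κ * (v : ℝ) ^ 2) := by ring
    _ ≤ (η * q) * (κ * (v : ℝ) ^ 2) := mul_le_mul_of_nonneg_right h.q_ge (by positivity)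
    _ = q * κ * (η * (v : ℝ) ^ 2) := by ring
    _ ≤ q * κ * slots m₂ m₃ false := by gcongr; exact h.ter

/-- The number of powers of `√v` gained along one level. -/
lemma tame_child {r : Rules v m₂ m₃} {x : Fin v → ℝ} {k : Fin 3} {a : Fin v}
    (ht : Tame ρ r x (childSum (posVec k) (symInd a))) (s : Bool) :
    |∑ y, x y * ruleOp r (posVec k) s (symInd a) y| ≤
      q * (1 / √(v : ℝ) ^ (2 + [s].count false)) * √(nsq x) := by
  have hs := h.sqrt_pos
  refine ht.abs_le ?_ (spread_childSum h.one_le_v s k a) (h.slots_pos s) ?_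
  · cases s <;> simp
  · cases s with
    | true =>
      refine h.tame_bin_le (by positivity) ?_
      have : 1 / √(v : ℝ) ^ (2 + [true].count false) * v = 1 := by
        simp [h.sqrt_sq, h.v_pos.ne']
      rw [this]; norm_num
    | false =>
      refine h.tame_ter_le (by positivity) (le_of_eq ?_)
      simp only [Bool.false_eq_true, if_false, List.count_singleton_self]
      have e := h.sqrt_sq
      generalize √(v : ℝ) = S at *
      rw [← e]
      field_simp

/-- For a function known only through its deviation `κ` the quotient of deviation scale and number
of rules is of order `κ / √v` for both arities: every level gains one power of `√v`. -/
lemma tame_bound {r : Rules v m₂ m₃} {x : Fin v → ℝ} {c : Production v → ℝ} (ht : Tame ρ r x c)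
    (s : Bool) {c₀ κ : ℝ} (hκ : 0 ≤ κ)
    (hc : match s with
      | true => ∀ z x y, |c (.bin z x y) - c₀| ≤ κ
      | false => ∀ z x y w, |c (.ter z x y w) - c₀| ≤ κ) :
    |∑ y, x y * ruleAvg r s c y| ≤ q * (κ / √(v : ℝ)) * √(nsq x) := by
  have hs := h.sqrt_pos
  have hs1 := h.one_le_sqrt
  have hv := h.v_pos
  refine ht.abs_le ?_ (spread_of_bound h.one_le_v s hκ hc) (h.slots_pos s) ?_
  · cases s <;> simp <;> positivity
  · cases s with
    | true =>
      refine h.tame_bin_le (by positivity) ?_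
      simp only [if_true]
      have : κ / √(v : ℝ) * v = √(v : ℝ) * κ := by
        have e := h.sqrt_sq
        generalize √(v : ℝ) = S at *
        rw [← e]
        field_simp
      rw [this]
      nlinarith [mul_nonneg hs.le hκ]
    | false =>
      refine h.tame_ter_le (by positivity) ?_
      simp only [Bool.false_eq_true, if_false]
      have : κ / √(v : ℝ) * (v : ℝ) ^ 2 = √(v : ℝ) * (v * κ) := by
        have e := h.sqrt_sq
        generalize √(v : ℝ) = S at *
        rw [← e]
        field_simp
      rw [this]
      nlinarith [mul_nonneg hv.le hκ]

end Scales

variable (h : Scales v m₂ m₃ ρ η q) (ht : Typical ρ ε n R)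
include h ht

lemma Typical.abs_row_cons_le (α : Fin v) (s : Bool) (w : List Bool) (hw : w.length ≤ n)
    (y : Fin v) : |row R α (s :: w) y| ≤
      q * (1 / √(v : ℝ) ^ (2 + [s].count false)) * √(nsq (row R α w)) :=
  h.tame_child (ht.child w.length w [] 0 α y le_rfl (by simpa using hw)) s

/-- A level gains two powers of `√v` per entry, three if ternary, and summing over `v` entries gives
one back. The net gain is one for a binary and two for a ternary level. -/
lemma Typical.sqrt_nsq_row_le (α : Fin v) (w : List Bool) (hw : w.length ≤ n + 1) :
    √(nsq (row R α w)) ≤ q ^ w.length / √(v : ℝ) ^ (w.length + w.count false) := by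
  have hs := h.sqrt_pos
  have hq := h.q_pos
  induction w with
  | nil => simpa using nsq_row_nil_le R α
  | cons s w ih =>
    have hw' : w.length ≤ n := by simpa using hw
    have h1 := ih (by omega)
    have h2 : ∀ y, |row R α (s :: w) y| ≤ q * (1 / √(v : ℝ) ^ (2 + [s].count false)) *
        (q ^ w.length / √(v : ℝ) ^ (w.length + w.count false)) := fun y =>
      (ht.abs_row_cons_le h α s w hw' y).trans (by gcongr)
    refine (sqrt_nsq_le (by positivity) h2).trans (le_of_eq ?_)
    rw [count_false_cons s w, List.length_cons]
    field_simp
    ring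

/-- Along the all-binary word an entry is typically of order `√v ^ (-(n + 1))`; a single ternary
letter already costs a further factor `√v`. -/
lemma Typical.abs_row_le (α : Fin v) (w : List Bool) (hw : w.length = n) (hf : false ∈ w)
    (y : Fin v) : |row R α w y| ≤ q ^ n / √(v : ℝ) ^ (n + 2) := by
  have hs := h.sqrt_pos
  have hs1 := h.one_le_sqrt
  have hq := h.q_pos
  cases w with
  | nil => simp at hf
  | cons s w =>
    have hw' : w.length + 1 = n := by simpa using hw
    refine (ht.abs_row_cons_le h α s w (by omega) y).trans ?_
    have h1 := ht.sqrt_nsq_row_le h α w (by omega)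
    have hc : 1 ≤ (s :: w).count false := List.one_le_count_iff.2 hf
    calc _ ≤ q * (1 / √(v : ℝ) ^ (2 + [s].count false)) *
        (q ^ w.length / √(v : ℝ) ^ (w.length + w.count false)) := by gcongr
      _ = q ^ n / √(v : ℝ) ^ (n + 1 + (s :: w).count false) := by
        rw [count_false_cons s w, ← hw']
        field_simp
        ring
      _ ≤ _ := div_le_div_of_nonneg_left (by positivity) (by positivity)
        (pow_le_pow_right₀ hs1 (by omega))

end Typical

/-! ### Functions pulled back from the leaves, cross pairs and ternary siblings. -/

section Leaves

variable {v m₂ m₃ : ℕ}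

/-- First and last positions select exactly one child, so the center is not multiplied by the arity;
summing over all positions would do so. -/
lemma abs_childSum_sub_le {k : Fin 3} (hk : k ≠ 0) {f : Fin v → ℝ} {c₀ κ : ℝ}
    (hf : ∀ y, |f y - c₀| ≤ κ) (b : Production v) : |childSum (posVec k) f b - c₀| ≤ κ := by
  fin_cases k
  · exact absurd rfl hk
  all_goals cases b <;> simp only [childSum, posVec, firstPos, lastPos, one_mul, zero_mul,
    add_zero, zero_add] <;> exact hf _

lemma abs_ruleAvg_le (r : Rules v m₂ m₃) (s : Bool) {f : Production v → ℝ} {K : ℝ}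
    (hf : ∀ b, |f b| ≤ K) (z : Fin v) : |ruleAvg r s f z| ≤ K := by
  have hK : 0 ≤ K := (abs_nonneg _).trans (hf (.bin z z z))
  have aux : ∀ (m : ℕ) (g : Fin m → ℝ), (∀ j, |g j| ≤ K) → |1 / (m : ℝ) * ∑ j, g j| ≤ K := by
    intro m g hg
    rw [abs_mul, abs_of_nonneg (by positivity : (0 : ℝ) ≤ 1 / m)]
    have h1 : |∑ j, g j| ≤ m * K := (Finset.abs_sum_le_sum_abs _ _).trans
      ((Finset.sum_le_sum fun j _ => hg j).trans (by simp))
    rcases Nat.eq_zero_or_pos m with rfl | hm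
    · simpa using hK
    · have hm' : (0 : ℝ) < m := by exact_mod_cast hm
      calc 1 / (m : ℝ) * |∑ j, g j| ≤ 1 / (m : ℝ) * (m * K) := by gcongr
        _ = K := by field_simp
  cases s <;> exact aux _ _ fun j => hf _

lemma sum_embedding_le {ι U : Type*} [Fintype ι] [Fintype U] (φ : ι ↪ U) {g : U → ℝ}
    (hg : ∀ u, 0 ≤ g u) : ∑ s, g (φ s) ≤ ∑ u, g u := by
  rw [← Finset.sum_map Finset.univ φ g]
  exact Finset.sum_le_sum_of_subset_of_nonneg (Finset.subset_univ _) fun u _ _ => hg u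

variable {ρ ε η q : ℝ} {n : ℕ} {R : ℕ → Rules v m₂ m₃}

section
variable (h : Scales v m₂ m₃ ρ η q)
include h

/-- Each tuple is used by at most one slot, so the total number of occurrences of `a` is at most
that among all tuples: `2 * v` or `3 * v ^ 2`. -/
lemma Scales.abs_mean_ruleOp_le (r : Rules v m₂ m₃) (k : Fin 3) (s : Bool) (a : Fin v) :
    |(∑ y, ruleOp r (posVec k) s (symInd a) y) / v| ≤ q / √(v : ℝ) ^ 2 := by
  have hv := h.v_pos
  have hη := h.eta_pos
  have hq : 3 / η ≤ q := by
    rw [div_le_iff₀ hη]; linarith [h.q_ge, h.rho]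
  have hn0 : ∀ y, 0 ≤ ruleOp r (posVec k) s (symInd a) y := fun y =>
    ruleAvg_nonneg _ _ (fun b => by
      cases b
      · exact (childSum_symInd_bin k a _ _ _).1
      · exact (childSum_symInd_ter k a _ _ _ _).1) y
  rw [abs_of_nonneg (div_nonneg (Finset.sum_nonneg fun y _ => hn0 y) hv.le), h.sqrt_sq]
  gcongr
  refine le_trans ?_ hq
  have hm := h.slots_pos s
  cases s with
  | true =>
    have hm' : (0 : ℝ) < m₂ := by simpa [slots] using hm
    have e : ∑ y, ruleOp r (posVec k) true (symInd a) y =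
        1 / (m₂ : ℝ) * ∑ s : Fin v × Fin m₂,
          childSum (posVec k) (symInd a) (.bin s.1 (r.1 s).1 (r.1 s).2) := by
      rw [Fintype.sum_prod_type, Finset.mul_sum]; rfl
    rw [e]
    calc _ ≤ 1 / (m₂ : ℝ) * ∑ s : Fin v × Fin m₂, (symInd a (r.1 s).1 + symInd a (r.1 s).2) := by
          gcongr with s
          exact (childSum_symInd_bin k a _ _ _).2
      _ ≤ 1 / (m₂ : ℝ) * (2 * v) := by
          rw [← sum_symInd_pair a]
          gcongr
          exact sum_embedding_le r.1 (g := fun u => symInd a u.1 + symInd a u.2)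
            fun u => add_nonneg (symInd_nonneg _ _) (symInd_nonneg _ _)
      _ ≤ 3 / η := by
          rw [div_mul_eq_mul_div, div_le_div_iff₀ hm' hη]
          nlinarith [h.bin, mul_pos hη hv]
  | false =>
    have hm' : (0 : ℝ) < m₃ := by simpa [slots] using hm
    have e : ∑ y, ruleOp r (posVec k) false (symInd a) y =
        1 / (m₃ : ℝ) * ∑ s : Fin v × Fin m₃,
          childSum (posVec k) (symInd a) (.ter s.1 (r.2 s).1 (r.2 s).2.1 (r.2 s).2.2) := by
      rw [Fintype.sum_prod_type, Finset.mul_sum]; rfl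
    rw [e]
    calc _ ≤ 1 / (m₃ : ℝ) * ∑ s : Fin v × Fin m₃,
          (symInd a (r.2 s).1 + symInd a (r.2 s).2.1 + symInd a (r.2 s).2.2) := by
          gcongr with s
          exact (childSum_symInd_ter k a _ _ _ _).2
      _ ≤ 1 / (m₃ : ℝ) * (3 * (v : ℝ) ^ 2) := by
          rw [← sum_symInd_triple a]
          gcongr
          exact sum_embedding_le r.2 (g := fun u => symInd a u.1 + symInd a u.2.1 + symInd a u.2.2)
            fun u => add_nonneg (add_nonneg (symInd_nonneg _ _) (symInd_nonneg _ _))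
              (symInd_nonneg _ _)
      _ ≤ 3 / η := by
          rw [div_mul_eq_mul_div, div_le_div_iff₀ hm' hη]
          nlinarith [h.ter]

omit h in
lemma sqrt_nsq_row_nil_le (α : Fin v) : √(nsq (row R α [])) ≤ 1 :=
  Real.sqrt_le_one.2 (nsq_row_nil_le R α)

variable (ht : Typical ρ ε n R)
include ht

/-- The centered value at `y` is the linear statistic of the centered point mass at `y`. The level
next to the leaf acts on an indicator and gains two powers of `√v`; each level above it acts on an
already smoothed function and gains one. -/
lemma Typical.abs_cen_leaf_le {k : Fin 3} (hk : k ≠ 0) (a : Fin v) (w : List Bool) (hne : w ≠ [])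
    (i : ℕ) (hi : i + w.length ≤ n + 1) (y : Fin v) :
    |cen (leaf R (posVec k) i w (symInd a)) y| ≤ q ^ w.length / √(v : ℝ) ^ (w.length + 1) := by
  have hs := h.sqrt_pos
  have hs1 := h.one_le_sqrt
  have hq := h.q_pos
  have hrow := sqrt_nsq_row_nil_le (R := R) y
  induction w generalizing i y with
  | nil => exact absurd rfl hne
  | cons s w ih =>
    have hiw : i + w.length ≤ n := by simp at hi; omega
    rw [leaf, ← sum_row_nil_mul R y]
    by_cases hw : w = []
    · subst hw
      refine (h.tame_child (ht.child i [] [] k y a (Nat.zero_le _) hiw) s).trans ?_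
      calc _ ≤ q * (1 / √(v : ℝ) ^ (2 + [s].count false)) * 1 := by gcongr
        _ ≤ q * (1 / √(v : ℝ) ^ 2) * 1 := by
          gcongr
          · omega
        _ = _ := by simp; ring
    · have hc := fun b => abs_childSum_sub_le hk (f := leaf R (posVec k) (i + 1) w (symInd a))
        (c₀ := (∑ y, leaf R (posVec k) (i + 1) w (symInd a) y) / v)
        (κ := q ^ w.length / √(v : ℝ) ^ (w.length + 1))
        (fun y => ih hw (i + 1) (by omega) y (sqrt_nsq_row_nil_le (R := R) y)) b
      refine (h.tame_bound (ht.child i [] w k y a (Nat.zero_le _) hiw) s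
        (κ := q ^ w.length / √(v : ℝ) ^ (w.length + 1))
        (c₀ := (∑ y, leaf R (posVec k) (i + 1) w (symInd a) y) / v) (by positivity) ?_).trans ?_
      · cases s
        · exact fun z x y w => hc _
        · exact fun z x y => hc _
      · calc _ ≤ q * (q ^ w.length / √(v : ℝ) ^ (w.length + 1) / √(v : ℝ)) * 1 := by gcongr
          _ = _ := by rw [List.length_cons]; field_simp; ring

/-- The size, unlike the fluctuation, stays at the order `1 / v` of the mean, since averaging cannot
increase it. -/
lemma Typical.abs_leaf_le {k : Fin 3} (hk : k ≠ 0) (a : Fin v) (w : List Bool) (hne : w ≠ [])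
    (i : ℕ) (hi : i + w.length ≤ n + 1) (y : Fin v) :
    |leaf R (posVec k) i w (symInd a) y| ≤ 2 * q / √(v : ℝ) ^ 2 := by
  induction w generalizing i y with
  | nil => exact absurd rfl hne
  | cons s w ih =>
    by_cases hw : w = []
    · subst hw
      have h1 := ht.abs_cen_leaf_le h hk a [s] hne i hi y
      have h2 := h.abs_mean_ruleOp_le (R i) k s a
      have e : leaf R (posVec k) i [s] (symInd a) y = cen (leaf R (posVec k) i [s] (symInd a)) y +
        (∑ y, ruleOp (R i) (posVec k) s (symInd a) y) / v := by simp [cen, leaf]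
      rw [e]
      refine (abs_add_le _ _).trans ((add_le_add h1 h2).trans (le_of_eq ?_))
      simp; ring
    · rw [leaf]
      refine abs_ruleAvg_le _ _ (fun b => ?_) y
      have := abs_childSum_sub_le hk (f := leaf R (posVec k) (i + 1) w (symInd a)) (c₀ := 0)
        (κ := 2 * q / √(v : ℝ) ^ 2)
        (fun y => by rw [sub_zero]; exact ih hw (i + 1) (by simp at hi; omega) y) b
      rwa [sub_zero] at this

/-- The joining level acts on a product of two functions of size `1 / v`, one of them effectively
replaced by its fluctuation. The powers of `√v` are two from the size, `w.length + 1` from the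
fluctuation, one from the joining level and `i` from the row: `n + 4` in all. -/
lemma Typical.abs_cross_le (i : ℕ) (u w w' : List Bool) (s : Bool) (α a b : Fin v)
    (hu : u.length = i) (hw : i + w.length = n) (hw' : w.length = w'.length) (hne : w ≠ []) :
    |∑ y, row R α u y * ruleAvg (R i) s
        (siblingPairs (pairMul (leaf R lastPos (i + 1) w (symInd a))
          (leaf R firstPos (i + 1) w' (symInd b)))) y| ≤
      8 * q ^ (n + 2) / √(v : ℝ) ^ (n + 4) := by
  have hs := h.sqrt_pos
  have hs1 := h.one_le_sqrt
  have hq := h.q_pos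
  have hv := h.v_pos
  have hne' : w' ≠ [] := by
    rintro rfl; simp at hw'; exact hne hw'
  set A := leaf R lastPos (i + 1) w (symInd a) with hA
  set A' := leaf R firstPos (i + 1) w' (symInd b) with hA'
  set M := 2 * q / √(v : ℝ) ^ 2 with hM
  set κ := q ^ w.length / √(v : ℝ) ^ (w.length + 1) with hκ
  have hM0 : 0 ≤ M := by positivity
  have hκ0 : 0 ≤ κ := by positivity
  have cA : ∀ y, |cen A y| ≤ κ := ht.abs_cen_leaf_le h (k := 2) (by decide) a w hne _ (by omega)
  have cA' : ∀ y, |cen A' y| ≤ κ := fun y => by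
    have := ht.abs_cen_leaf_le h (k := 1) (by decide) b w' hne' (i + 1) (by omega) y
    rwa [← hw'] at this
  have bA : ∀ y, |A y| ≤ M := ht.abs_leaf_le h (k := 2) (by decide) a w hne _ (by omega)
  have bA' : ∀ y, |A' y| ≤ M :=
    ht.abs_leaf_le h (k := 1) (by decide) b w' hne' (i + 1) (by omega)
  set μ := (∑ y, A y) / v with hμ
  set μ' := (∑ y, A' y) / v with hμ'
  have bμ : |μ| ≤ M := by
    rw [hμ, abs_div, abs_of_pos hv, div_le_iff₀ hv]
    exact (Finset.abs_sum_le_sum_abs _ _).trans ((Finset.sum_le_sum fun y _ => bA y).trans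
      (by simp [mul_comm]))
  -- After the product of the means is removed, every remaining term contains a fluctuation.
  have hprod : ∀ x y, |pairMul A A' x y - μ * μ'| ≤ 2 * (M * κ) := fun x y => by
    have e : pairMul A A' x y - μ * μ' = cen A x * A' y + μ * cen A' y := by
      simp only [pairMul, cen, hμ, hμ']; ring
    rw [e]
    refine (abs_add_le _ _).trans ?_
    rw [abs_mul, abs_mul]
    have h1 := mul_le_mul (cA x) (bA' y) (abs_nonneg _) hκ0
    have h2 := mul_le_mul bμ (cA' y) (abs_nonneg _) hM0
    linarith
  have hpair := ht.pair i u w w' α a b hu.le hw.le hw'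
  -- A ternary production has two sibling pairs, hence the doubled center.
  have key := h.tame_bound hpair s (κ := 4 * (M * κ)) (c₀ := if s then μ * μ' else 2 * (μ * μ'))
    (by positivity) (by
      have h0 : 0 ≤ M * κ := by positivity
      cases s
      · intro z x y w
        simp only [siblingPairs, Bool.false_eq_true, if_false]
        have h1 := abs_le.1 (hprod x y)
        have h2 := abs_le.1 (hprod y w)
        rw [abs_le]; constructor <;> linarith
      · intro z x y
        simp only [siblingPairs, if_true]
        exact (hprod x y).trans (by linarith))
  refine key.trans ?_
  have hr := ht.sqrt_nsq_row_le h α u (by omega)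
  have hr' : √(nsq (row R α u)) ≤ q ^ i / √(v : ℝ) ^ i := by
    refine hr.trans ?_
    rw [hu]
    exact div_le_div_of_nonneg_left (by positivity) (by positivity)
      (pow_le_pow_right₀ hs1 (by omega))
  calc _ ≤ q * (4 * (M * κ) / √(v : ℝ)) * (q ^ i / √(v : ℝ) ^ i) := by gcongr
    _ = _ := by
      rw [hM, hκ, ← hw]
      field_simp
      ring

/-- A deviation of constant scale divided by about `v ^ 2` ternary rules yields four powers of `√v`,
and the row yields `n`. -/
lemma Typical.abs_ter_le (w : List Bool) (α a b : Fin v) (hw : w.length = n) :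
    |∑ y, row R α w y * ruleAvg (R n) false (siblingPairs (pairInd a b)) y| ≤
      8 * q ^ (n + 2) / √(v : ℝ) ^ (n + 4) := by
  have hs := h.sqrt_pos
  have hs1 := h.one_le_sqrt
  have hq := h.q_pos
  have hv := h.v_pos
  have ht' := ht.pair n w [] [] α a b hw.le le_rfl rfl
  have e : pairMul (leaf R lastPos (n + 1) [] (symInd a)) (leaf R firstPos (n + 1) [] (symInd b)) =
    pairInd a b := (pairInd_eq a b).symm
  rw [e] at ht'
  have hr := ht.sqrt_nsq_row_le h α w (by omega)
  have hr' : √(nsq (row R α w)) ≤ q ^ n / √(v : ℝ) ^ n := by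
    refine hr.trans ?_
    rw [hw]
    exact div_le_div_of_nonneg_left (by positivity) (by positivity)
      (pow_le_pow_right₀ hs1 (by omega))
  refine (ht'.abs_le (κ := q * (1 / (v : ℝ) ^ 2)) (by norm_num) (spread_pairInd_ter a b)
    (h.slots_pos false) (h.tame_ter_le (by positivity) ?_)).trans ?_
  · have : 1 / (v : ℝ) ^ 2 * (v : ℝ) ^ 2 = 1 := by field_simp
    rw [this]; norm_num
  · have hq1 : 1 ≤ q := by linarith [h.q_ge_twelve]
    calc _ ≤ q * (1 / (v : ℝ) ^ 2) * (q ^ n / √(v : ℝ) ^ n) := by gcongr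
      _ = q ^ (n + 1) / √(v : ℝ) ^ (n + 4) := by
        have e := h.sqrt_sq
        generalize √(v : ℝ) = S at *
        rw [← e]
        field_simp
        ring
      _ ≤ _ := by
        gcongr
        calc q ^ (n + 1) ≤ q ^ (n + 2) := pow_le_pow_right₀ hq1 (by omega)
          _ ≤ 8 * q ^ (n + 2) := by linarith [pow_pos hq (n + 2)]

end

/-! ### Norms and inner products of the all-binary pull-backs. -/

section Quad

lemma nsq_cen_add_mul (f g : Fin v → ℝ) (c : ℝ) :
    nsq (cen fun y => f y + c * g y) =
      nsq (cen f) + c ^ 2 * nsq (cen g) + 2 * c * ∑ y, cen f y * cen g y := by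
  rw [cen_add, cen_mul]
  simp only [nsq, Finset.mul_sum, ← Finset.sum_add_distrib]
  exact Finset.sum_congr rfl fun y _ => by ring

lemma binLeaf_succ (i k : ℕ) (z : Fin v) :
    binLeaf R i (k + 1) z = ruleOp (R i) allPos true (binLeaf R (i + 1) k z) := rfl

lemma nsq_cen_symInd (z : Fin v) : nsq (cen (symInd z)) = 1 - 1 / v := by
  rw [nsq_cen, sum_symInd]; simp [symInd]

lemma sum_cen_mul_cen_symInd {z z' : Fin v} (h : z ≠ z') :
    ∑ y, cen (symInd z) y * cen (symInd z') y = -(1 / v) := by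
  have hv : (v : ℝ) ≠ 0 := by
    have : 0 < v := Fin.pos z
    positivity
  have h1 : ∑ y, symInd z y * symInd z' y = 0 := by simp [symInd, h.symm]
  simp only [cen, sum_symInd, sub_mul, mul_sub, Finset.sum_sub_distrib, ← Finset.mul_sum,
    ← Finset.sum_mul, h1]
  simp
  field_simp
  ring

variable (ht : Typical ρ ε n R)
include ht

/-- Each binary level multiplies the squared norm by `2 / m₂` up to a factor between `1 - ε` and `1
+ ε`; the start is a centered indicator. -/
lemma Typical.nsq_binLeaf (hε0 : 0 ≤ ε) (hε1 : ε ≤ 1) (k i : ℕ) (hik : i + k = n) (z : Fin v) :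
    (2 / m₂ : ℝ) ^ k * ((1 - ε) ^ k * (1 - 1 / v)) ≤ nsq (cen (binLeaf R i k z)) ∧
      nsq (cen (binLeaf R i k z)) ≤ (2 / m₂ : ℝ) ^ k * (1 + ε) ^ k := by
  induction k generalizing i with
  | zero =>
    have e : binLeaf R i 0 z = symInd z := rfl
    rw [e, nsq_cen_symInd]
    have : (0 : ℝ) ≤ 1 / v := by positivity
    simp
  | succ k ih =>
    obtain ⟨h1, h2⟩ := ih (i + 1) (by omega)
    have hq := ht.quad i k 1 z z (by omega)
    simp only [QuadTame, Fin.val_one, Nat.cast_one, sub_self, zero_mul, add_zero] at hq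
    rw [binLeaf_succ]
    change |nsq (cen (ruleOp (R i) allPos true (binLeaf R (i + 1) k z))) -
      2 / m₂ * nsq (cen (binLeaf R (i + 1) k z))| ≤ _ at hq
    obtain ⟨h3, h4⟩ := abs_le.1 hq
    have hm : (0 : ℝ) ≤ 2 / m₂ := by positivity
    constructor
    · calc _ = (1 - ε) * (2 / m₂ * ((2 / m₂ : ℝ) ^ k * ((1 - ε) ^ k * (1 - 1 / v)))) := by ring
        _ ≤ (1 - ε) * (2 / m₂ * nsq (cen (binLeaf R (i + 1) k z))) := by
          gcongr
        _ ≤ _ := by linarith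
    · calc _ ≤ (1 + ε) * (2 / m₂ * nsq (cen (binLeaf R (i + 1) k z))) := by linarith
        _ ≤ (1 + ε) * (2 / m₂ * ((2 / m₂ : ℝ) ^ k * (1 + ε) ^ k)) := by gcongr
        _ = _ := by ring

/-- Distinct centered indicators have inner product `-(1 / v)`, and each level adds a relative error
controlled by the norms. -/
lemma Typical.abs_sum_binLeaf_le (hε0 : 0 ≤ ε) (hε1 : ε ≤ 1) (k i : ℕ) (hik : i + k = n)
    {z z' : Fin v} (hz : z ≠ z') :
    |∑ y, cen (binLeaf R i k z) y * cen (binLeaf R i k z') y| ≤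
      (2 / m₂ : ℝ) ^ k * (1 / v + ε * (k * 2 ^ k)) := by
  induction k generalizing i with
  | zero =>
    have e : ∀ z, binLeaf R i 0 z = symInd z := fun _ => rfl
    rw [e, e, sum_cen_mul_cen_symInd hz, abs_neg, abs_of_nonneg (by positivity)]
    simp
  | succ k ih =>
    have h0 := ih (i + 1) (by omega)
    have hq0 := ht.quad i k 0 z z' (by omega)
    have hq2 := ht.quad i k 2 z z' (by omega)
    have e0 : (((0 : Fin 3) : ℕ) - 1 : ℝ) = -1 := by simp
    have e2 : (((2 : Fin 3) : ℕ) - 1 : ℝ) = 1 := by norm_num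
    rw [e0] at hq0
    rw [e2] at hq2
    simp only [QuadTame, ruleOp_add, ruleOp_mul] at hq0 hq2
    rw [nsq_cen_add_mul, nsq_cen_add_mul] at hq0 hq2
    have b1 := (ht.nsq_binLeaf hε0 hε1 k (i + 1) (by omega) z).2
    have b2 := (ht.nsq_binLeaf hε0 hε1 k (i + 1) (by omega) z').2
    rw [binLeaf_succ, binLeaf_succ]
    set P := ∑ y, cen (ruleOp (R i) allPos true (binLeaf R (i + 1) k z)) y *
      cen (ruleOp (R i) allPos true (binLeaf R (i + 1) k z')) y
    set Q := ∑ y, cen (binLeaf R (i + 1) k z) y * cen (binLeaf R (i + 1) k z') y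
    set a := nsq (cen (binLeaf R (i + 1) k z))
    set b := nsq (cen (binLeaf R (i + 1) k z'))
    set c := nsq (cen (ruleOp (R i) allPos true (binLeaf R (i + 1) k z)))
    set d := nsq (cen (ruleOp (R i) allPos true (binLeaf R (i + 1) k z')))
    have hm : (0 : ℝ) ≤ 2 / m₂ := by positivity
    -- Polarization: subtract the estimates for the sum and the difference and divide by four. On
    -- the error side the inner products cancel and the norms remain.
    have key : |P - 2 / m₂ * Q| ≤ ε * (2 / m₂ * ((a + b) / 2)) := by
      have h1 := abs_le.1 hq0
      have h2 := abs_le.1 hq2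
      rw [abs_le]
      constructor <;> nlinarith
    have h1e : (1 + ε) ^ k ≤ 2 ^ k := by gcongr; linarith
    have hab : (a + b) / 2 ≤ (2 / m₂ : ℝ) ^ k * 2 ^ k := by
      have : (2 / m₂ : ℝ) ^ k * (1 + ε) ^ k ≤ (2 / m₂ : ℝ) ^ k * 2 ^ k := by gcongr
      linarith
    calc |P| = |(P - 2 / m₂ * Q) + 2 / m₂ * Q| := by ring_nf
      _ ≤ |P - 2 / m₂ * Q| + |2 / m₂ * Q| := abs_add_le _ _
      _ ≤ ε * (2 / m₂ * ((2 / m₂ : ℝ) ^ k * 2 ^ k)) +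
          2 / m₂ * ((2 / m₂ : ℝ) ^ k * (1 / v + ε * (k * 2 ^ k))) := by
        rw [abs_mul, abs_of_nonneg hm]
        gcongr
        exact key.trans (by gcongr)
      _ = (2 / m₂ : ℝ) ^ (k + 1) * (1 / v + ε * ((k + 1) * 2 ^ k)) := by ring
      _ ≤ _ := by
        push_cast
        gcongr
        · norm_num
        · omega

end Quad

end Leaves

/-! ### Almost all grammars are typical. -/

/-- The linear statistic is of the expected order simultaneously for all admissible deviation
bounds. -/
lemma linear_statistic_forall_whp {η δ : ℝ} (hη : 0 < η) (hδ : 0 < δ) :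
    ∀ᶠ v : ℕ in atTop, ∀ (m : ℕ) (U : Type) [Fintype U] [DecidableEq U], 0 < m →
      (v * m : ℝ) + η * Fintype.card U ≤ Fintype.card U → (Fintype.card U : ℝ) ≤ (v : ℝ) ^ 3 →
      ∀ (c : U → ℝ) (x : Fin v → ℝ), ∑ z, x z = 0 →
      frac (fun φ : (Fin v × Fin m) ↪ U => ∃ c₀ τ : ℝ, 0 ≤ τ ∧ (∀ u, |c u - c₀| ≤ τ) ∧
        ∑ u, (c u - c₀) ^ 2 ≤ v * τ ^ 2 ∧
        (v : ℝ) ^ δ * (√(nsq x) * (4 * τ)) < |∑ s, x s.1 * c (φ s)|) ≤ 1 / (v : ℝ) ^ 6 := by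
  filter_upwards [linear_statistic_whp hη hδ] with v hv m U _ _ hm hcard hU c x hx
  -- A single admissible `τ₁` within a factor two of the infimum serves all admissible `τ` at once;
  -- this is why the threshold has `4 * τ` where the pointwise bound has `2 * τ`.
  set S : Set ℝ := {τ | 0 ≤ τ ∧ ∃ c₀, (∀ u, |c u - c₀| ≤ τ) ∧ ∑ u, (c u - c₀) ^ 2 ≤ v * τ ^ 2}
    with hS
  have hbdd : BddBelow S := ⟨0, fun τ h => h.1⟩
  have hfalse : (∀ φ : (Fin v × Fin m) ↪ U, ¬ ∃ c₀ τ : ℝ, 0 ≤ τ ∧ (∀ u, |c u - c₀| ≤ τ) ∧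
        ∑ u, (c u - c₀) ^ 2 ≤ v * τ ^ 2 ∧
        (v : ℝ) ^ δ * (√(nsq x) * (4 * τ)) < |∑ s, x s.1 * c (φ s)|) →
      frac (fun φ : (Fin v × Fin m) ↪ U => ∃ c₀ τ : ℝ, 0 ≤ τ ∧ (∀ u, |c u - c₀| ≤ τ) ∧
        ∑ u, (c u - c₀) ^ 2 ≤ v * τ ^ 2 ∧
        (v : ℝ) ^ δ * (√(nsq x) * (4 * τ)) < |∑ s, x s.1 * c (φ s)|) ≤ 1 / (v : ℝ) ^ 6 :=
    fun h => by
      simp only [h, frac, Finset.filter_false, Finset.card_empty, Nat.cast_zero, zero_div]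
      positivity
  rcases S.eq_empty_or_nonempty with hE | hne
  · refine hfalse fun φ => ?_
    rintro ⟨c₀, τ, h1, h2, h3, -⟩
    have : τ ∈ S := ⟨h1, c₀, h2, h3⟩
    rw [hE] at this; exact this
  have h0 : 0 ≤ sInf S := le_csInf hne fun τ h => h.1
  rcases h0.eq_or_lt with h0 | h0
  -- If the infimum is zero then `c` is constant, and the vanishing sum of `x` annihilates the
  -- statistic.
  · refine hfalse fun φ => ?_
    rintro ⟨c₀, τ, h1, h2, h3, h4⟩
    have hconst : ∀ u u', c u = c u' := fun u u' => by
      by_contra hcu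
      have hpos : 0 < |c u - c u'| / 2 := by
        have := abs_pos.2 (sub_ne_zero.2 hcu)
        positivity
      rw [h0] at hpos
      obtain ⟨τ', ⟨_, c₁, hc, _⟩, hlt⟩ := exists_lt_of_csInf_lt hne hpos
      have := abs_sub_le (c u) c₁ (c u')
      have e1 := hc u
      have e2 := hc u'
      rw [abs_sub_comm] at e2
      linarith
    have hz : ∑ s, x s.1 * c (φ s) = 0 := by
      rcases isEmpty_or_nonempty U with hU0 | ⟨⟨u₀⟩⟩
      · exact Finset.sum_eq_zero fun s _ => (hU0.false (φ s)).elim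
      · simp only [hconst _ u₀]
        rw [← Finset.sum_mul, sum_slots_fst, hx]; ring
    rw [hz, abs_zero] at h4
    have : 0 ≤ (v : ℝ) ^ δ * (√(nsq x) * (4 * τ)) := by positivity
    linarith
  · obtain ⟨τ₁, ⟨hτ₁, c₁, hc1, hc2⟩, hlt⟩ := exists_lt_of_csInf_lt hne
      (show sInf S < 2 * sInf S by linarith)
    have hpos : 0 < τ₁ := lt_of_lt_of_le h0 (csInf_le hbdd ⟨hτ₁, c₁, hc1, hc2⟩)
    refine (frac_mono fun φ h => ?_).trans (hv m U hm hcard hU c c₁ τ₁ hpos hc1 hc2 x hx)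
    obtain ⟨c₀, τ, h1, h2, h3, h4⟩ := h
    have hle : sInf S ≤ τ := csInf_le hbdd ⟨h1, c₀, h2, h3⟩
    have h5 : 2 * τ₁ ≤ 4 * τ := by linarith
    exact lt_of_le_of_lt (by gcongr) h4

/-- The numbers of rules are of the order of their maximal values, and bounded away from them. -/
structure Sizes (η : ℝ) (v m₂ m₃ : ℕ) : Prop where
  bin : η * v ≤ m₂
  ter : η * (v : ℝ) ^ 2 ≤ m₃
  bin_le : (v * m₂ : ℝ) + η * (v : ℝ) ^ 2 ≤ (v : ℝ) ^ 2
  ter_le : (v * m₃ : ℝ) + η * (v : ℝ) ^ 3 ≤ (v : ℝ) ^ 3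

/-- The values of a function of the productions do not depend on the parents. -/
def ParentFree {v : ℕ} (c : Production v → ℝ) : Prop :=
  (∀ z z' x y, c (.bin z x y) = c (.bin z' x y)) ∧
    ∀ z z' x y w, c (.ter z x y w) = c (.ter z' x y w)

lemma parentFree_childSum {v : ℕ} (θ : ℝ × ℝ × ℝ) (f : Fin v → ℝ) :
    ParentFree (childSum θ f) := ⟨fun _ _ _ _ => rfl, fun _ _ _ _ _ => rfl⟩

lemma parentFree_siblingPairs {v : ℕ} (c : Fin v → Fin v → ℝ) :
    ParentFree (siblingPairs c) := ⟨fun _ _ _ _ => rfl, fun _ _ _ _ _ => rfl⟩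

/-- For a parent-free `c` any fixed parent `z₀` can be inserted, which makes the average over rules
a statistic of one injection. Each arity involves only its own component of the rules. -/
lemma tame_whp {η δ : ℝ} (hη : 0 < η) (hδ : 0 < δ) :
    ∀ᶠ v : ℕ in atTop, ∀ (m₂ m₃ : ℕ), Sizes η v m₂ m₃ → ∀ (c : Production v → ℝ),
      ParentFree c → ∀ x : Fin v → ℝ, ∑ z, x z = 0 →
      frac (fun r : Rules v m₂ m₃ => ¬ Tame ((v : ℝ) ^ δ) r x c) ≤ 2 / (v : ℝ) ^ 6 := by
  filter_upwards [linear_statistic_forall_whp hη hδ, eventually_ge_atTop 1]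
    with v hv hv1 m₂ m₃ hsz c hc x hx
  have hv0 : (0 : ℝ) < v := by exact_mod_cast hv1
  have hv1' : (1 : ℝ) ≤ v := by exact_mod_cast hv1
  have hm2 : (0 : ℝ) < m₂ := lt_of_lt_of_le (by positivity) hsz.bin
  have hm3 : (0 : ℝ) < m₃ := lt_of_lt_of_le (by positivity) hsz.ter
  let z₀ : Fin v := ⟨0, hv1⟩
  set P : Rules v m₂ m₃ → Prop := fun r => ∃ c₀ τ : ℝ, 0 ≤ τ ∧
    (∀ u : Fin v × Fin v, |c (.bin z₀ u.1 u.2) - c₀| ≤ τ) ∧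
    ∑ u : Fin v × Fin v, (c (.bin z₀ u.1 u.2) - c₀) ^ 2 ≤ v * τ ^ 2 ∧
    (v : ℝ) ^ δ * (√(nsq x) * (4 * τ)) < |∑ s, x s.1 * c (.bin z₀ (r.1 s).1 (r.1 s).2)| with hP
  set Q : Rules v m₂ m₃ → Prop := fun r => ∃ c₀ τ : ℝ, 0 ≤ τ ∧
    (∀ u : Fin v × Fin v × Fin v, |c (.ter z₀ u.1 u.2.1 u.2.2) - c₀| ≤ τ) ∧
    ∑ u : Fin v × Fin v × Fin v, (c (.ter z₀ u.1 u.2.1 u.2.2) - c₀) ^ 2 ≤ v * τ ^ 2 ∧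
    (v : ℝ) ^ δ * (√(nsq x) * (4 * τ)) <
      |∑ s, x s.1 * c (.ter z₀ (r.2 s).1 (r.2 s).2.1 (r.2 s).2.2)| with hQ
  have h1 : frac P ≤ 1 / (v : ℝ) ^ 6 := frac_prod_left (by positivity) fun _ =>
    hv m₂ (Fin v × Fin v) (by exact_mod_cast hm2)
      (by simpa [sq] using hsz.bin_le)
      (by simp; nlinarith [mul_pos hv0 hv0]) (fun u => c (.bin z₀ u.1 u.2)) x hx
  have h2 : frac Q ≤ 1 / (v : ℝ) ^ 6 := frac_prod_right (by positivity) fun _ =>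
    hv m₃ (Fin v × Fin v × Fin v) (by exact_mod_cast hm3)
      (by
        have := hsz.ter_le
        simp only [Fintype.card_prod, Fintype.card_fin, Nat.cast_mul]
        have e : (v : ℝ) * (v * v) = (v : ℝ) ^ 3 := by ring
        rw [e]; exact this)
      (by simp; apply le_of_eq; ring) (fun u => c (.ter z₀ u.1 u.2.1 u.2.2)) x hx
  refine (frac_mono fun r hr => ?_).trans ((frac_or_le P Q).trans (by
    have : 2 / (v : ℝ) ^ 6 = 1 / (v : ℝ) ^ 6 + 1 / (v : ℝ) ^ 6 := by ring
    linarith))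
  simp only [Tame, not_forall, not_le] at hr
  obtain ⟨s, c₀, τ, hτ, hsp, hlt⟩ := hr
  cases s with
  | true =>
    left
    refine ⟨c₀, τ, hτ, (hsp z₀).1, (hsp z₀).2, ?_⟩
    have e : ∑ y, x y * ruleAvg r true c y =
        1 / (m₂ : ℝ) * ∑ s : Fin v × Fin m₂, x s.1 * c (.bin z₀ (r.1 s).1 (r.1 s).2) := by
      rw [Fintype.sum_prod_type, Finset.mul_sum]
      refine Finset.sum_congr rfl fun y _ => ?_
      rw [ruleAvg]
      dsimp only
      rw [← Finset.mul_sum]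
      simp only [hc.1 y z₀]; ring
    rw [e, abs_mul, abs_of_nonneg (by positivity), one_div_mul_eq_div] at hlt
    exact (div_lt_div_iff_of_pos_right hm2).1 hlt
  | false =>
    right
    refine ⟨c₀, τ, hτ, (hsp z₀).1, (hsp z₀).2, ?_⟩
    have e : ∑ y, x y * ruleAvg r false c y =
        1 / (m₃ : ℝ) * ∑ s : Fin v × Fin m₃,
          x s.1 * c (.ter z₀ (r.2 s).1 (r.2 s).2.1 (r.2 s).2.2) := by
      rw [Fintype.sum_prod_type, Finset.mul_sum]
      refine Finset.sum_congr rfl fun y _ => ?_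
      rw [ruleAvg]
      dsimp only
      rw [← Finset.mul_sum]
      simp only [hc.2 y z₀]; ring
    rw [e, abs_mul, abs_of_nonneg (by positivity), one_div_mul_eq_div] at hlt
    exact (div_lt_div_iff_of_pos_right hm3).1 hlt

lemma quadTame_whp {η ε : ℝ} (hη : 0 < η) (hε : 0 < ε) :
    ∀ᶠ v : ℕ in atTop, ∀ (m₂ m₃ : ℕ), Sizes η v m₂ m₃ → ∀ h : Fin v → ℝ,
      frac (fun r : Rules v m₂ m₃ => ¬ QuadTame ε r h) ≤ 2 / (v : ℝ) ^ 6 := by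
  filter_upwards [quadratic_statistic_whp hη hε, eventually_ge_atTop 1]
    with v hv hv1 m₂ m₃ hsz h
  have hv0 : (0 : ℝ) < v := by exact_mod_cast hv1
  have hm2 : (0 : ℝ) < m₂ := lt_of_lt_of_le (by positivity) hsz.bin
  refine frac_prod_left (by positivity) fun φ₃ => ?_
  refine (frac_mono fun φ hr => ?_).trans ((hv m₂ hsz.bin hsz.bin_le h).trans (by gcongr; norm_num))
  simp only [QuadTame, not_le] at hr
  have e : ruleOp ((φ, φ₃) : Rules v m₂ m₃) allPos true h =
      fun z => 1 / (m₂ : ℝ) * ∑ j, (h (φ (z, j)).1 + h (φ (z, j)).2) := by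
    ext z; simp [ruleOp, ruleAvg, childSum, allPos]
  rw [e, cen_mul, nsq_mul] at hr
  set A := nsq (cen fun z => ∑ j, (h (φ (z, j)).1 + h (φ (z, j)).2))
  have e2 : (1 / (m₂ : ℝ)) ^ 2 * A - 2 / m₂ * nsq (cen h) =
      (1 / (m₂ : ℝ)) ^ 2 * (A - 2 * m₂ * nsq (cen h)) := by
    field_simp
  rw [e2, abs_mul, abs_of_nonneg (by positivity : (0 : ℝ) ≤ (1 / (m₂ : ℝ)) ^ 2)] at hr
  have e3 : ε * (2 / m₂ * nsq (cen h)) =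
      (1 / (m₂ : ℝ)) ^ 2 * (ε * (2 * m₂ * nsq (cen h))) := by
    field_simp
  rw [e3] at hr
  exact lt_of_mul_lt_mul_left hr (by positivity)

/-! ### Independence of the levels and the union bound. -/

section Levels

variable {n v m₂ m₃ : ℕ}

/-- A row reads only levels below the length of its word. Together with `leaf_congr`, for the levels
below the resampled one in the tree, this freezes both factors of a statistic. -/
lemma row_congr {R R' : ℕ → Rules v m₂ m₃} (α : Fin v) (w : List Bool)
    (h : ∀ j < w.length, R j = R' j) : row R α w = row R' α w := by
  induction w with
  | nil => rfl
  | cons s w ih =>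
    ext y
    simp only [row]
    rw [ih fun j hj => h j (by simp; omega), h w.length (by simp)]

lemma leaf_congr {R R' : ℕ → Rules v m₂ m₃} (θ : ℝ × ℝ × ℝ) (f : Fin v → ℝ) (w : List Bool)
    (i : ℕ) (h : ∀ j, i ≤ j → j < i + w.length → R j = R' j) :
    leaf R θ i w f = leaf R' θ i w f := by
  induction w generalizing i with
  | nil => rfl
  | cons s w ih =>
    simp only [leaf]
    rw [ih (i + 1) fun j h1 h2 => h j (by omega) (by simp; omega),
      h i le_rfl (by simp)]

lemma levels_update_self (G : Grammar (n + 1) v m₂ m₃) (i : Fin (n + 1)) (r : Rules v m₂ m₃) :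
    levels (Function.update G i r) i = r := by
  rw [levels, dif_pos i.2]
  simp

lemma levels_update_of_ne (G : Grammar (n + 1) v m₂ m₃) (i : Fin (n + 1)) (r : Rules v m₂ m₃)
    {j : ℕ} (hj : j < n + 1) (hne : j ≠ i) : levels (Function.update G i r) j = levels G j := by
  have : (⟨j, hj⟩ : Fin (n + 1)) ≠ i := fun h => hne (by rw [← h])
  simp [levels, hj, this]

/-- The words of length at most `n`. -/
abbrev Words (n : ℕ) : Type := Σ j : Fin (n + 1), List.Vector Bool j

lemma exists_words {w : List Bool} (h : w.length ≤ n) : ∃ w' : Words n, w'.2.toList = w :=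
  ⟨⟨⟨w.length, by omega⟩, ⟨w, rfl⟩⟩, rfl⟩

/-- Almost all grammars are typical. -/
lemma typical_whp (n : ℕ) {η δ ε : ℝ} (hη : 0 < η) (hδ : 0 < δ) (hε : 0 < ε) :
    ∃ K : ℝ, ∀ᶠ v : ℕ in atTop, ∀ (m₂ m₃ : ℕ) [NeZero m₂] [NeZero m₃], Sizes η v m₂ m₃ →
      frac (fun G : Grammar (n + 1) v m₂ m₃ => ¬ Typical ((v : ℝ) ^ δ) ε n (levels G)) ≤
        K / (v : ℝ) ^ 3 := by
  refine ⟨2 * (Fintype.card (Fin (n + 1) × Words n × Words n × Fin 3) +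
    Fintype.card (Fin (n + 1) × Words n × Words n × Words n) +
    Fintype.card (Fin (n + 1) × Fin (n + 1) × Fin 3)), ?_⟩
  filter_upwards [tame_whp hη hδ, quadTame_whp hη hε, eventually_ge_atTop 1]
    with v hT hQ hv1 m₂ m₃ _ _ hsz
  have hv1' : (1 : ℝ) ≤ v := by exact_mod_cast hv1
  have hv0 : (0 : ℝ) < v := by linarith
  set b : ℝ := 2 / (v : ℝ) ^ 6 with hb
  have hb0 : 0 ≤ b := by positivity
  -- The length constraints belong to the event, so the index type is a plain finite product; where
  -- they fail the event is empty.
  set P₁ : ((Fin (n + 1) × Words n × Words n × Fin 3) × Fin v × Fin v) →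
      Grammar (n + 1) v m₂ m₃ → Prop := fun t G =>
    t.1.2.1.2.toList.length ≤ t.1.1 ∧ t.1.1 + t.1.2.2.1.2.toList.length ≤ n ∧
      ¬ Tame ((v : ℝ) ^ δ) (levels G t.1.1) (row (levels G) t.2.1 t.1.2.1.2.toList)
        (childSum (posVec t.1.2.2.2) (leaf (levels G) (posVec t.1.2.2.2) (t.1.1 + 1)
          t.1.2.2.1.2.toList (symInd t.2.2))) with hP₁
  set P₂ : ((Fin (n + 1) × Words n × Words n × Words n) × Fin v × Fin v × Fin v) →
      Grammar (n + 1) v m₂ m₃ → Prop := fun t G =>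
    t.1.2.1.2.toList.length ≤ t.1.1 ∧ t.1.1 + t.1.2.2.1.2.toList.length ≤ n ∧
      t.1.2.2.1.2.toList.length = t.1.2.2.2.2.toList.length ∧
      ¬ Tame ((v : ℝ) ^ δ) (levels G t.1.1) (row (levels G) t.2.1 t.1.2.1.2.toList)
        (siblingPairs (pairMul
          (leaf (levels G) lastPos (t.1.1 + 1) t.1.2.2.1.2.toList (symInd t.2.2.1))
          (leaf (levels G) firstPos (t.1.1 + 1) t.1.2.2.2.2.toList (symInd t.2.2.2)))) with hP₂
  set P₃ : ((Fin (n + 1) × Fin (n + 1) × Fin 3) × Fin v × Fin v) →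
      Grammar (n + 1) v m₂ m₃ → Prop := fun t G =>
    (t.1.1 : ℕ) + 1 + t.1.2.1 = n ∧ ¬ QuadTame ε (levels G t.1.1) (fun y =>
      binLeaf (levels G) (t.1.1 + 1) t.1.2.1 t.2.1 y +
        ((t.1.2.2 : ℕ) - 1 : ℝ) * binLeaf (levels G) (t.1.1 + 1) t.1.2.1 t.2.2 y) with hP₃
  have hlow : ∀ (i : Fin (n + 1)) (G : Grammar (n + 1) v m₂ m₃) r (α : Fin v) (w : List Bool),
      w.length ≤ i → row (levels (Function.update G i r)) α w = row (levels G) α w :=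
    fun i G r α w hw => row_congr α w fun j hj =>
      levels_update_of_ne G i r (by omega) (by omega)
  have hhigh : ∀ (i : Fin (n + 1)) (G : Grammar (n + 1) v m₂ m₃) r θ (f : Fin v → ℝ)
      (w : List Bool), i + w.length ≤ n →
      leaf (levels (Function.update G i r)) θ (i + 1) w f = leaf (levels G) θ (i + 1) w f :=
    fun i G r θ f w hw => leaf_congr θ f w _ fun j h1 h2 =>
      levels_update_of_ne G i r (by omega) (by omega)
  have h1 : ∀ t, frac (P₁ t) ≤ b := fun t => by
    refine frac_le_of_update _ t.1.1 hb0 fun G => ?_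
    by_cases hc : t.1.2.1.2.toList.length ≤ t.1.1 ∧ t.1.1 + t.1.2.2.1.2.toList.length ≤ n
    · refine (frac_mono fun r hr => ?_).trans (hT m₂ m₃ hsz
        (childSum (posVec t.1.2.2.2) (leaf (levels G) (posVec t.1.2.2.2) (t.1.1 + 1)
          t.1.2.2.1.2.toList (symInd t.2.2))) (parentFree_childSum _ _)
        (row (levels G) t.2.1 t.1.2.1.2.toList) (sum_row _ _ _))
      have := hr.2.2
      rwa [levels_update_self, hlow _ _ _ _ _ hc.1, hhigh _ _ _ _ _ _ hc.2] at this
    · refine (frac_mono (Q := fun _ => False) fun r hr => hc ⟨hr.1, hr.2.1⟩).trans ?_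
      simpa [frac] using hb0
  have h2 : ∀ t, frac (P₂ t) ≤ b := fun t => by
    refine frac_le_of_update _ t.1.1 hb0 fun G => ?_
    by_cases hc : t.1.2.1.2.toList.length ≤ t.1.1 ∧ t.1.1 + t.1.2.2.1.2.toList.length ≤ n ∧
      t.1.2.2.1.2.toList.length = t.1.2.2.2.2.toList.length
    · refine (frac_mono fun r hr => ?_).trans (hT m₂ m₃ hsz
        (siblingPairs (pairMul
          (leaf (levels G) lastPos (t.1.1 + 1) t.1.2.2.1.2.toList (symInd t.2.2.1))
          (leaf (levels G) firstPos (t.1.1 + 1) t.1.2.2.2.2.toList (symInd t.2.2.2))))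
        (parentFree_siblingPairs _)
        (row (levels G) t.2.1 t.1.2.1.2.toList) (sum_row _ _ _))
      have := hr.2.2.2
      rwa [levels_update_self, hlow _ _ _ _ _ hc.1, hhigh _ _ _ _ _ _ hc.2.1,
        hhigh _ _ _ _ _ _ (hc.2.2 ▸ hc.2.1)] at this
    · refine (frac_mono (Q := fun _ => False) fun r hr => hc ⟨hr.1, hr.2.1, hr.2.2.1⟩).trans ?_
      simpa [frac] using hb0
  have h3 : ∀ t, frac (P₃ t) ≤ b := fun t => by
    refine frac_le_of_update _ t.1.1 hb0 fun G => ?_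
    by_cases hc : (t.1.1 : ℕ) + 1 + t.1.2.1 = n
    · refine (frac_mono fun r hr => ?_).trans (hQ m₂ m₃ hsz (fun y =>
        binLeaf (levels G) (t.1.1 + 1) t.1.2.1 t.2.1 y +
          ((t.1.2.2 : ℕ) - 1 : ℝ) * binLeaf (levels G) (t.1.1 + 1) t.1.2.1 t.2.2 y))
      have := hr.2
      rwa [levels_update_self, binLeaf, binLeaf, hhigh _ _ _ _ _ _ (by simp; omega),
        hhigh _ _ _ _ _ _ (by simp; omega)] at this
    · refine (frac_mono (Q := fun _ => False) fun r hr => hc hr.1).trans ?_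
      simpa [frac] using hb0
  have key : frac (fun G : Grammar (n + 1) v m₂ m₃ => ¬ Typical ((v : ℝ) ^ δ) ε n (levels G)) ≤
      frac (fun G => ∃ t, P₁ t G) + (frac (fun G => ∃ t, P₂ t G) + frac (fun G => ∃ t, P₃ t G)) := by
    refine (frac_mono fun G hG => ?_).trans ((frac_or_le _ _).trans
      (add_le_add le_rfl (frac_or_le _ _)))
    by_contra hno
    push Not at hno
    obtain ⟨n1, n2, n3⟩ := hno
    refine hG ⟨fun i u w k α a hu hw => ?_, fun i u w w' α a b hu hw hw' => ?_,
      fun i k σ z z' hik => ?_⟩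
    · obtain ⟨u, rfl⟩ := exists_words (n := n) (w := u) (by omega)
      obtain ⟨w, rfl⟩ := exists_words (n := n) (w := w) (by omega)
      have := n1 ((⟨i, by omega⟩, u, w, k), α, a)
      simp only [hP₁, not_and, not_not] at this
      exact this hu hw
    · obtain ⟨u, rfl⟩ := exists_words (n := n) (w := u) (by omega)
      obtain ⟨w, rfl⟩ := exists_words (n := n) (w := w) (by omega)
      obtain ⟨w', rfl⟩ := exists_words (n := n) (w := w') (by omega)
      have := n2 ((⟨i, by omega⟩, u, w, w'), α, a, b)
      simp only [hP₂, not_and, not_not] at this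
      exact this hu hw hw'
    · have := n3 ((⟨i, by omega⟩, ⟨k, by omega⟩, σ), z, z')
      simp only [hP₃, not_and, not_not] at this
      exact this hik
  refine key.trans ?_
  -- Each family has at most a constant times `v ^ 3` members of probability at most `2 / v ^ 6`.
  have k1 := frac_exists_le P₁ b h1
  have k2 := frac_exists_le P₂ b h2
  have k3 := frac_exists_le P₃ b h3
  rw [Fintype.card_prod, Fintype.card_prod (Fin v), Fintype.card_fin] at k1
  rw [Fintype.card_prod, Fintype.card_prod (Fin v), Fintype.card_prod (Fin v),
    Fintype.card_fin] at k2
  rw [Fintype.card_prod, Fintype.card_prod (Fin v), Fintype.card_fin] at k3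
  push_cast at k1 k2 k3 ⊢
  set N₁ : ℝ := ((Fintype.card (Fin (n + 1) × Words n × Words n × Fin 3) : ℕ) : ℝ)
  set N₂ : ℝ := ((Fintype.card (Fin (n + 1) × Words n × Words n × Words n) : ℕ) : ℝ)
  set N₃ : ℝ := ((Fintype.card (Fin (n + 1) × Fin (n + 1) × Fin 3) : ℕ) : ℝ)
  have hv23 : (v : ℝ) * v ≤ v * (v * v) := by nlinarith [mul_pos hv0 hv0]
  have hN1 : 0 ≤ N₁ := by positivity
  have hN3 : 0 ≤ N₃ := by positivity
  calc _ ≤ N₁ * (v * (v * v)) * b + (N₂ * (v * (v * v)) * b + N₃ * (v * (v * v)) * b) := by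
        refine add_le_add (k1.trans ?_) (add_le_add k2 (k3.trans ?_)) <;> gcongr
    _ = 2 * (N₁ + N₂ + N₃) / (v : ℝ) ^ 3 := by
        rw [hb]; field_simp; ring

end Levels

/-! ### Positivity of the weights of the words. -/

section Weights

variable {p : ℝ}

lemma lenStepR_iterate_pos (hp0 : 0 < p) (hp1 : p < 1) {F : ℕ → ℝ} (hF : ∀ k, 2 ≤ k → 0 < F k)
    (n k : ℕ) (hk : 2 ≤ k) : 0 < (lenStepR p)^[n] F k := by
  induction n generalizing k with
  | zero => exact hF k hk
  | succ n ih =>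
    rw [Function.iterate_succ_apply', lenStepR]
    have h1 := ih (k + 2) (by omega)
    have h2 := ih (k + 3) (by omega)
    have : 0 < 1 - p := by linarith
    positivity

/-- A production has at least two children, so positivity of `F` is needed from length two on. This
matters because `pairWeight 1 = 0`. -/
lemma liftOne_pos (hp0 : 0 < p) (hp1 : p < 1) {F : ℕ → ℝ} (hF : ∀ k, 2 ≤ k → 0 < F k) (s : Bool)
    (N : ℕ) : 0 < liftOne p s F N := by
  refine mul_pos ?_ (lenStepR_iterate_pos hp0 hp1 hF _ _ (by cases s <;> simp [arityLen]))
  cases s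
  · simpa [arityWeight] using hp1
  · simpa [arityWeight] using hp0

lemma binaryWeight_pos (hp0 : 0 < p) (hp1 : p < 1) (n : ℕ) {F : ℕ → ℝ}
    (hF : ∀ k, 1 ≤ k → 0 < F k) : 0 < binaryWeight p n F := by
  induction n generalizing F with
  | zero => exact hF 1 le_rfl
  | succ n ih =>
    exact ih (F := liftOne p true F) fun k _ =>
      liftOne_pos hp0 hp1 (fun k hk => hF k (by omega)) true k

lemma symConst_pos (hp0 : 0 < p) (hp1 : p < 1) (n : ℕ) {F : ℕ → ℝ}
    (hF : ∀ k, 1 ≤ k → 0 < F k) : 0 < symConst p n F := by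
  induction n generalizing F with
  | zero => exact hF 1 le_rfl
  | succ n ih =>
    have h := fun s => ih (F := liftOne p s F) fun k _ =>
      liftOne_pos hp0 hp1 (fun k hk => hF k (by omega)) s k
    have h1 := h true
    have h2 := h false
    rw [symConst]; positivity

lemma pairWeight_pos {k : ℕ} (hk : 2 ≤ k) : 0 < pairWeight k := by
  have : 0 < k - 1 := by omega
  unfold pairWeight; positivity

lemma posWeight_pos {k : ℕ} (hk : 1 ≤ k) : 0 < posWeight k := by
  have : 0 < k := by omega
  unfold posWeight; positivity

lemma one_div_natCast_le_one (k : ℕ) : 1 / (k : ℝ) ≤ 1 := by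
  rcases Nat.eq_zero_or_pos k with rfl | hk
  · simp
  · rw [div_le_one (by positivity)]; exact_mod_cast hk

lemma pairWeight_le_one (k : ℕ) : pairWeight k ≤ 1 := one_div_natCast_le_one _

lemma posWeight_le_one (k : ℕ) : posWeight k ≤ 1 := one_div_natCast_le_one _

/-- The ratio of the covariance of the parent of a binary pair and the covariance of a symbol at a
uniformly random position, in the limit of a large vocabulary. -/
def covRatio (p : ℝ) (n : ℕ) : ℝ :=
  binaryWeight p n (liftOne p true pairWeight) /
    (symConst p n (liftOne p true pairWeight) * binaryWeight p n posWeight)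

lemma covRatio_pos (hp0 : 0 < p) (hp1 : p < 1) (n : ℕ) : 0 < covRatio p n := by
  have h := fun k (_ : 1 ≤ k) => liftOne_pos hp0 hp1 (F := pairWeight)
    (fun k hk => pairWeight_pos hk) true k
  exact div_pos (binaryWeight_pos hp0 hp1 n h) (mul_pos (symConst_pos hp0 hp1 n h)
    (binaryWeight_pos hp0 hp1 n fun k hk => posWeight_pos hk))

end Weights

/-! ### Size of the negligible terms. -/

section Bounds

variable {n v m₂ m₃ : ℕ} [NeZero v] [NeZero m₂] [NeZero m₃] {p₂ : unitInterval}
  {ρ ε η q : ℝ} {R : ℕ → Rules v m₂ m₃}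
  (h : Scales v m₂ m₃ ρ η q) (ht : Typical ρ ε n R)
include h ht

/-- The order of the entries that are negligible compared to the covariance of binary siblings. -/
def errorScale (n v : ℕ) (q : ℝ) : ℝ :=
  (v : ℝ)⁻¹ * (32 * (n + 1) * 4 ^ n * (q ^ (n + 2) / √(v : ℝ) ^ (n + 4)))

lemma Typical.abs_ter_contribution_le (a b α : Fin v) :
    |typeContribution p₂ (fun i : Fin (n + 1) => R i) .ter a b α| ≤ errorScale n v q := by
  have hv := h.v_pos
  have hs := h.sqrt_pos
  have hq := h.q_pos
  rw [typeContribution_eq, abs_mul, abs_of_nonneg (by positivity), errorScale]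
  gcongr
  refine (abs_cen_symFun_le p₂.2.1 p₂.2.2 R α n (liftOne_nonneg p₂.2.1 p₂.2.2 pairWeight_nonneg _)
    (liftOne_le_one p₂.2.1 p₂.2.2 pairWeight_nonneg pairWeight_le_one _)
    fun w hw => ht.abs_ter_le h w α a b hw).trans ?_
  have h24 : (2 : ℝ) ^ n ≤ 4 ^ n := by gcongr; norm_num
  have hn : (0 : ℝ) ≤ n := by positivity
  calc (2 : ℝ) ^ n * (8 * q ^ (n + 2) / √(v : ℝ) ^ (n + 4))
      = (8 * 2 ^ n) * (q ^ (n + 2) / √(v : ℝ) ^ (n + 4)) := by ring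
    _ ≤ (32 * (n + 1) * 4 ^ n) * (q ^ (n + 2) / √(v : ℝ) ^ (n + 4)) := by
      gcongr
      nlinarith [pow_pos (show (0 : ℝ) < 4 by norm_num) n]

lemma Typical.abs_cross_contribution_le (a b α : Fin v) :
    |typeContribution p₂ (fun i : Fin (n + 1) => R i) .cross a b α| ≤ errorScale n v q := by
  have hv := h.v_pos
  have hs := h.sqrt_pos
  have hq := h.q_pos
  rw [typeContribution_eq, abs_mul, abs_of_nonneg (by positivity), errorScale]
  gcongr
  have e : contribFun p₂ R n .cross (pairInd a b) = fun α => ∑ s : Bool, ∑ s' : Bool,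
      pairFun p₂ R n (liftTwo p₂ s s' pairWeight) (crossOp (R n) s s' (pairInd a b)) α := rfl
  set τ := 8 * q ^ (n + 2) / √(v : ℝ) ^ (n + 4) with hτ
  have hτ0 : 0 ≤ τ := by positivity
  have hb : ∀ s s', |cen (pairFun p₂ R n (liftTwo p₂ s s' pairWeight)
      (crossOp (R n) s s' (pairInd a b))) α| ≤ n * 4 ^ n * τ := fun s s' => by
    rw [pairInd_eq, crossOp_pairMul]
    exact abs_cen_pairFun_le p₂.2.1 p₂.2.2 R a b α hτ0
      (fun i u w w' s hu hw hw' hne => ht.abs_cross_le h i u w w' s α a b hu hw hw' hne) n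
      (liftTwo_nonneg p₂.2.1 p₂.2.2 pairWeight_nonneg s s')
      (liftTwo_le_one p₂.2.1 p₂.2.2 pairWeight_nonneg pairWeight_le_one s s') [s] [s'] rfl rfl
      (by simp)
  rw [e]
  simp only [cen_sum]
  refine (Finset.abs_sum_le_sum_abs _ _).trans ((Finset.sum_le_sum fun s _ =>
    (Finset.abs_sum_le_sum_abs _ _).trans (Finset.sum_le_sum fun s' _ => hb s s')).trans ?_)
  simp only [Finset.sum_const, Finset.card_univ, Fintype.card_bool, nsmul_eq_mul]
  calc _ = (32 * n * 4 ^ n) * (q ^ (n + 2) / √(v : ℝ) ^ (n + 4)) := by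
        rw [hτ]; push_cast; ring
    _ ≤ _ := by gcongr; linarith

-- Only words with a ternary letter are left after the subtraction. The bound is uniform in the
-- weight `F`, so it serves both the parent of a binary pair and the symbol at a random position; `1
-- / m₂` supplies two more powers of `√v`.
omit [NeZero v] [NeZero m₂] [NeZero m₃] in
lemma Typical.abs_symFun_sub_le {F : ℕ → ℝ} (hF0 : ∀ k, 0 ≤ F k) (hF : ∀ k, F k ≤ 1)
    (z α : Fin v) :
    1 / (m₂ : ℝ) * ((v : ℝ)⁻¹ * |cen (symFun p₂ R n F (symInd z)) α -
      binaryWeight p₂ n F * cen (binLeaf R 0 n z) α|) ≤ errorScale n v q := by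
  have hv := h.v_pos
  have hs := h.sqrt_pos
  have hq := h.q_pos
  have hm : (0 : ℝ) < m₂ := by simpa [slots] using h.slots_pos true
  have key := abs_cen_symFun_sub_le p₂.2.1 p₂.2.2 R α n hF0 hF (f := symInd z)
    (τ := q ^ n / √(v : ℝ) ^ (n + 2)) (by positivity) fun w hw hf => by
      rw [← row_eq_sum]; exact ht.abs_row_le h α w hw hf z
  rw [← row_eq_sum, row_replicate] at key
  have hminv : 1 / (m₂ : ℝ) ≤ q * (1 / √(v : ℝ) ^ 2) := by
    rw [h.sqrt_sq, mul_one_div, div_le_div_iff₀ hm hv, one_mul]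
    have h1 := h.inv_eta_le
    have h2 := h.bin
    rw [div_le_iff₀ h.eta_pos] at h1
    nlinarith
  rw [errorScale]
  have hq1 : 1 ≤ q := by linarith [h.q_ge_twelve]
  have h24 : (2 : ℝ) ^ n ≤ 4 ^ n := by gcongr; norm_num
  have hn : (0 : ℝ) ≤ n := by positivity
  calc 1 / (m₂ : ℝ) * ((v : ℝ)⁻¹ * |cen (symFun p₂ R n F (symInd z)) α -
      binaryWeight p₂ n F * cen (binLeaf R 0 n z) α|)
      ≤ (q * (1 / √(v : ℝ) ^ 2)) * ((v : ℝ)⁻¹ * (2 ^ n * (q ^ n / √(v : ℝ) ^ (n + 2)))) := by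
        gcongr
        exact key
    _ = (v : ℝ)⁻¹ * (2 ^ n * (q ^ (n + 1) / √(v : ℝ) ^ (n + 4))) := by
        field_simp
        ring
    _ ≤ _ := by
        gcongr
        · nlinarith [pow_pos (show (0 : ℝ) < 4 by norm_num) n]
        · norm_num

end Bounds

/-! ### Stability and separation of unit vectors. -/

section Unit

lemma norm_unit_sub_unit_le {E : Type*} [NormedAddCommGroup E] [NormedSpace ℝ E] {x y : E} {t : ℝ}
    (hx : x ≠ 0) (hy : y ≠ 0) (h : ‖x - y‖ ≤ t * ‖y‖) : ‖‖x‖⁻¹ • x - ‖y‖⁻¹ • y‖ ≤ 2 * t := by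
  have hx0 : 0 < ‖x‖ := norm_pos_iff.2 hx
  have hy0 : 0 < ‖y‖ := norm_pos_iff.2 hy
  have e : ‖x‖⁻¹ • x - ‖y‖⁻¹ • y = ‖y‖⁻¹ • (x - y) + (‖x‖⁻¹ - ‖y‖⁻¹) • x := by
    rw [smul_sub, sub_smul]; abel
  have h1 : ‖‖y‖⁻¹ • (x - y)‖ ≤ t := by
    rw [norm_smul, norm_inv, norm_norm, inv_mul_le_iff₀ hy0, mul_comm]
    exact h
  have h2 : ‖(‖x‖⁻¹ - ‖y‖⁻¹) • x‖ ≤ t := by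
    rw [norm_smul, Real.norm_eq_abs]
    have e2 : ‖x‖⁻¹ - ‖y‖⁻¹ = (‖y‖ - ‖x‖) / ‖y‖ * ‖x‖⁻¹ := by field_simp
    rw [e2, abs_mul, abs_inv, abs_norm, mul_assoc, inv_mul_cancel₀ hx0.ne', mul_one, abs_div,
      abs_norm, div_le_iff₀ hy0]
    refine le_trans ?_ h
    rw [norm_sub_rev]
    exact abs_norm_sub_norm_le y x
  rw [e]
  refine (norm_add_le _ _).trans ?_
  linarith

/-- The cosine is at most `1 / 10`, so the squared distance is at least `9 / 5`. The excess over `1`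
leaves room for replacing the model vectors by the actual slices. -/
lemma le_norm_unit_sub_unit {E : Type*} [NormedAddCommGroup E] [InnerProductSpace ℝ E] {x y : E}
    {D : ℝ} (hD : 0 < D) (hx : 19 / 20 * D ≤ ‖x‖ ^ 2) (hy : 19 / 20 * D ≤ ‖y‖ ^ 2)
    (h : inner ℝ x y ≤ D / 20) : 6 / 5 ≤ ‖‖x‖⁻¹ • x - ‖y‖⁻¹ • y‖ := by
  have hx0 : 0 < ‖x‖ := by
    rcases (norm_nonneg x).eq_or_lt with h0 | h0
    · rw [← h0] at hx; norm_num at hx; linarith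
    · exact h0
  have hy0 : 0 < ‖y‖ := by
    rcases (norm_nonneg y).eq_or_lt with h0 | h0
    · rw [← h0] at hy; norm_num at hy; linarith
    · exact h0
  have hxy : 19 / 20 * D ≤ ‖x‖ * ‖y‖ := by
    refine le_of_sq_le_sq ?_ (by positivity)
    rw [mul_pow ‖x‖, sq (19 / 20 * D)]
    exact mul_le_mul hx hy (by positivity) (by positivity)
  have hin : ‖x‖⁻¹ * (‖y‖⁻¹ * inner ℝ x y) ≤ 1 / 10 := by
    rw [← mul_assoc, ← mul_inv, inv_mul_le_iff₀ (by positivity)]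
    linarith
  have hu : ‖‖x‖⁻¹ • x‖ = 1 := by
    rw [norm_smul, norm_inv, norm_norm, inv_mul_cancel₀ hx0.ne']
  have hw : ‖‖y‖⁻¹ • y‖ = 1 := by
    rw [norm_smul, norm_inv, norm_norm, inv_mul_cancel₀ hy0.ne']
  refine le_of_sq_le_sq ?_ (norm_nonneg _)
  rw [norm_sub_sq_real, hu, hw, real_inner_smul_left, real_inner_smul_right]
  nlinarith

end Unit

section Slices

variable {v : ℕ}

lemma norm_toLp (f : Fin v → ℝ) : ‖WithLp.toLp 2 f‖ = √(nsq f) := by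
  rw [EuclideanSpace.norm_eq]
  simp [nsq]

lemma inner_toLp (f g : Fin v → ℝ) :
    inner ℝ (WithLp.toLp 2 f : EuclideanSpace ℝ (Fin v)) (WithLp.toLp 2 g) = ∑ y, f y * g y := by
  simp [PiLp.inner_apply, mul_comm]

lemma norm_slice_sub_le {T : Fin v → Fin v → Fin v → ℝ} {a b : Fin v} {g : Fin v → ℝ} {κ : ℝ}
    (hκ : 0 ≤ κ) (h : ∀ α, |T a b α - g α| ≤ κ) :
    ‖slice T a b - WithLp.toLp 2 g‖ ≤ √(v : ℝ) * κ := by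
  rw [slice, ← WithLp.toLp_sub, norm_toLp]
  exact sqrt_nsq_le hκ h

lemma norm_slice_le {T : Fin v → Fin v → Fin v → ℝ} {a b : Fin v} {κ : ℝ}
    (hκ : 0 ≤ κ) (h : ∀ α, |T a b α| ≤ κ) : ‖slice T a b‖ ≤ √(v : ℝ) * κ := by
  rw [slice, norm_toLp]
  exact sqrt_nsq_le hκ h

end Slices

/-! ### From typical rules to the recovery statements. -/

section Conclusion

variable {n v m₂ m₃ : ℕ} [NeZero v] [NeZero m₂] [NeZero m₃] {p₂ : unitInterval}
  {ρ η q : ℝ}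

omit [NeZero v] [NeZero m₂] [NeZero m₃] in
lemma init_eq (G : Grammar (n + 1) v m₂ m₃) : Fin.init G = fun i : Fin n => levels G i := by
  ext1 i
  have : (i : ℕ) < n + 1 := by omega
  rw [levels, dif_pos this]; rfl

/-- The tolerance of the quadratic statistics. -/
def quadTol (n : ℕ) : ℝ := 1 / (40 * ((n + 1) * 2 ^ n))

lemma quadTol_pos (n : ℕ) : 0 < quadTol n := by unfold quadTol; positivity

/-- The tolerance is chosen to keep the inner-product error accumulated over `n` levels below `1 /
40`. -/
lemma quadTol_mul_le (n : ℕ) : quadTol n * (n * 2 ^ n) ≤ 1 / 40 := by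
  unfold quadTol
  rw [one_div_mul_eq_div, div_le_div_iff₀ (by positivity) (by norm_num)]
  nlinarith [pow_pos (show (0 : ℝ) < 2 by norm_num) n]

lemma one_sub_quadTol_pow (n : ℕ) : 39 / 40 ≤ (1 - quadTol n) ^ n := by
  have h1 := quadTol_mul_le n
  have h0 := quadTol_pos n
  have h2 : (1 : ℝ) ≤ 2 ^ n := one_le_pow₀ (by norm_num)
  have hn : (0 : ℝ) ≤ n := by positivity
  have h3 : n * quadTol n ≤ 1 / 40 := by
    refine le_trans ?_ h1
    rw [mul_comm]
    gcongr
    exact le_mul_of_one_le_right hn h2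
  have hle : quadTol n ≤ 1 := by
    unfold quadTol
    rw [div_le_one (by positivity)]
    nlinarith
  have := one_add_mul_le_pow (show (-2 : ℝ) ≤ -quadTol n by linarith) n
  rw [← sub_eq_add_neg] at this
  linarith

lemma quadTol_le_one (n : ℕ) : quadTol n ≤ 1 := by
  have h2 : (1 : ℝ) ≤ 2 ^ n := one_le_pow₀ (by norm_num)
  have hn : (0 : ℝ) ≤ n := by positivity
  unfold quadTol
  rw [div_le_one (by positivity)]
  nlinarith

-- The errors `1 / v ≤ 1 / 40` and `1 / 40` from the tolerance add up to `1 / 20`, and `(39 / 40) ^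
-- 2 ≥ 19 / 20`.
omit [NeZero v] [NeZero m₂] [NeZero m₃] in
lemma Typical.binLeaf_geometry {R : ℕ → Rules v m₂ m₃} (ht : Typical ρ (quadTol n) n R)
    (hv : 40 ≤ v) :
    (∀ z, 19 / 20 * (2 / m₂ : ℝ) ^ n ≤ nsq (cen (binLeaf R 0 n z))) ∧
      ∀ z z', z ≠ z' → |∑ y, cen (binLeaf R 0 n z) y * cen (binLeaf R 0 n z') y| ≤
        (2 / m₂ : ℝ) ^ n / 20 := by
  have hv' : (40 : ℝ) ≤ v := by exact_mod_cast hv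
  have hinv : 1 / (v : ℝ) ≤ 1 / 40 := one_div_le_one_div_of_le (by norm_num) hv'
  have hD : (0 : ℝ) ≤ (2 / m₂ : ℝ) ^ n := by positivity
  have h0 := (quadTol_pos n).le
  have h1 := quadTol_le_one n
  constructor
  · intro z
    refine le_trans ?_ (ht.nsq_binLeaf h0 h1 n 0 (zero_add n) z).1
    rw [mul_comm]
    refine mul_le_mul_of_nonneg_left ?_ hD
    nlinarith [one_sub_quadTol_pow n]
  · intro z z' hz
    refine (ht.abs_sum_binLeaf_le h0 h1 n 0 (zero_add n) hz).trans ?_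
    rw [div_eq_mul_inv (_ ^ n)]
    refine mul_le_mul_of_nonneg_left ?_ hD
    linarith [quadTol_mul_le n]

/-- The direction of the slices at the pairs of binary siblings of `z`. -/
def mainSlice (p₂ : unitInterval) (G : Grammar (n + 1) v m₂ m₃) (z : Fin v) (α : Fin v) : ℝ :=
  1 / (m₂ : ℝ) * ((v : ℝ)⁻¹ * (binaryWeight p₂ n (liftOne p₂ true pairWeight) *
    cen (binLeaf (levels G) 0 n z) α))

variable (h : Scales v m₂ m₃ ρ η q) {G : Grammar (n + 1) v m₂ m₃}
  (ht : Typical ρ (quadTol n) n (levels G))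
include h ht

lemma Typical.abs_binaryTerm_sub_le {z a b : Fin v} (hz : IsBinaryRule G z a b) (α : Fin v) :
    |binaryTerm p₂ G (parentCov p₂ G) a b α - mainSlice p₂ G z α| ≤ errorScale n v q := by
  refine le_trans (le_of_eq ?_) (ht.abs_symFun_sub_le h (p₂ := p₂)
    (liftOne_nonneg p₂.2.1 p₂.2.2 pairWeight_nonneg true)
    (liftOne_le_one p₂.2.1 p₂.2.2 pairWeight_nonneg pairWeight_le_one true) z α)
  have hm : (0 : ℝ) ≤ 1 / (m₂ : ℝ) := by positivity
  have hv : (0 : ℝ) ≤ (v : ℝ)⁻¹ := by positivity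
  have e := typeProb_mul_parentCov p₂ (levels G) (n := n) z α
  rw [levels_eq] at e
  rw [binaryTerm, binaryRuleProb_unique G hz fun y => parentCov p₂ G y α, mul_left_comm, e, mainSlice, ← mul_sub, ← mul_sub,
    abs_mul, abs_mul, abs_of_nonneg hm, abs_of_nonneg hv]

lemma Typical.abs_binaryTerm_symbolCov_sub_le (hp₀ : (0 : ℝ) < p₂) (hp₁ : (p₂ : ℝ) < 1)
    {z a b : Fin v} (hz : IsBinaryRule G z a b) (α : Fin v) :
    |covRatio p₂ n * binaryTerm p₂ G (symbolCov p₂ (Fin.init G)) a b α - mainSlice p₂ G z α| ≤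
      binaryWeight p₂ n (liftOne p₂ true pairWeight) / binaryWeight p₂ n posWeight *
        errorScale n v q := by
  have hpos := fun k (_ : 1 ≤ k) => liftOne_pos hp₀ hp₁ (F := pairWeight)
    (fun k hk => pairWeight_pos hk) true k
  have hw := binaryWeight_pos hp₀ hp₁ n hpos
  have hc := symConst_pos hp₀ hp₁ n hpos
  have hw' := binaryWeight_pos hp₀ hp₁ n fun k hk => posWeight_pos hk
  have key := ht.abs_symFun_sub_le h (p₂ := p₂) posWeight_nonneg posWeight_le_one z α
  have hm : (0 : ℝ) ≤ 1 / (m₂ : ℝ) := by positivity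
  have hv : (0 : ℝ) ≤ (v : ℝ)⁻¹ := by positivity
  have e := typeProb_bin p₂ (levels G) (n := n)
  rw [levels_eq] at e
  rw [binaryTerm, binaryRuleProb_unique G hz fun y => symbolCov p₂ (Fin.init G) y α, init_eq, symbolCov_eq, e, covRatio, mainSlice]
  set W := binaryWeight p₂ n (liftOne p₂ true pairWeight)
  set W' := binaryWeight p₂ n posWeight
  set c := symConst p₂ n (liftOne p₂ true pairWeight)
  set A := cen (symFun p₂ (levels G) n posWeight (symInd z)) α
  set B := cen (binLeaf (levels G) 0 n z) α
  -- Here `c` is the probability of a binary pair; the ratio replaces the weight `W'` of the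
  -- all-binary word for a random position by the weight `W` for the parent of a binary pair.
  have e2 : W / (c * W') * (c * (1 / (m₂ : ℝ) * ((v : ℝ)⁻¹ * A))) -
      1 / (m₂ : ℝ) * ((v : ℝ)⁻¹ * (W * B)) =
      W / W' * (1 / (m₂ : ℝ) * ((v : ℝ)⁻¹ * (A - W' * B))) := by
    field_simp
  rw [e2, abs_mul, abs_mul, abs_mul, abs_of_nonneg hm, abs_of_nonneg hv,
    abs_of_pos (div_pos hw hw')]
  gcongr

/-- For a typical grammar and a large vocabulary the root-to-pair covariance reveals the binary
rules of the last level. -/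
theorem Typical.conclusion (hp₀ : (0 : ℝ) < p₂) (hp₁ : (p₂ : ℝ) < 1) {t ε : ℝ} (ht0 : 0 < t)
    (ht1 : 200 * t ≤ 1) (htε : 40 * t ≤ ε) (hv : 40 ≤ v)
    (hsmall : ∀ z, √(v : ℝ) * errorScale n v q ≤ t * √(nsq (mainSlice p₂ G z)))
    (hsmall' : ∀ z, √(v : ℝ) * (binaryWeight p₂ n (liftOne p₂ true pairWeight) /
      binaryWeight p₂ n posWeight * errorScale n v q) ≤ t * √(nsq (mainSlice p₂ G z))) :
    LowerOrder ε p₂ G (typeContribution p₂ G .ter) ∧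
    LowerOrder ε p₂ G (typeContribution p₂ G .cross) ∧
    LowerOrder ε p₂ G (fun a b α =>
      pairCov p₂ G a b α - binaryTerm p₂ G (parentCov p₂ G) a b α) ∧
    LowerOrder ε p₂ G (fun a b α =>
      pairCov p₂ G a b α - covRatio p₂ n * binaryTerm p₂ G (symbolCov p₂ (Fin.init G)) a b α) ∧
    (∀ z a b : Fin v, IsBinaryRule G z a b →
      slice (binaryTerm p₂ G (parentCov p₂ G)) a b ≠ 0 ∧ slice (pairCov p₂ G) a b ≠ 0) ∧
    (∀ z a b z' a' b' : Fin v, IsBinaryRule G z a b → IsBinaryRule G z' a' b' →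
      (z = z' → ‖unitSlice (pairCov p₂ G) a b - unitSlice (pairCov p₂ G) a' b'‖ ≤ ε) ∧
      (z ≠ z' → 1 ≤ ‖unitSlice (pairCov p₂ G) a b - unitSlice (pairCov p₂ G) a' b'‖)) ∧
    (∀ z a b a' b' : Fin v, (∀ y, ¬ IsBinaryRule G y a b) → IsBinaryRule G z a' b' →
      ‖slice (pairCov p₂ G) a b‖ ≤ ε * ‖slice (pairCov p₂ G) a' b'‖) := by
  have hs := h.sqrt_pos
  have hv0 := h.v_pos
  have hq := h.q_pos
  set X := errorScale n v q with hX
  have hX0 : 0 ≤ X := by rw [hX, errorScale]; positivity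
  set X' := binaryWeight p₂ n (liftOne p₂ true pairWeight) / binaryWeight p₂ n posWeight * X
  have hW := binaryWeight_pos hp₀ hp₁ n fun k (_ : 1 ≤ k) => liftOne_pos hp₀ hp₁ (F := pairWeight)
    (fun k hk => pairWeight_pos hk) true k
  have hW' := binaryWeight_pos hp₀ hp₁ n fun k hk => posWeight_pos hk
  have hX'0 : 0 ≤ X' := by positivity
  have hm : (0 : ℝ) < m₂ := by simpa [slots] using h.slots_pos true
  have hter : ∀ a b α, |typeContribution p₂ G .ter a b α| ≤ X := fun a b α => by
    have := ht.abs_ter_contribution_le h (p₂ := p₂) a b α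
    rwa [levels_eq] at this
  have hcross : ∀ a b α, |typeContribution p₂ G .cross a b α| ≤ X := fun a b α => by
    have := ht.abs_cross_contribution_le h (p₂ := p₂) a b α
    rwa [levels_eq] at this
  have hdec := pairCov_decomposition p₂ G
  have hB := fun z a b (hz : IsBinaryRule G z a b) α => ht.abs_binaryTerm_sub_le h (p₂ := p₂) hz α
  have hB' := fun z a b (hz : IsBinaryRule G z a b) α =>
    ht.abs_binaryTerm_symbolCov_sub_le h hp₀ hp₁ hz α
  have hB0 : ∀ a b, (∀ y, ¬ IsBinaryRule G y a b) → ∀ C α, binaryTerm p₂ G C a b α = 0 :=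
    fun a b hab C α => by rw [binaryTerm, binaryRuleProb_sum_eq_zero G hab, mul_zero]
  set Y : Fin v → EuclideanSpace ℝ (Fin v) := fun z => WithLp.toLp 2 (mainSlice p₂ G z) with hY
  have hYn : ∀ z, ‖Y z‖ = √(nsq (mainSlice p₂ G z)) := fun z => norm_toLp _
  obtain ⟨hg1, hg2⟩ := ht.binLeaf_geometry hv
  set k := 1 / (m₂ : ℝ) * ((v : ℝ)⁻¹ * binaryWeight p₂ n (liftOne p₂ true pairWeight)) with hk
  have hk0 : 0 < k := by positivity
  have hmain : ∀ z, mainSlice p₂ G z = fun α => k * cen (binLeaf (levels G) 0 n z) α := fun z => by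
    ext α; rw [mainSlice, hk]; ring
  set D := k ^ 2 * (2 / m₂ : ℝ) ^ n with hD
  have hD0 : 0 < D := by positivity
  have hY1 : ∀ z, 19 / 20 * D ≤ ‖Y z‖ ^ 2 := fun z => by
    rw [hYn, Real.sq_sqrt (nsq_nonneg _), hmain, nsq_mul, hD]
    have := mul_le_mul_of_nonneg_left (hg1 z) (sq_nonneg k)
    linarith
  have hY2 : ∀ z z', z ≠ z' → inner ℝ (Y z) (Y z') ≤ D / 20 := fun z z' hz => by
    simp only [hY]
    rw [inner_toLp, hmain, hmain, hD]
    have := mul_le_mul_of_nonneg_left ((le_abs_self _).trans (hg2 z z' hz)) (sq_nonneg k)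
    rw [Finset.mul_sum] at this
    calc _ = ∑ y, k ^ 2 * (cen (binLeaf (levels G) 0 n z) y * cen (binLeaf (levels G) 0 n z') y) :=
          Finset.sum_congr rfl fun y _ => by ring
      _ ≤ _ := this
      _ = _ := by ring
  have hYpos : ∀ z, 0 < ‖Y z‖ := fun z => by
    rcases (norm_nonneg (Y z)).eq_or_lt with h0 | h0
    · have := hY1 z
      rw [← h0] at this; norm_num at this; linarith
    · exact h0
  have hs1 : ∀ z, √(v : ℝ) * X ≤ t * ‖Y z‖ := fun z => by rw [hYn]; exact hsmall z
  have hs2 : ∀ z, √(v : ℝ) * X' ≤ t * ‖Y z‖ := fun z => by rw [hYn]; exact hsmall' z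
  have hBn : ∀ z a b, IsBinaryRule G z a b →
      ‖slice (binaryTerm p₂ G (parentCov p₂ G)) a b - Y z‖ ≤ t * ‖Y z‖ := fun z a b hz =>
    (norm_slice_sub_le hX0 (hB z a b hz)).trans (hs1 z)
  have hCn : ∀ z a b, IsBinaryRule G z a b →
      ‖slice (pairCov p₂ G) a b - Y z‖ ≤ 3 * t * ‖Y z‖ := fun z a b hz => by
    refine (norm_slice_sub_le (κ := 3 * X) (by positivity) fun α => ?_).trans ?_
    · rw [hdec]
      have h1 := abs_le.1 (hB z a b hz α)
      have h2 := abs_le.1 (hter a b α)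
      have h3 := abs_le.1 (hcross a b α)
      rw [abs_le]; constructor <;> linarith
    · have := hs1 z
      nlinarith
  have hlow : ∀ {x : EuclideanSpace ℝ (Fin v)} {z : Fin v} {r : ℝ}, ‖x - Y z‖ ≤ r * ‖Y z‖ →
      (1 - r) * ‖Y z‖ ≤ ‖x‖ := fun {x z r} hx => by
    have := norm_sub_norm_le (Y z) x
    rw [norm_sub_rev] at this
    linarith
  have hBlow := fun z a b hz => hlow (hBn z a b hz)
  have hClow := fun z a b hz => hlow (hCn z a b hz)
  -- One generous bound covers all four tensors; the last one collects at most `3 * X + X'`.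
  have hlower : ∀ T : Fin v → Fin v → Fin v → ℝ, (∀ a b α, |T a b α| ≤ 4 * X + 2 * X') →
      LowerOrder ε p₂ G T := by
    intro T hT a b α z a' b' hz
    refine (hT a b α).trans ?_
    rw [← mul_div_assoc, le_div_iff₀ hs]
    have h1 := hs1 z
    have h2 := hs2 z
    have h3 := hBlow z a' b' hz
    have h4 : 40 * t * ((1 - t) * ‖Y z‖) ≤ ε * ‖slice (binaryTerm p₂ G (parentCov p₂ G)) a' b'‖ :=
      mul_le_mul htε h3 (mul_nonneg (by linarith) (norm_nonneg _)) (by linarith)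
    have h5 : 6 * (t * ‖Y z‖) ≤ 40 * t * ((1 - t) * ‖Y z‖) := by
      have : 0 ≤ t * ‖Y z‖ := by positivity
      nlinarith
    nlinarith
  refine ⟨hlower _ fun a b α => (hter a b α).trans (by linarith),
    hlower _ fun a b α => (hcross a b α).trans (by linarith),
    hlower _ fun a b α => ?_, hlower _ fun a b α => ?_, fun z a b hz => ⟨?_, ?_⟩,
    fun z a b z' a' b' hz hz' => ?_, fun z a b a' b' hab hz => ?_⟩
  · have h2 := abs_le.1 (hter a b α)
    have h3 := abs_le.1 (hcross a b α)
    rw [hdec, abs_le]; constructor <;> linarith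
  · have h2 := abs_le.1 (hter a b α)
    have h3 := abs_le.1 (hcross a b α)
    rw [hdec]
    by_cases hab : ∃ z, IsBinaryRule G z a b
    · obtain ⟨z, hz⟩ := hab
      have h4 := abs_le.1 (hB z a b hz α)
      have h5 := abs_le.1 (hB' z a b hz α)
      rw [abs_le]; constructor <;> linarith
    · rw [hB0 a b (not_exists.1 hab), hB0 a b (not_exists.1 hab), abs_le]
      constructor <;> linarith
  · intro h0
    have := hBlow z a b hz
    rw [h0, norm_zero] at this
    nlinarith [hYpos z]
  · intro h0
    have := hClow z a b hz
    rw [h0, norm_zero] at this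
    nlinarith [hYpos z]
  · have hne : ∀ z a b, IsBinaryRule G z a b → slice (pairCov p₂ G) a b ≠ 0 := by
      intro z a b hz h0
      have := hClow z a b hz
      rw [h0, norm_zero] at this
      nlinarith [hYpos z]
    have hYne : ∀ z, Y z ≠ 0 := fun z => norm_pos_iff.1 (hYpos z)
    -- Each direction is within `6 * t` of the model direction. For one symbol this gives `12 * t ≤
    -- ε`; for two symbols `6 / 5 - 12 * t ≥ 1`.
    have u1 := norm_unit_sub_unit_le (hne z a b hz) (hYne z) (hCn z a b hz)
    have u2 := norm_unit_sub_unit_le (hne z' a' b' hz') (hYne z') (hCn z' a' b' hz')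
    have hU : ∀ a b, unitSlice (pairCov p₂ G) a b =
      ‖slice (pairCov p₂ G) a b‖⁻¹ • slice (pairCov p₂ G) a b := fun _ _ => rfl
    rw [← hU] at u1 u2
    constructor
    · rintro rfl
      have := norm_sub_le_norm_sub_add_norm_sub (unitSlice (pairCov p₂ G) a b) (‖Y z‖⁻¹ • Y z)
        (unitSlice (pairCov p₂ G) a' b')
      rw [norm_sub_rev (‖Y z‖⁻¹ • Y z)] at this
      linarith
    · intro hzz
      have u3 := le_norm_unit_sub_unit hD0 (hY1 z) (hY1 z') (hY2 z z' hzz)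
      have t1 := norm_sub_le_norm_sub_add_norm_sub (‖Y z‖⁻¹ • Y z) (unitSlice (pairCov p₂ G) a b)
        (‖Y z'‖⁻¹ • Y z')
      have t2 := norm_sub_le_norm_sub_add_norm_sub (unitSlice (pairCov p₂ G) a b)
        (unitSlice (pairCov p₂ G) a' b') (‖Y z'‖⁻¹ • Y z')
      rw [norm_sub_rev (‖Y z‖⁻¹ • Y z) (unitSlice (pairCov p₂ G) a b)] at t1
      linarith
  · have h1 : ‖slice (pairCov p₂ G) a b‖ ≤ √(v : ℝ) * (2 * X) := by
      refine norm_slice_le (by positivity) fun α => ?_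
      have h2 := abs_le.1 (hter a b α)
      have h3 := abs_le.1 (hcross a b α)
      rw [hdec, hB0 a b hab, abs_le]; constructor <;> linarith
    have h2 := hs1 z
    have h3 := hClow z a' b' hz
    have h4 : 40 * t * ((1 - 3 * t) * ‖Y z‖) ≤ ε * ‖slice (pairCov p₂ G) a' b'‖ :=
      mul_le_mul htε h3 (mul_nonneg (by linarith) (norm_nonneg _)) (by linarith)
    have h5 : 2 * (t * ‖Y z‖) ≤ 40 * t * ((1 - 3 * t) * ‖Y z‖) := by
      have : 0 ≤ t * ‖Y z‖ := by positivity
      nlinarith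
    linarith

end Conclusion

/-! ### The limit of a large vocabulary. -/

section Limit

lemma Sizes.scales {v m₂ m₃ : ℕ} {η ρ : ℝ} (h : Sizes η v m₂ m₃) (hv : 1 ≤ v) (hη0 : 0 < η)
    (hη1 : η ≤ 1) (hρ : 1 ≤ ρ) : Scales v m₂ m₃ ρ η (12 / η * ρ) where
  one_le_v := hv
  rho := hρ
  eta_pos := hη0
  eta_le := hη1
  bin := h.bin
  ter := h.ter
  q_ge := by
    have : η * (12 / η * ρ) = 12 * ρ := by field_simp
    rw [this]

/-- The error is smaller than the norm of the leading slice by `q ^ (n + 2) / √v` up to constants,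
which is exactly what `hc` makes small. Here `m₂ ≤ v` bounds the leading slice from below. -/
lemma Typical.sqrt_mul_errorScale_le {n v m₂ m₃ : ℕ} [NeZero v] [NeZero m₂] [NeZero m₃]
    {p₂ : unitInterval} {ρ η q t c : ℝ} (h : Scales v m₂ m₃ ρ η q)
    {G : Grammar (n + 1) v m₂ m₃} (ht : Typical ρ (quadTol n) n (levels G))
    (hp₀ : (0 : ℝ) < p₂) (hp₁ : (p₂ : ℝ) < 1) (hv : 40 ≤ v) (hm : m₂ ≤ v) (ht0 : 0 < t)
    (hc : 2 * c * (32 * (n + 1) * 4 ^ n) * q ^ (n + 2) ≤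
      t * binaryWeight p₂ n (liftOne p₂ true pairWeight) * √(v : ℝ)) (z : Fin v) :
    √(v : ℝ) * (c * errorScale n v q) ≤ t * √(nsq (mainSlice p₂ G z)) := by
  have hs := h.sqrt_pos
  have hv0 := h.v_pos
  have hm0 : (0 : ℝ) < m₂ := by simpa [slots] using h.slots_pos true
  have hm' : (m₂ : ℝ) ≤ v := by exact_mod_cast hm
  have hW := binaryWeight_pos hp₀ hp₁ n fun k (_ : 1 ≤ k) => liftOne_pos hp₀ hp₁ (F := pairWeight)
    (fun k hk => pairWeight_pos hk) true k
  set W := binaryWeight p₂ n (liftOne p₂ true pairWeight)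
  have hlow : 1 / √(v : ℝ) ^ 2 * ((v : ℝ)⁻¹ * W) * (1 / (2 * √(v : ℝ) ^ n)) ≤
      √(nsq (mainSlice p₂ G z)) := by
    have e : mainSlice p₂ G z =
        fun α => (1 / (m₂ : ℝ) * ((v : ℝ)⁻¹ * W)) * cen (binLeaf (levels G) 0 n z) α := by
      ext α; rw [mainSlice]; ring
    rw [e, nsq_mul, Real.sqrt_mul (sq_nonneg _), Real.sqrt_sq (by positivity), h.sqrt_sq]
    gcongr
    refine Real.le_sqrt_of_sq_le ?_
    have h1 := (ht.binLeaf_geometry hv).1 z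
    have h2 : (1 / (v : ℝ)) ^ n ≤ (2 / m₂ : ℝ) ^ n := by
      gcongr
      norm_num
    have h3 : (1 / (2 * √(v : ℝ) ^ n)) ^ 2 = 1 / 4 * (1 / (v : ℝ)) ^ n := by
      rw [one_div_pow, mul_pow, ← pow_mul, mul_comm n, pow_mul, h.sqrt_sq, one_div_pow]
      field_simp
      norm_num
    rw [h3]
    calc 1 / 4 * (1 / (v : ℝ)) ^ n ≤ 19 / 20 * (2 / m₂ : ℝ) ^ n :=
          mul_le_mul (by norm_num) h2 (by positivity) (by norm_num)
      _ ≤ _ := h1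
  refine le_trans ?_ (mul_le_mul_of_nonneg_left hlow ht0.le)
  have e1 : √(v : ℝ) * (c * errorScale n v q) =
      (2 * c * (32 * (n + 1) * 4 ^ n) * q ^ (n + 2)) *
        ((v : ℝ)⁻¹ * (1 / (2 * √(v : ℝ) ^ (n + 3)))) := by
    rw [errorScale]; field_simp; ring
  have e2 : t * (1 / √(v : ℝ) ^ 2 * ((v : ℝ)⁻¹ * W) * (1 / (2 * √(v : ℝ) ^ n))) =
      (t * W * √(v : ℝ)) * ((v : ℝ)⁻¹ * (1 / (2 * √(v : ℝ) ^ (n + 3)))) := by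
    field_simp
    ring
  rw [e1, e2]
  gcongr

lemma eventually_sizes {f₂ f₃ η : ℝ} (h2 : η < f₂) (h2' : η < 1 - f₂) (h3 : η < f₃)
    (h3' : η < 1 - f₃) {v m₂ m₃ : ℕ → ℕ} (hv : Tendsto v atTop atTop)
    (hm₂ : Tendsto (fun k => (m₂ k : ℝ) / (v k : ℝ)) atTop (𝓝 f₂))
    (hm₃ : Tendsto (fun k => (m₃ k : ℝ) / (v k : ℝ) ^ 2) atTop (𝓝 f₃)) :
    ∀ᶠ k in atTop, Sizes η (v k) (m₂ k) (m₃ k) := by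
  filter_upwards [hv.eventually_ge_atTop 1, hm₂.eventually_const_le h2,
    hm₂.eventually_le_const (show f₂ < 1 - η by linarith), hm₃.eventually_const_le h3,
    hm₃.eventually_le_const (show f₃ < 1 - η by linarith)] with k hk a1 a2 a3 a4
  have hv0 : (0 : ℝ) < v k := by exact_mod_cast hk
  rw [le_div_iff₀ (by positivity)] at a1 a3
  rw [div_le_iff₀ (by positivity)] at a2 a4
  refine ⟨a1, a3, ?_, ?_⟩
  · nlinarith
  · nlinarith

/-- Without any grammar the counting probability would be `0 / 0 = 0`, and passing to complements
would fail. -/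
lemma grammar_nonempty {n v m₂ m₃ : ℕ} {η : ℝ} (hη : 0 < η) (h : Sizes η v m₂ m₃) (hv : 1 ≤ v) :
    Nonempty (Grammar (n + 1) v m₂ m₃) := by
  have hv0 : (0 : ℝ) < v := by exact_mod_cast hv
  have h1 : v * m₂ ≤ v ^ 2 := by
    have : (v * m₂ : ℝ) ≤ (v : ℝ) ^ 2 := by
      have := h.bin_le
      have : 0 < η * (v : ℝ) ^ 2 := by positivity
      linarith
    exact_mod_cast this
  have h2 : v * m₃ ≤ v ^ 3 := by
    have : (v * m₃ : ℝ) ≤ (v : ℝ) ^ 3 := by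
      have := h.ter_le
      have : 0 < η * (v : ℝ) ^ 3 := by positivity
      linarith
    exact_mod_cast this
  obtain ⟨φ⟩ := Function.Embedding.nonempty_of_card_le
    (α := Fin v × Fin m₂) (β := Fin v × Fin v) (by simpa [sq] using h1)
  obtain ⟨φ'⟩ := Function.Embedding.nonempty_of_card_le
    (α := Fin v × Fin m₃) (β := Fin v × Fin v × Fin v) (by
      simp only [Fintype.card_prod, Fintype.card_fin]
      calc v * m₃ ≤ v ^ 3 := h2
        _ = v * (v * v) := by ring)
  exact ⟨fun _ => (φ, φ')⟩

lemma grammarProb_eq_frac {L v m₂ m₃ : ℕ} (S : Set (Grammar L v m₂ m₃)) :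
    grammarProb S = frac (fun G => G ∈ S) := by
  classical
  rw [grammarProb, frac, Nat.card_eq_fintype_card, Nat.card_eq_fintype_card, Fintype.card_subtype]

/-- For a large vocabulary almost all grammars are typical, and the negligible terms are small. -/
lemma eventually_frac_typical (n : ℕ) (p₂ : unitInterval) (hp₀ : (0 : ℝ) < p₂)
    (hp₁ : (p₂ : ℝ) < 1) {η ε : ℝ} (hη0 : 0 < η) (hε : 0 < ε) :
    ∃ K t δ : ℝ, 0 < t ∧ 200 * t ≤ 1 ∧ 40 * t ≤ ε ∧ 0 < δ ∧ ∀ᶠ v : ℕ in atTop, 40 ≤ v ∧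
      1 ≤ (v : ℝ) ^ δ ∧
      (∀ (m₂ m₃ : ℕ) [NeZero m₂] [NeZero m₃], Sizes η v m₂ m₃ →
        frac (fun G : Grammar (n + 1) v m₂ m₃ =>
          ¬ Typical ((v : ℝ) ^ δ) (quadTol n) n (levels G)) ≤ K / (v : ℝ) ^ 3) ∧
      ∀ c ∈ ({1, binaryWeight p₂ n (liftOne p₂ true pairWeight) / binaryWeight p₂ n posWeight} :
          Set ℝ), 2 * c * (32 * (n + 1) * 4 ^ n) * (12 / η * (v : ℝ) ^ δ) ^ (n + 2) ≤
        t * binaryWeight p₂ n (liftOne p₂ true pairWeight) * √(v : ℝ) := by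
  have hW := binaryWeight_pos hp₀ hp₁ n fun k (_ : 1 ≤ k) => liftOne_pos hp₀ hp₁ (F := pairWeight)
    (fun k hk => pairWeight_pos hk) true k
  set W := binaryWeight p₂ n (liftOne p₂ true pairWeight)
  -- This makes `(v ^ δ) ^ (n + 2) = v ^ (1 / 4)`, which is beaten by `√v`.
  set δ : ℝ := 1 / (4 * (n + 2)) with hδ
  have hδ0 : 0 < δ := by positivity
  obtain ⟨K, hK⟩ := typical_whp n hη0 hδ0 (quadTol_pos n)
  set t := min (ε / 40) (1 / 200) with ht
  have ht0 : 0 < t := lt_min (by positivity) (by norm_num)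
  have h4 : (0 : ℝ) < 1 / 4 := by norm_num
  have hbig : ∀ c : ℝ, ∀ᶠ v : ℕ in atTop,
      2 * c * (32 * (n + 1) * 4 ^ n) * (12 / η * (v : ℝ) ^ δ) ^ (n + 2) ≤ t * W * √(v : ℝ) := by
    intro c
    filter_upwards [eventually_const_le_rpow h4
      (2 * c * (32 * (n + 1) * 4 ^ n) * (12 / η) ^ (n + 2) / (t * W)), eventually_ge_atTop 1]
      with v hv hv1
    have hv0 : (0 : ℝ) < v := by exact_mod_cast hv1
    rw [div_le_iff₀ (by positivity)] at hv
    have e1 : ((v : ℝ) ^ δ) ^ (n + 2) = (v : ℝ) ^ (1 / 4 : ℝ) := by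
      rw [← Real.rpow_natCast, ← Real.rpow_mul hv0.le]
      congr 1
      rw [hδ]; push_cast; field_simp
    have e2 : √(v : ℝ) = (v : ℝ) ^ (1 / 4 : ℝ) * (v : ℝ) ^ (1 / 4 : ℝ) := by
      rw [← Real.rpow_add hv0, Real.sqrt_eq_rpow]; norm_num
    have hV : 0 ≤ (v : ℝ) ^ (1 / 4 : ℝ) := by positivity
    rw [mul_pow, e1, e2]
    calc _ = 2 * c * (32 * (n + 1) * 4 ^ n) * (12 / η) ^ (n + 2) * (v : ℝ) ^ (1 / 4 : ℝ) := by ring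
      _ ≤ (v : ℝ) ^ (1 / 4 : ℝ) * (t * W) * (v : ℝ) ^ (1 / 4 : ℝ) := by gcongr
      _ = _ := by ring
  refine ⟨K, t, δ, ht0, ?_, ?_, hδ0, ?_⟩
  · have := min_le_right (ε / 40) (1 / 200); linarith
  · have := min_le_left (ε / 40) (1 / 200); linarith
  · filter_upwards [eventually_ge_atTop 40, eventually_const_le_rpow hδ0 1, hK, hbig 1,
      hbig (W / binaryWeight p₂ n posWeight)] with v a1 a2 a3 a4 a5
    refine ⟨a1, a2, a3, ?_⟩
    rintro c (rfl | rfl)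
    · exact a4
    · exact a5

end Limit

end RHM

end

theorem mainTheorem3 (n : ℕ) (p₂ : unitInterval) (hp₀ : (0 : ℝ) < p₂) (hp₁ : (p₂ : ℝ) < 1) :
    -- the exact decomposition by local topology, for every grammar of depth `L = n + 1`
    (∀ (v m₂ m₃ : ℕ) [NeZero v] [NeZero m₂] [NeZero m₃] (G : RHM.Grammar (n + 1) v m₂ m₃)
        (a b α : Fin v),
      RHM.pairCov p₂ G a b α =
        RHM.binaryTerm p₂ G (RHM.parentCov p₂ G) a b α
          + RHM.typeContribution p₂ G RHM.PairType.ter a b α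
          + RHM.typeContribution p₂ G RHM.PairType.cross a b α) ∧
    ∃ κ : ℝ, 0 < κ ∧
      ∀ (f₂ f₃ : ℝ), 0 < f₂ → f₂ < 1 → 0 < f₃ → f₃ < 1 →
      ∀ (v m₂ m₃ : ℕ → ℕ) [∀ k, NeZero (v k)] [∀ k, NeZero (m₂ k)] [∀ k, NeZero (m₃ k)],
      Tendsto v atTop atTop →
      Tendsto (fun k => (m₂ k : ℝ) / (v k : ℝ)) atTop (𝓝 f₂) →
      Tendsto (fun k => (m₃ k : ℝ) / (v k : ℝ) ^ 2) atTop (𝓝 f₃) →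
      ∀ ε : ℝ, 0 < ε →
      Tendsto (fun k => RHM.grammarProb {G : RHM.Grammar (n + 1) (v k) (m₂ k) (m₃ k) |
        -- the ternary-sibling and the cross-boundary contributions are of lower order
        RHM.LowerOrder ε p₂ G (RHM.typeContribution p₂ G RHM.PairType.ter) ∧
        RHM.LowerOrder ε p₂ G (RHM.typeContribution p₂ G RHM.PairType.cross) ∧
        -- the covariance is asymptotically the binary term
        RHM.LowerOrder ε p₂ G (fun a b α =>
          RHM.pairCov p₂ G a b α - RHM.binaryTerm p₂ G (RHM.parentCov p₂ G) a b α) ∧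
        -- the same with the covariance at a uniformly random position of level `L - 1`
        RHM.LowerOrder ε p₂ G (fun a b α =>
          RHM.pairCov p₂ G a b α
            - κ * RHM.binaryTerm p₂ G (RHM.symbolCov p₂ (Fin.init G)) a b α) ∧
        -- slices at pairs of binary siblings do not vanish and cluster by the generating symbol
        (∀ z a b : Fin (v k), RHM.IsBinaryRule G z a b →
          RHM.slice (RHM.binaryTerm p₂ G (RHM.parentCov p₂ G)) a b ≠ 0 ∧
          RHM.slice (RHM.pairCov p₂ G) a b ≠ 0) ∧
        (∀ z a b z' a' b' : Fin (v k), RHM.IsBinaryRule G z a b → RHM.IsBinaryRule G z' a' b' →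
          (z = z' → ‖RHM.unitSlice (RHM.pairCov p₂ G) a b
            - RHM.unitSlice (RHM.pairCov p₂ G) a' b'‖ ≤ ε) ∧
          (z ≠ z' → 1 ≤ ‖RHM.unitSlice (RHM.pairCov p₂ G) a b
            - RHM.unitSlice (RHM.pairCov p₂ G) a' b'‖)) ∧
        -- slices at all other pairs are negligible
        (∀ z a b a' b' : Fin (v k), (∀ y, ¬ RHM.IsBinaryRule G y a b) →
          RHM.IsBinaryRule G z a' b' →
          ‖RHM.slice (RHM.pairCov p₂ G) a b‖ ≤ ε * ‖RHM.slice (RHM.pairCov p₂ G) a' b'‖)})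
        atTop (𝓝 1) := by
  refine ⟨fun v m₂ m₃ _ _ _ G a b α => RHM.pairCov_decomposition p₂ G a b α,
    RHM.covRatio p₂ n, RHM.covRatio_pos hp₀ hp₁ n, ?_⟩
  intro f₂ f₃ hf₂ hf₂' hf₃ hf₃' v m₂ m₃ _ _ _ hv hm₂ hm₃ ε hε
  -- The rule densities must stay away from `0`, so that averaging is effective, and from `1`, so
  -- that a positive fraction of the tuples is still available at every exposure step.
  obtain ⟨η, hη0, hη1, h2, h2', h3, h3'⟩ : ∃ η : ℝ, 0 < η ∧ η ≤ 1 ∧ η < f₂ ∧ η < 1 - f₂ ∧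
      η < f₃ ∧ η < 1 - f₃ := by
    have hpos : 0 < min (min f₂ (1 - f₂)) (min f₃ (1 - f₃)) :=
      lt_min (lt_min hf₂ (by linarith)) (lt_min hf₃ (by linarith))
    obtain ⟨η, h0, h1⟩ := exists_between hpos
    simp only [lt_min_iff] at h1
    exact ⟨η, h0, by linarith, h1.1.1, h1.1.2, h1.2.1, h1.2.2⟩
  obtain ⟨K, t, δ, ht0, ht1, htε, -, hK⟩ :=
    RHM.eventually_frac_typical n p₂ hp₀ hp₁ hη0 hε
  have hlim : Tendsto (fun k => 1 - K / (v k : ℝ) ^ 3) atTop (𝓝 1) := by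
    have h1 : Tendsto (fun k => (v k : ℝ) ^ 3) atTop atTop :=
      (tendsto_pow_atTop (by norm_num)).comp (tendsto_natCast_atTop_atTop.comp hv)
    simpa using (h1.const_div_atTop K).const_sub 1
  refine tendsto_of_tendsto_of_tendsto_of_le_of_le' hlim tendsto_const_nhds ?_ ?_
  · filter_upwards [hv.eventually hK, RHM.eventually_sizes h2 h2' h3 h3' hv hm₂ hm₃]
      with k ⟨hv40, hρ, hfrac, hsmall⟩ hsz
    have hsc := hsz.scales (by omega) hη0 hη1 hρ
    have hne : Nonempty (RHM.Grammar (n + 1) (v k) (m₂ k) (m₃ k)) :=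
      RHM.grammar_nonempty hη0 hsz (by omega)
    have hmv : m₂ k ≤ v k := by
      have hv0 : (0 : ℝ) < v k := hsc.v_pos
      have : (m₂ k : ℝ) ≤ v k := by
        refine le_of_mul_le_mul_left ?_ hv0
        have := hsz.bin_le
        have : 0 < η * (v k : ℝ) ^ 2 := by positivity
        linarith [sq (v k : ℝ)]
      exact_mod_cast this
    have h1 := hfrac (m₂ k) (m₃ k) hsz
    rw [RHM.frac_compl] at h1
    rw [RHM.grammarProb_eq_frac]
    refine (sub_le_comm.1 h1).trans (RHM.frac_mono fun G hG => ?_)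
    refine hG.conclusion hsc hp₀ hp₁ ht0 ht1 htε hv40 (fun z => ?_) fun z => ?_
    · have := hG.sqrt_mul_errorScale_le hsc hp₀ hp₁ hv40 hmv ht0 (hsmall 1 (by simp)) z
      rwa [one_mul] at this
    · exact hG.sqrt_mul_errorScale_le hsc hp₀ hp₁ hv40 hmv ht0 (hsmall _ (by simp)) z
  · refine Filter.Eventually.of_forall fun k => ?_
    refine div_le_one_of_le₀ ?_ (by positivity)
    exact_mod_cast Finite.card_subtype_le _
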